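/- Let $(R,\mathfrak m)$ be a Noetherian local ring, $A=\bigoplus_{n\ge 0}A_n$ a standard graded Noetherian $R$-algebra (that is, $A$ is commutative and generated by $A_1$ as an $R$-algebra), and $M=\bigoplus_{n\ge 0}M_n$ a finitely generated graded $A$-module of finite Krull dimension $D\ge 0$ (in particular $M\neq 0$). For an ideal $I$ of $A$ generated by linear forms (elements of $A_1$), let $G_I(M)=\bigoplus_{i\ge 0}I^iM/I^{i+1}M$, a module over $G_I(A)=\bigoplus_{i\ge 0}I^i/I^{i+1}$, graded by the internal grading $[G_I(M)]_n=\bigoplus_{i\ge 0}[I^iM/I^{i+1}M]_n$. For $s,n\ge 0$ put $$h_I(s,n)=\sum_{u=0}^{s}\ell_R\!\left(\frac{\mathfrak m^{u}[G_I(M)]_n}{\mathfrak m^{u+1}[G_I(M)]_n}\right).$$ The numbers $c^*_k(I,M)$, $0\le k\le D-1$, are the integers $c^*_k(I,M)=a_{k,D-1-k}$ read off from the expansion $$h_I(s,n)=\sum_{\substack{k,l\ge 0\\ k+l\le D-1}}a_{k,l}\binom{s+k}{k}\binom{n+l}{l}\qquad(s,n\gg 0),\quad a_{k,l}\in\mathbb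 Z,$$ if $\dim G_I(M)=D$, and are $0$ if $\dim G_I(M)<D$. Write $\operatorname{ht}_M(I)=\min\{\dim M_{\mathfrak p}\mid \mathfrak p\in\operatorname{Supp}M\cap V(I)\}$, and for ideals $I\subseteq J$ say that $I$ is a reduction of $(J,M)$ if $IJ^nM=J^{n+1}M$ for some $n\ge 1$. **Theorem.** Let $I\subseteq J$ be ideals of $A$ generated by linear forms with $\operatorname{ht}_M(I)>0$. If $I$ is a reduction of $(J,M)$, then $h_I$ and $h_J$ take finite values and have expansions as above for $s,n\gg0$, and $$c^*_k(I,M)=c^*_k(J,M)\qquad\text{for all }k=0,\dots,D-1.$$ -/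

import Mathlib

namespace CStar

open Polynomial

section Rees

variable {R A : Type*} [CommRing R] [CommRing A] [Algebra R A]

/-- The ideal `I · 𝓡(I, A) = ⨁ᵢ I ^ (i + 1) tⁱ` of the Rees algebra `𝓡(I, A) = ⨁ᵢ Iⁱ tⁱ`. -/
noncomputable abbrev reesIdeal (I : Ideal A) : Ideal (reesAlgebra I) :=
  I.map (algebraMap A (reesAlgebra I))

/-- The associated graded ring `G_I(A) = ⨁ᵢ Iⁱ / I ^ (i + 1)`, as `𝓡(I, A) / I 𝓡(I, A)`
(which is also the extended Rees ring modulo `t⁻¹`). -/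
abbrev AssocGradedRing (I : Ideal A) : Type _ := reesAlgebra I ⧸ reesIdeal I

variable (M : Type*) [AddCommGroup M] [Module R M] [Module A M] [IsScalarTower R A M]

/-- The Rees module `𝓡(I, M) = ⨁ᵢ Iⁱ M tⁱ ⊆ M[t]`: the elements `f` of `M[t]` whose `i`-th
coefficient lies in `Iⁱ M` for all `i`. -/
def ReesModule (I : Ideal A) : Type _ :=
  ↥((I.stableFiltration (⊤ : Submodule A M)).submodule)

namespace ReesModule

variable (I : Ideal A)

noncomputable instance : AddCommGroup (ReesModule M I) :=
  inferInstanceAs (AddCommGroup ↥((I.stableFiltration (⊤ : Submodule A M)).submodule))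

noncomputable instance : Module (reesAlgebra I) (ReesModule M I) :=
  inferInstanceAs (Module (reesAlgebra I) ↥((I.stableFiltration (⊤ : Submodule A M)).submodule))

/-- The `R`-module structure, through `R → A → 𝓡(I, A)`. -/
noncomputable instance : Module R (ReesModule M I) :=
  Module.compHom _ (algebraMap R (reesAlgebra I))

instance : IsScalarTower R (reesAlgebra I) (ReesModule M I) :=
  IsScalarTower.of_algebraMap_smul fun _ _ => rfl

variable {M I}

/-- The coefficient of `tⁱ`. -/
def coeff (f : ReesModule M I) (i : ℕ) : M := f.1.coeff i

theorem coeff_add (f g : ReesModule M I) (i : ℕ) : (f + g).coeff i = f.coeff i + g.coeff i := rfl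

theorem coeff_zero (i : ℕ) : (0 : ReesModule M I).coeff i = 0 := rfl

theorem coeff_smul (r : R) (f : ReesModule M I) (i : ℕ) : (r • f).coeff i = r • f.coeff i := by
  have h : ((algebraMap A[X] A[X]) (algebraMap R A[X] r)) • f.1 = algebraMap R A r • f.1 := by
    rw [Algebra.algebraMap_self_apply, IsScalarTower.algebraMap_apply R A A[X], algebraMap_smul]
  exact (congrArg (fun g : PolynomialModule A M => g.coeff i) h).trans
    (algebraMap_smul A r (f.1.coeff i))

end ReesModule

/-- The associated graded module `G_I(M) = ⨁ᵢ Iⁱ M / I ^ (i + 1) M`, as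
`𝓡(I, M) / I 𝓡(I, M)`; it is a module over `G_I(A)`. -/
abbrev AssocGradedModule (I : Ideal A) : Type _ :=
  ReesModule M I ⧸ (reesIdeal I • ⊤ : Submodule (reesAlgebra I) (ReesModule M I))

/-- The degree `n` part `[𝓡(I, M)]ₙ = ⨁ᵢ [Iⁱ M]ₙ tⁱ` of the Rees module for the internal grading,
the one induced by the grading `𝓜` of `M`, with `t` of degree zero. -/
noncomputable def reesInternal (I : Ideal A) (𝓜 : ℕ → Submodule R M) (n : ℕ) :
    Submodule R (ReesModule M I) where
  carrier := {f | ∀ i, f.coeff i ∈ 𝓜 n}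
  add_mem' hf hg i := (𝓜 n).add_mem (hf i) (hg i)
  zero_mem' _ := (𝓜 n).zero_mem
  smul_mem' r f hf i := by
    rw [ReesModule.coeff_smul]
    exact (𝓜 n).smul_mem r (hf i)

/-- The internal grading of the associated graded module:
`[G_I(M)]ₙ = ⨁ᵢ [Iⁱ M / I ^ (i + 1) M]ₙ`. -/
noncomputable def internalGrading (I : Ideal A) (𝓜 : ℕ → Submodule R M) (n : ℕ) :
    Submodule R (AssocGradedModule M I) :=
  (reesInternal M I 𝓜 n).map
    ((Submodule.mkQ (reesIdeal I • ⊤ : Submodule (reesAlgebra I) (ReesModule M I))).restrictScalars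
      R)

end Rees

section Multiplicity

/-- For a local ring `(R, 𝔪)` and an `R`-module `N` with homogeneous parts `𝓝 j`, the value
`h_T(i, j) = ℓ(𝔪ⁱ Nⱼ / 𝔪 ^ (i + 1) Nⱼ)` of the Hilbert function of the bigraded module
`T = G_𝔪(N)`. -/
noncomputable def hilb {R N : Type*} [CommRing R] [IsLocalRing R] [AddCommGroup N] [Module R N]
    (𝓝 : ℕ → Submodule R N) (i j : ℕ) : ℕ∞ :=
  Module.length R
    (↥(IsLocalRing.maximalIdeal R ^ i • 𝓝 j) ⧸
      (IsLocalRing.maximalIdeal R ^ (i + 1) • 𝓝 j).submoduleOf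
        (IsLocalRing.maximalIdeal R ^ i • 𝓝 j))

/-- The sum transform `h_T^{(1,0)}(i, j) = ∑_{u = 0}^{i} h_T(u, j)`. -/
noncomputable def hilbSum {R N : Type*} [CommRing R] [IsLocalRing R] [AddCommGroup N] [Module R N]
    (𝓝 : ℕ → Submodule R N) (i j : ℕ) : ℕ∞ :=
  ∑ u ∈ Finset.range (i + 1), hilb 𝓝 u j

/-- For all `i, j ≫ 0`, the value `h i j` is finite and equal to
`∑_{k + l ≤ D - 1} a k l * (i + k choose k) * (j + l choose l)`. -/
def IsHilbertExpansion (h : ℕ → ℕ → ℕ∞) (D : ℕ) (a : ℕ → ℕ → ℤ) : Prop :=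
  ∃ n₀ : ℕ, ∀ i j : ℕ, n₀ ≤ i → n₀ ≤ j → ∃ v : ℕ, h i j = (v : ℕ∞) ∧
    (v : ℤ) = ∑ k ∈ Finset.range D, ∑ l ∈ Finset.range (D - k),
      a k l * ((i + k).choose k : ℤ) * ((j + l).choose l : ℤ)

open Classical in
/-- The coefficient `a_{k, D - 1 - k}` in the expansion of `h`. The numbers `a k l` with
`k + l ≤ D - 1` are determined by `h` and `D`. -/
noncomputable def topCoeff (h : ℕ → ℕ → ℕ∞) (D k : ℕ) : ℤ :=
  if H : ∃ a, IsHilbertExpansion h D a then H.choose k (D - 1 - k) else 0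

open Classical in
/-- The `c^D`-multiplicity sequence `c_k^D(N)`, `0 ≤ k < D`, of a graded `S`-module `N` with
homogeneous parts `𝓝 j` (where `dim N ≤ D`). -/
noncomputable def cMult {R N : Type*} (S : Type*) [CommRing R] [IsLocalRing R] [CommRing S]
    [AddCommGroup N] [Module R N] [Module S N] (𝓝 : ℕ → Submodule R N) (D k : ℕ) : ℤ :=
  if Module.supportDim S N = D then topCoeff (hilbSum 𝓝) D k else 0

/-- The `c^*`-multiplicity sequence `c^*_{k, D}(I, M) = c_k^D(G_I(M))`, where `G_I(M)` carries the
internal grading. -/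
noncomputable def cStar {R A M : Type*} [CommRing R] [IsLocalRing R] [CommRing A] [Algebra R A]
    [AddCommGroup M] [Module R M] [Module A M] [IsScalarTower R A M]
    (𝓜 : ℕ → Submodule R M) (I : Ideal A) (D k : ℕ) : ℤ :=
  cMult (AssocGradedRing I) (internalGrading M I 𝓜) D k

end Multiplicity

section Ideals

/-- The `M`-height `ht_M(I) = min {dim M_𝔭 | 𝔭 ∈ Supp M ∩ V(I)}`. -/
noncomputable def moduleHeight {A : Type*} (M : Type*) [CommRing A] [AddCommGroup M] [Module A M]
    (I : Ideal A) : WithBot ℕ∞ :=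
  ⨅ p ∈ Module.support A M ∩ PrimeSpectrum.zeroLocus (I : Set A),
    Module.supportDim (Localization.AtPrime p.asIdeal)
      (LocalizedModule p.asIdeal.primeCompl M)

/-- For `I ≤ J`, the ideal `I` is a reduction of `(J, M)`: `I J ^ n M = J ^ (n + 1) M` for some positive `n`
(equivalently, for all large `n`). -/
def IsReduction {A : Type*} (M : Type*) [CommRing A] [AddCommGroup M] [Module A M]
    (I J : Ideal A) : Prop :=
  ∃ n : ℕ, 0 < n ∧
    ((I * J ^ n) • ⊤ : Submodule A M) = ((J ^ (n + 1)) • ⊤ : Submodule A M)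

/-- `I` is generated by linear forms, i.e. by elements of degree one. -/
def GeneratedByLinearForms {R A : Type*} [CommRing R] [CommRing A] [Algebra R A]
    (𝓐 : ℕ → Submodule R A) (I : Ideal A) : Prop :=
  ∃ L : Set A, L ⊆ 𝓐 1 ∧ I = Ideal.span L

end Ideals

end CStar

/-! Since `I` is generated by linear forms, `IⁱM` has no part of degree `n < i`. Hence `h_I(s, n)`
is a finite sum over `i ≤ n` of the lengths of `[IⁱM / (𝔪^(s+1) IⁱM + I^(i+1)M)]ₙ`
(`hilbSum_internalGrading`). Let `q(s, n)` be the sum over `i ≤ n` of the lengths of `[JⁱM /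
(𝔪^(s+1) JⁱM + IⁱM)]ₙ`.

The quotient of `JⁱM` by `𝔪^(s+1) JⁱM + I^(i+1)M` is measured in two ways, through `IⁱM` and through
`J^(i+1)M`. Were these lengths additive, the sums over `i` would be `q + h_I` and `h_J + q`, so that
`h_I = h_J`. Additivity fails because `𝔪^(s+1) JⁱM ∩ IⁱM` may exceed `𝔪^(s+1) IⁱM`, but Artin-Rees
limits the defect to a shift of `s`: `h_I(s-c) ≤ h_J(s)` and `h_J(s) + q(s-c) ≤ q(s) + h_I(s)`
(`exists_filtLen_add_le`). The constant `c` must serve all `i` at once. It comes from Artin-Rees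
over the Rees algebra of `I`, applied to `⨁ JⁱM tⁱ`, which is finite there because `I` is a
reduction (`exists_pow_smul_inf_le`, `IsReduction.stable`).

Therefore `|h_I - h_J|` is bounded by the changes of `h_I` and `q` under a shift of `s` by `c`. Both
functions are eventually combinations of binomials of total degree at most `D - 1`, so these changes
have smaller degree and the coefficients in total degree `D - 1` agree (`topCoeff_eq_of_degLT`). The
binomial form is a Hilbert-Serre argument (`exists_relLen_eq_of_familyACC`). For the degree, `∑_{j ≤
n} h_I(s, j)` is compared with the length of `M / 𝔐^m M`, where `𝔐 = 𝔪A + A₁A` and `m` is linear in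
`s` and `n` (`exists_sum_filtLen_le`, `exists_adicLen_le`). For `q` one uses `J^(i+m)M ⊆ IⁱM`, which
gives `q ≤ m h_J`.

The definition of `c^*` also depends on whether `G_I(M)` has dimension `D`. The dimensions of
`G_I(M)` and `G_J(M)` coincide because their annihilators over the Rees algebra of `I` have the same
radical (`supportDim_assocGradedModule_eq`). -/

namespace CStar

/-! ### Relative lengths of submodules -/

section RelLen

variable {R N T : Type*} [CommRing R] [AddCommGroup N] [Module R N] [AddCommGroup T] [Module R T]

/-- The length of `V / (U ∩ V)`. -/
noncomputable def relLen (U V : Submodule R N) : ℕ∞ := Module.length R (↥V ⧸ U.submoduleOf V)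

theorem mem_submoduleOf_iff {U V : Submodule R N} {v : V} : v ∈ U.submoduleOf V ↔ (v : N) ∈ U :=
  Iff.rfl

theorem relLen_eq_of_surjective {P : Type*} [AddCommGroup P] [Module R P] {U V : Submodule R N}
    (g : V →ₗ[R] P) (hg : Function.Surjective g) (hk : ∀ v : V, g v = 0 ↔ (v : N) ∈ U) :
    relLen U V = Module.length R P := by
  have hker : LinearMap.ker g = U.submoduleOf V := by
    ext v
    rw [LinearMap.mem_ker, hk, mem_submoduleOf_iff]
  unfold relLen
  rw [← hker]
  exact (g.quotKerEquivOfSurjective hg).length_eq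

theorem relLen_inf_eq {U U' V : Submodule R N} (h : U ⊓ V = U' ⊓ V) : relLen U V = relLen U' V := by
  refine relLen_eq_of_surjective (U'.submoduleOf V).mkQ (Submodule.mkQ_surjective _) fun v ↦ ?_
  have h1 : (v : N) ∈ U ⊓ V ↔ (v : N) ∈ U' ⊓ V := by rw [h]
  simp only [Submodule.mem_inf, v.2, and_true] at h1
  rw [h1, Submodule.mkQ_apply, Submodule.Quotient.mk_eq_zero, mem_submoduleOf_iff]

theorem relLen_eq_zero {U V : Submodule R N} (h : V ≤ U) : relLen U V = 0 := by
  rw [relLen_eq_of_surjective (0 : V →ₗ[R] PUnit) (fun x ↦ ⟨0, rfl⟩)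
    fun v ↦ ⟨fun _ ↦ h v.2, fun _ ↦ rfl⟩]
  exact Module.length_eq_zero

theorem relLen_map (f : N →ₗ[R] T) (X Y : Submodule R N) :
    relLen (X.map f) (Y.map f) = relLen (X ⊔ LinearMap.ker f) Y := by
  symm
  refine relLen_eq_of_surjective (((X.map f).submoduleOf (Y.map f)).mkQ ∘ₗ f.submoduleMap Y)
    ((Submodule.mkQ_surjective _).comp (f.submoduleMap_surjective Y)) fun v ↦ ?_
  rw [← Submodule.comap_map_eq, LinearMap.comp_apply, Submodule.mkQ_apply,
    Submodule.Quotient.mk_eq_zero, mem_submoduleOf_iff]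
  rfl

/-- The length is additive along `V / X → V / (X + W)`, with kernel `W / (X ∩ W)`. -/
theorem relLen_eq_add (X : Submodule R N) {V W : Submodule R N} (h : W ≤ V) :
    relLen X V = relLen (X ⊔ W) V + relLen X W := by
  set K : Submodule R (↥V ⧸ X.submoduleOf V) :=
    (W.submoduleOf V).map (X.submoduleOf V).mkQ with hK
  have h1 : relLen X V = Module.length R K + Module.length R ((↥V ⧸ X.submoduleOf V) ⧸ K) :=
    Module.length_eq_add_of_exact K.subtype K.mkQ K.injective_subtype K.mkQ_surjective
      (LinearMap.exact_subtype_mkQ K)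
  have h2 : relLen X W = Module.length R K := by
    refine relLen_eq_of_surjective (((X.submoduleOf V).mkQ ∘ₗ Submodule.inclusion h).codRestrict K
      fun w ↦ Submodule.mem_map_of_mem w.2) ?_ fun w ↦ ?_
    · rintro ⟨_, v, hv, rfl⟩
      exact ⟨⟨v, hv⟩, rfl⟩
    · rw [← Subtype.coe_inj, LinearMap.codRestrict_apply, LinearMap.comp_apply,
        Submodule.mkQ_apply, ZeroMemClass.coe_zero, Submodule.Quotient.mk_eq_zero,
        mem_submoduleOf_iff]
      rfl
  have h3 : relLen (X ⊔ W) V = Module.length R ((↥V ⧸ X.submoduleOf V) ⧸ K) := by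
    refine relLen_eq_of_surjective (K.mkQ ∘ₗ (X.submoduleOf V).mkQ)
      (K.mkQ_surjective.comp (Submodule.mkQ_surjective _)) fun v ↦ ?_
    rw [LinearMap.comp_apply, Submodule.mkQ_apply K, Submodule.Quotient.mk_eq_zero, hK,
      ← Submodule.mem_comap, Submodule.comap_map_eq, Submodule.ker_mkQ]
    simp only [Submodule.mem_sup]
    constructor
    · rintro ⟨y, hy, z, hz, rfl⟩
      exact ⟨z, hz, y, hy, by rw [Submodule.coe_add, add_comm]⟩
    · rintro ⟨z, hz, y, hy, hyz⟩
      refine ⟨⟨y, h hy⟩, hy, ⟨z, ?_⟩, hz, Subtype.ext (by rw [← hyz, add_comm]; rfl)⟩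
      rw [eq_sub_of_add_eq hyz]
      exact V.sub_mem v.2 (h hy)
  rw [h1, h2, h3, add_comm]

theorem relLen_antitone {U U' V : Submodule R N} (h : U ⊓ V ≤ U') : relLen U' V ≤ relLen U V := by
  have h1 : relLen U V = relLen (U ⊓ V) V := relLen_inf_eq (by simp)
  have h2 : relLen U' V = relLen (U ⊓ V ⊔ U' ⊓ V) V := by
    rw [sup_eq_right.2 (le_inf h inf_le_right)]
    exact relLen_inf_eq (by simp)
  rw [h1, h2, relLen_eq_add (U ⊓ V) (inf_le_right : U' ⊓ V ≤ V)]
  exact le_self_add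

theorem relLen_mono {U V V' : Submodule R N} (h : V ≤ V') : relLen U V ≤ relLen U V' := by
  rw [relLen_eq_add U h]
  exact le_add_self

theorem relLen_add_relLen {U V W : Submodule R N} (hUW : U ≤ W) (hWV : W ≤ V) :
    relLen U V = relLen U W + relLen W V := by
  rw [relLen_eq_add U hWV, sup_eq_right.2 hUW, add_comm]

theorem relLen_sup {A C : Submodule R N} : relLen A (A ⊔ C) = relLen A C := by
  rw [relLen_eq_add A (le_sup_right : C ≤ A ⊔ C), relLen_eq_zero le_rfl, zero_add]

theorem relLen_of_decreasing {W : ℕ → Submodule R N} (hW : Antitone W) (s : ℕ) :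
    ∑ u ∈ Finset.range s, relLen (W (u + 1)) (W u) = relLen (W s) (W 0) := by
  induction s with
  | zero => simp [relLen_eq_zero]
  | succ s ih =>
    rw [Finset.sum_range_succ, ih, add_comm,
      ← relLen_add_relLen (hW s.le_succ) (hW (Nat.zero_le s))]

/-- Additivity iterated along the filtration of `W 0 / X` induced by `W`; the last summand is what
remains after `s` steps. -/
theorem sum_relLen_le {W : ℕ → Submodule R N} (hW : Antitone W) (X : Submodule R N) (s : ℕ) :
    ∑ u ∈ Finset.range s, relLen (X ⊔ W (u + 1)) (W u) + relLen X (W s) = relLen X (W 0) := by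
  induction s with
  | zero => simp
  | succ s ih =>
    rw [Finset.sum_range_succ, ← ih, add_assoc, relLen_eq_add X (hW s.le_succ)]

theorem relLen_top_eq (U : Submodule R N) : relLen U ⊤ = Module.length R (N ⧸ U) := by
  refine relLen_eq_of_surjective (U.mkQ ∘ₗ Submodule.subtype ⊤) ?_ fun v ↦ by simp
  intro x
  obtain ⟨x, rfl⟩ := Submodule.mkQ_surjective _ x
  exact ⟨⟨x, trivial⟩, rfl⟩

/-- The sum over `u ≤ s` telescopes along the `𝔪`-adic filtration. -/
theorem hilbSum_eq_relLen [IsLocalRing R] (𝓝 : ℕ → Submodule R N) (s j : ℕ) :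
    hilbSum 𝓝 s j = relLen (IsLocalRing.maximalIdeal R ^ (s + 1) • 𝓝 j) (𝓝 j) := by
  have h := relLen_of_decreasing (W := fun u ↦ IsLocalRing.maximalIdeal R ^ u • 𝓝 j)
    (fun a b h ↦ Submodule.smul_mono_left (Ideal.pow_le_pow_right h)) (s + 1)
  simp only [pow_zero, Ideal.one_eq_top, Submodule.top_smul] at h
  exact h

end RelLen

end CStar

namespace CStar

/-! ### Binomial expansions in two variables and their growth -/

section Binomial

open Filter Topology

/-- The value `C(s + k, k) C(n + l, l)` of a product of binomial polynomials, `x = (k, l)`. -/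
def binom₂ (x : ℕ × ℕ) (s n : ℕ) : ℤ := ((s + x.1).choose x.1 : ℤ) * ((n + x.2).choose x.2 : ℤ)

theorem choose_add_le_pow (s k : ℕ) : (s + k).choose k ≤ (s + 1) ^ k := by
  induction k with
  | zero => simp
  | succ k ih =>
    have h := Nat.add_one_mul_choose_eq (s + k) k
    have h2 : (s + k + 1).choose (k + 1) * (k + 1) ≤ (s + 1) ^ (k + 1) * (k + 1) := by
      rw [← h]
      calc (s + k + 1) * (s + k).choose k ≤ ((s + 1) * (k + 1)) * (s + 1) ^ k :=
            Nat.mul_le_mul (by nlinarith [Nat.zero_le (s * k)]) ih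
        _ = _ := by ring
    exact Nat.le_of_mul_le_mul_right h2 k.succ_pos

/-- By Pascal's rule a shift by `c` adds `c` binomials of one degree less. The factor `s + 1` on the
left replaces the exponent `k - 1` on the right, so that for `k = 0` no separate convention is
needed. -/
theorem choose_add_sub_le (c s k : ℕ) :
    (s + 1) * ((s + c + k).choose k - (s + k).choose k) ≤ c * (c + 1) ^ k * (s + 1) ^ k := by
  suffices h : (s + c + 1) * (s + c + k).choose k
      ≤ (s + c + 1) * (s + k).choose k + c * (s + c + 1) ^ k by
    have h1 : (s + c + 1) * ((s + c + k).choose k - (s + k).choose k) ≤ c * (s + c + 1) ^ k := by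
      rw [Nat.mul_sub]
      omega
    calc (s + 1) * ((s + c + k).choose k - (s + k).choose k)
        ≤ (s + c + 1) * ((s + c + k).choose k - (s + k).choose k) :=
          Nat.mul_le_mul_right _ (by omega)
      _ ≤ c * (s + c + 1) ^ k := h1
      _ ≤ c * ((c + 1) * (s + 1)) ^ k :=
          Nat.mul_le_mul_left _ (Nat.pow_le_pow_left (by nlinarith [Nat.zero_le (c * s)]) _)
      _ = _ := by rw [mul_pow, mul_assoc]
  cases k with
  | zero => simp
  | succ k =>
    suffices h : (s + c + (k + 1)).choose (k + 1)
        ≤ (s + (k + 1)).choose (k + 1) + c * (s + c + 1) ^ k by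
      calc _ ≤ (s + c + 1) * ((s + (k + 1)).choose (k + 1) + c * (s + c + 1) ^ k) :=
            Nat.mul_le_mul_left _ h
        _ = _ := by ring
    induction c with
    | zero => simp
    | succ c ih =>
      have h1 : (s + (c + 1) + (k + 1)).choose (k + 1)
          = (s + (c + 1) + k).choose k + (s + c + (k + 1)).choose (k + 1) := by
        have := Nat.choose_succ_succ (s + (c + 1) + k) k
        rw [show s + c + (k + 1) = s + (c + 1) + k by ring]
        exact this
      have h2 := choose_add_le_pow (s + (c + 1)) k
      have h3 : (s + c + 1) ^ k ≤ (s + (c + 1) + 1) ^ k := Nat.pow_le_pow_left (by omega) _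
      rw [h1]
      nlinarith

theorem choose_shift_bound (c k : ℕ) : ∃ K : ℤ, 0 ≤ K ∧ ∀ s n : ℕ,
    0 ≤ ((s + c + k).choose k : ℤ) - ((s + k).choose k : ℤ) ∧
    ((s : ℤ) + n + 1) * (((s + c + k).choose k : ℤ) - ((s + k).choose k : ℤ)) ≤
      K * ((s : ℤ) + n + 1) ^ k := by
  refine ⟨c * (c + 1) ^ k, by positivity, fun s n ↦ ?_⟩
  have hle : (s + k).choose k ≤ (s + c + k).choose k := Nat.choose_le_choose _ (by omega)
  refine ⟨by have : ((s + k).choose k : ℤ) ≤ _ := Int.ofNat_le.2 hle; linarith, ?_⟩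
  cases k with
  | zero => simp
  | succ k =>
    have h := choose_add_sub_le c s (k + 1)
    have h' : (s + 1) * ((s + c + (k + 1)).choose (k + 1) - (s + (k + 1)).choose (k + 1)) ≤
        (s + 1) * (c * (c + 1) ^ (k + 1) * (s + 1) ^ k) := by
      refine h.trans (le_of_eq (by ring))
    have h2 := Nat.le_of_mul_le_mul_left h' s.succ_pos
    have h3 : ((s + c + (k + 1)).choose (k + 1) : ℤ) - ((s + (k + 1)).choose (k + 1) : ℤ) ≤
        c * (c + 1) ^ (k + 1) * ((s : ℤ) + 1) ^ k := by
      rw [← Nat.cast_sub hle]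
      exact_mod_cast h2
    have h4 : ((s : ℤ) + 1) ^ k ≤ ((s : ℤ) + n + 1) ^ k :=
      pow_le_pow_left₀ (by positivity) (by linarith [Int.natCast_nonneg n]) _
    calc _ ≤ ((s : ℤ) + n + 1) * (c * (c + 1) ^ (k + 1) * ((s : ℤ) + n + 1) ^ k) := by
          refine mul_le_mul_of_nonneg_left (h3.trans ?_) (by positivity)
          exact mul_le_mul_of_nonneg_left h4 (by positivity)
      _ = _ := by ring

/-- The product difference `AB - A'B' = (A - A')B + A'(B - B')` reduces this to one variable; each
summand loses one degree in one factor. -/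
theorem binom₂_shift_bound (c d : ℕ) (x : ℕ × ℕ) : ∃ K : ℤ, 0 ≤ K ∧ ∀ s n : ℕ,
    ((s : ℤ) + n + 1) * |binom₂ x (s + c) (n + d) - binom₂ x s n| ≤
      K * ((s : ℤ) + n + 1) ^ (x.1 + x.2) := by
  obtain ⟨K₁, hK₁, h₁⟩ := choose_shift_bound c x.1
  obtain ⟨K₂, hK₂, h₂⟩ := choose_shift_bound d x.2
  refine ⟨K₁ * (d + 1) ^ x.2 + K₂, by positivity, fun s n ↦ ?_⟩
  obtain ⟨hA0, hA⟩ := h₁ s n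
  obtain ⟨hB0, hB⟩ := h₂ n s
  rw [show (n : ℤ) + s + 1 = s + n + 1 by ring] at hB
  have hB' : ((n + d + x.2).choose x.2 : ℤ) ≤ (d + 1) ^ x.2 * ((s : ℤ) + n + 1) ^ x.2 := by
    calc ((n + d + x.2).choose x.2 : ℤ) ≤ ((n + d : ℕ) + 1 : ℤ) ^ x.2 :=
          mod_cast choose_add_le_pow (n + d) x.2
      _ ≤ ((d + 1) * ((s : ℤ) + n + 1)) ^ x.2 := by
          refine pow_le_pow_left₀ (by positivity) ?_ _
          push_cast
          nlinarith [Int.natCast_nonneg n, Int.natCast_nonneg s, Int.natCast_nonneg d,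
            mul_nonneg (Int.natCast_nonneg d) (Int.natCast_nonneg s),
            mul_nonneg (Int.natCast_nonneg d) (Int.natCast_nonneg n)]
      _ = _ := mul_pow _ _ _
  have hA' : ((s + x.1).choose x.1 : ℤ) ≤ ((s : ℤ) + n + 1) ^ x.1 := by
    calc ((s + x.1).choose x.1 : ℤ) ≤ ((s : ℤ) + 1) ^ x.1 := mod_cast choose_add_le_pow s x.1
      _ ≤ _ := pow_le_pow_left₀ (by positivity) (by linarith [Int.natCast_nonneg n]) _
  unfold binom₂
  set A := ((s + c + x.1).choose x.1 : ℤ)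
  set A' := ((s + x.1).choose x.1 : ℤ)
  set B := ((n + d + x.2).choose x.2 : ℤ)
  set B' := ((n + x.2).choose x.2 : ℤ)
  set t := (s : ℤ) + n + 1
  have ht : 0 ≤ t := by positivity
  have hA'0 : 0 ≤ A' := by positivity
  have hB0' : 0 ≤ B := by positivity
  rw [show A * B - A' * B' = (A - A') * B + A' * (B - B') by ring,
    abs_of_nonneg (by positivity)]
  calc t * ((A - A') * B + A' * (B - B')) = (t * (A - A')) * B + A' * (t * (B - B')) := by ring
    _ ≤ (K₁ * t ^ x.1) * ((d + 1) ^ x.2 * t ^ x.2) + t ^ x.1 * (K₂ * t ^ x.2) := by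
        refine add_le_add (mul_le_mul hA hB' hB0' (by positivity))
          (mul_le_mul hA' hB (by positivity) (by positivity))
    _ = _ := by ring

theorem tendsto_choose_div_pow (p k : ℕ) :
    Tendsto (fun m : ℕ ↦ ((p * m + k).choose k : ℝ) / (m : ℝ) ^ k) atTop
      (𝓝 ((p : ℝ) ^ k / (k.factorial : ℝ))) := by
  induction k with
  | zero => simp
  | succ k ih =>
    have h1 : Tendsto (fun m : ℕ ↦ ((p : ℝ) + ((k : ℝ) + 1) / (m : ℝ)) / ((k : ℝ) + 1)) atTop
        (𝓝 (((p : ℝ) + 0) / ((k : ℝ) + 1))) :=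
      (tendsto_const_nhds.add (tendsto_const_div_atTop_nhds_zero_nat _)).div_const _
    have h2 := ih.mul h1
    have h3 : (p : ℝ) ^ (k + 1) / ((k + 1).factorial : ℝ)
        = (p : ℝ) ^ k / (k.factorial : ℝ) * (((p : ℝ) + 0) / ((k : ℝ) + 1)) := by
      rw [Nat.factorial_succ]
      push_cast
      have : (k.factorial : ℝ) ≠ 0 := by positivity
      field_simp
      ring
    rw [h3]
    refine h2.congr' ?_
    filter_upwards [eventually_gt_atTop 0] with m hm
    have hm' : (m : ℝ) ≠ 0 := by positivity
    have h4 : ((p * m + k + 1 : ℕ) : ℝ) * ((p * m + k).choose k : ℝ)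
        = ((p * m + k + 1).choose (k + 1) : ℝ) * ((k + 1 : ℕ) : ℝ) := by
      exact_mod_cast Nat.add_one_mul_choose_eq (p * m + k) k
    have h5 : ((p * m + (k + 1)).choose (k + 1) : ℝ)
        = ((p * m + k + 1 : ℕ) : ℝ) * ((p * m + k).choose k : ℝ) / ((k : ℝ) + 1) := by
      rw [h4]
      push_cast
      rw [mul_div_assoc, div_self (by positivity), mul_one, add_assoc]
    rw [h5]
    push_cast
    field_simp
    ring

/-- `f` is bounded by a multiple of `(s + n + 1) ^ (e - 1)`, and vanishes if `e = 0`,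
for `s, n ≫ 0`; the latter is forced for functions with integral values. -/
def DegLT (e : ℕ) (f : ℕ → ℕ → ℤ) : Prop :=
  ∃ (C : ℤ) (n₀ : ℕ), 0 ≤ C ∧ ∀ s n, n₀ ≤ s → n₀ ≤ n →
    ((s : ℤ) + n + 1) * |f s n| ≤ C * ((s : ℤ) + n + 1) ^ e

theorem DegLT.of_abs_le {e : ℕ} {f g : ℕ → ℕ → ℤ} (hg : DegLT e g) {n₁ : ℕ}
    (h : ∀ s n, n₁ ≤ s → n₁ ≤ n → |f s n| ≤ |g s n|) : DegLT e f := by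
  obtain ⟨C, n₀, hC, hg⟩ := hg
  refine ⟨C, max n₀ n₁, hC, fun s n hs hn ↦ ?_⟩
  exact (mul_le_mul_of_nonneg_left (h s n (le_of_max_le_right hs) (le_of_max_le_right hn))
    (by positivity)).trans (hg s n (le_of_max_le_left hs) (le_of_max_le_left hn))

theorem DegLT.add {e : ℕ} {f g : ℕ → ℕ → ℤ} (hf : DegLT e f) (hg : DegLT e g) :
    DegLT e (fun s n ↦ f s n + g s n) := by
  obtain ⟨C, n₀, hC, hf⟩ := hf
  obtain ⟨C', n₁, hC', hg⟩ := hg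
  refine ⟨C + C', max n₀ n₁, by positivity, fun s n hs hn ↦ ?_⟩
  have h1 := hf s n (le_of_max_le_left hs) (le_of_max_le_left hn)
  have h2 := hg s n (le_of_max_le_right hs) (le_of_max_le_right hn)
  calc _ ≤ ((s : ℤ) + n + 1) * (|f s n| + |g s n|) :=
        mul_le_mul_of_nonneg_left (abs_add_le _ _) (by positivity)
    _ ≤ _ := by linarith

theorem DegLT.sum {ι : Type*} (S : Finset ι) {e : ℕ} {f : ι → ℕ → ℕ → ℤ}
    (hf : ∀ i ∈ S, DegLT e (f i)) : DegLT e (fun s n ↦ ∑ i ∈ S, f i s n) := by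
  classical
  induction S using Finset.induction_on with
  | empty => exact ⟨0, 0, le_rfl, fun s n _ _ ↦ by simp⟩
  | insert a S ha ih =>
    simp only [Finset.sum_insert ha]
    exact (hf a (Finset.mem_insert_self _ _)).add
      (ih fun i hi ↦ hf i (Finset.mem_insert_of_mem hi))

theorem DegLT.const_mul {e : ℕ} {f : ℕ → ℕ → ℤ} (hf : DegLT e f) (c : ℤ) :
    DegLT e (fun s n ↦ c * f s n) := by
  obtain ⟨C, n₀, hC, hf⟩ := hf
  refine ⟨|c| * C, n₀, by positivity, fun s n hs hn ↦ ?_⟩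
  rw [abs_mul]
  calc _ = |c| * (((s : ℤ) + n + 1) * |f s n|) := by ring
    _ ≤ |c| * (C * ((s : ℤ) + n + 1) ^ e) :=
        mul_le_mul_of_nonneg_left (hf s n hs hn) (abs_nonneg c)
    _ = _ := by ring

/-- A combination of binomials in which only terms of total degree `< e` occur is shifted by a
function of smaller degree. -/
theorem DegLT.shift_sub {e : ℕ} {f : ℕ → ℕ → ℤ} {S : Finset (ℕ × ℕ)} {a : ℕ × ℕ → ℤ} {n₀ : ℕ}
    (hf : ∀ s n, n₀ ≤ s → n₀ ≤ n → f s n = ∑ x ∈ S, a x * binom₂ x s n)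
    (ha : ∀ x ∈ S, e ≤ x.1 + x.2 → a x = 0) (c d : ℕ) :
    DegLT (e - 1) (fun s n ↦ f (s + c) (n + d) - f s n) := by
  have h : DegLT (e - 1) (fun s n ↦ ∑ x ∈ S, a x * (binom₂ x (s + c) (n + d) - binom₂ x s n)) := by
    refine DegLT.sum S fun x hx ↦ ?_
    by_cases hxe : e ≤ x.1 + x.2
    · exact ⟨0, 0, le_rfl, fun s n _ _ ↦ by simp [ha x hx hxe]⟩
    · obtain ⟨K, hK, h⟩ := binom₂_shift_bound c d x
      refine DegLT.const_mul ⟨K, 0, hK, fun s n _ _ ↦ (h s n).trans ?_⟩ _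
      exact mul_le_mul_of_nonneg_left (pow_le_pow_right₀
        (by have := Int.natCast_nonneg s; have := Int.natCast_nonneg n; linarith) (by omega)) hK
  refine h.of_abs_le (n₁ := n₀) fun s n hs hn ↦ ?_
  rw [hf s n hs hn, hf _ _ (by omega) (by omega), ← Finset.sum_sub_distrib]
  simp only [mul_sub]
  exact le_rfl

/-- The growth of a combination of binomials bounds the total degree of its terms. -/
theorem DegLT.coeff_eq_zero {e : ℕ} {f : ℕ → ℕ → ℤ} {S : Finset (ℕ × ℕ)} {a : ℕ × ℕ → ℤ} {n₀ : ℕ}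
    (hf : ∀ s n, n₀ ≤ s → n₀ ≤ n → f s n = ∑ x ∈ S, a x * binom₂ x s n)
    (hdeg : DegLT e f) : ∀ x ∈ S, e ≤ x.1 + x.2 → a x = 0 := by
  by_contra! hcon
  obtain ⟨x₀, hx₀S, hx₀e, hx₀⟩ := hcon
  -- Take a term of maximal total degree `δ ≥ e` with nonzero coefficient; the contradiction comes
  -- from the leading form of degree `δ`.
  obtain ⟨y, hyT, hymax⟩ := (S.filter (fun x ↦ a x ≠ 0)).exists_max_image (fun x ↦ x.1 + x.2)
    ⟨x₀, by simp [hx₀S, hx₀]⟩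
  set δ := y.1 + y.2 with hδ
  have hyS : y ∈ S := (Finset.mem_filter.1 hyT).1
  have hy0 : a y ≠ 0 := (Finset.mem_filter.1 hyT).2
  have hmax : ∀ x ∈ S, δ < x.1 + x.2 → a x = 0 := fun x hx hlt ↦ by
    by_contra hne
    exact absurd (hymax x (by simp [hx, hne])) (by omega)
  have hδe : e ≤ δ := hx₀e.trans (hymax x₀ (by simp [hx₀S, hx₀]))
  -- `P` is the dehomogenized leading form: along the ray `(p m, m)` the quotient `f / m ^ δ` tends
  -- to `P(p)`.
  set P : Polynomial ℝ := ∑ x ∈ S, if x.1 + x.2 = δ then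
    Polynomial.monomial x.1 ((a x : ℝ) / ((x.1.factorial : ℝ) * (x.2.factorial : ℝ))) else 0 with hP
  have hlim : ∀ p : ℕ, p ≠ 0 → Tendsto (fun m : ℕ ↦ (f (p * m) m : ℝ) / (m : ℝ) ^ δ) atTop
      (𝓝 (P.eval (p : ℝ))) := by
    intro p hp
    have hterm : ∀ x ∈ S, Tendsto (fun m : ℕ ↦ ((a x * binom₂ x (p * m) m : ℤ) : ℝ) / (m : ℝ) ^ δ)
        atTop (𝓝 (if x.1 + x.2 = δ then
          (a x : ℝ) / ((x.1.factorial : ℝ) * (x.2.factorial : ℝ)) * (p : ℝ) ^ x.1 else 0)) := by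
      intro x hx
      rcases lt_trichotomy (x.1 + x.2) δ with hlt | heq | hgt
      · rw [if_neg hlt.ne]
        have h1 := ((tendsto_choose_div_pow p x.1).mul (tendsto_choose_div_pow 1 x.2)).const_mul
          (a x : ℝ)
        have h2 : Tendsto (fun m : ℕ ↦ ((m : ℝ) ^ (δ - (x.1 + x.2)))⁻¹) atTop (𝓝 0) :=
          ((tendsto_pow_atTop (by omega)).comp tendsto_natCast_atTop_atTop).inv_tendsto_atTop
        have h3 := h1.mul h2
        rw [mul_zero] at h3
        refine h3.congr' ?_
        filter_upwards [eventually_gt_atTop 0] with m hm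
        have hm' : (m : ℝ) ≠ 0 := by positivity
        have h4 : (m : ℝ) ^ δ = (m : ℝ) ^ x.1 * (m : ℝ) ^ x.2 * (m : ℝ) ^ (δ - (x.1 + x.2)) := by
          rw [← pow_add, ← pow_add]
          congr 1
          omega
        rw [h4]
        unfold binom₂
        push_cast
        rw [one_mul]
        field_simp
      · rw [if_pos heq]
        have h1 := ((tendsto_choose_div_pow p x.1).mul (tendsto_choose_div_pow 1 x.2)).const_mul
          (a x : ℝ)
        have h5 : (a x : ℝ) / ((x.1.factorial : ℝ) * (x.2.factorial : ℝ)) * (p : ℝ) ^ x.1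
            = (a x : ℝ) * ((p : ℝ) ^ x.1 / (x.1.factorial : ℝ) *
              (((1 : ℕ) : ℝ) ^ x.2 / (x.2.factorial : ℝ))) := by
          simp only [Nat.cast_one, one_pow]
          field_simp
        rw [h5]
        refine h1.congr' ?_
        filter_upwards [eventually_gt_atTop 0] with m hm
        have hm' : (m : ℝ) ≠ 0 := by positivity
        rw [← heq, pow_add]
        unfold binom₂
        push_cast
        rw [one_mul]
        field_simp
      · rw [if_neg hgt.ne', hmax x hx hgt]
        simp
    have hsum := tendsto_finsetSum S hterm
    have hPe : P.eval (p : ℝ) = ∑ x ∈ S, (if x.1 + x.2 = δ then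
          (a x : ℝ) / ((x.1.factorial : ℝ) * (x.2.factorial : ℝ)) * (p : ℝ) ^ x.1 else 0) := by
      rw [hP, Polynomial.eval_finsetSum]
      refine Finset.sum_congr rfl fun x _ ↦ ?_
      split_ifs <;> simp
    rw [hPe]
    refine hsum.congr' ?_
    filter_upwards [eventually_ge_atTop n₀] with m hm
    rw [hf (p * m) m (hm.trans (Nat.le_mul_of_pos_left m (Nat.pos_of_ne_zero hp))) hm]
    push_cast
    rw [Finset.sum_div]
  -- On that ray the growth bound gives `m |f| ≤ C (p + 2) ^ e m ^ δ`, so the limit must be zero.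
  have hzero : ∀ p : ℕ, p ≠ 0 → P.eval (p : ℝ) = 0 := by
    intro p hp
    obtain ⟨C, n₁, hC, hbound⟩ := hdeg
    refine tendsto_nhds_unique (hlim p hp) ?_
    refine squeeze_zero_norm' (a := fun m : ℕ ↦ ((C * (p + 2) ^ e : ℤ) : ℝ) / (m : ℝ)) ?_
      (tendsto_const_div_atTop_nhds_zero_nat _)
    filter_upwards [eventually_ge_atTop n₁, eventually_gt_atTop 0] with m hm hm0
    have h1 := hbound (p * m) m (hm.trans (Nat.le_mul_of_pos_left m (Nat.pos_of_ne_zero hp))) hm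
    have hm1 : (1 : ℤ) ≤ m := by exact_mod_cast hm0
    have hp0 : (0 : ℤ) ≤ p := Int.natCast_nonneg p
    have h2 : (m : ℤ) * |f (p * m) m| ≤ (C * (p + 2) ^ e) * (m : ℤ) ^ δ := by
      push_cast at h1
      calc (m : ℤ) * |f (p * m) m| ≤ ((p : ℤ) * m + m + 1) * |f (p * m) m| :=
            mul_le_mul_of_nonneg_right (by nlinarith) (abs_nonneg _)
        _ ≤ C * ((p : ℤ) * m + m + 1) ^ e := h1
        _ ≤ C * (((p : ℤ) + 2) * m) ^ e :=
            mul_le_mul_of_nonneg_left (pow_le_pow_left₀ (by positivity) (by nlinarith) _) hC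
        _ = (C * (p + 2) ^ e) * (m : ℤ) ^ e := by rw [mul_pow]; ring
        _ ≤ _ := mul_le_mul_of_nonneg_left (pow_le_pow_right₀ hm1 hδe) (by positivity)
    have hmr : (0 : ℝ) < m := by exact_mod_cast hm0
    rw [Real.norm_eq_abs, abs_div, abs_of_pos (pow_pos hmr δ), div_le_div_iff₀ (pow_pos hmr δ) hmr,
      mul_comm]
    exact_mod_cast h2
  have hP0 : P = 0 := by
    refine Polynomial.eq_zero_of_infinite_isRoot P (Set.Infinite.mono (s := Set.range
      fun p : ℕ ↦ ((p + 1 : ℕ) : ℝ)) ?_ (Set.infinite_range_of_injective fun a b h ↦ ?_))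
    · rintro _ ⟨p, rfl⟩
      exact hzero (p + 1) (Nat.succ_ne_zero p)
    · simpa using h
  -- No cancellation occurs in this coefficient: in total degree `δ` the first exponent determines
  -- the second.
  have hc : P.coeff y.1 = (a y : ℝ) / ((y.1.factorial : ℝ) * (y.2.factorial : ℝ)) := by
    rw [hP, Polynomial.finsetSum_coeff, Finset.sum_eq_single y]
    · rw [if_pos hδ.symm, Polynomial.coeff_monomial_same]
    · intro x _ hxy
      split_ifs with hx
      · rw [Polynomial.coeff_monomial, if_neg]
        intro h1
        exact hxy (Prod.ext h1 (by omega))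
      · simp
    · exact fun h ↦ absurd hyS h
  rw [hP0, Polynomial.coeff_zero] at hc
  have : (a y : ℝ) ≠ 0 := by exact_mod_cast hy0
  exact (div_ne_zero this (by positivity)) hc.symm

/-- The functions of one variable which are eventually integral combinations of the
binomials `C(s + k, k)`. -/
def evBinom : AddSubgroup (ℕ → ℤ) :=
  AddSubgroup.closure ({u | ∃ k : ℕ, ∀ s, u s = ((s + k).choose k : ℤ)} ∪
    {u | ∃ n₀ : ℕ, ∀ s, n₀ ≤ s → u s = 0})

/-- The additive group spanned by the products `u s * v n` with `u, v` in `evBinom`. -/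
def evBinom₂ : AddSubgroup (ℕ → ℕ → ℤ) :=
  AddSubgroup.closure {f | ∃ u ∈ evBinom, ∃ v ∈ evBinom, ∀ s n, f s n = u s * v n}

theorem mem_evBinom_of_choose {u : ℕ → ℤ} (k : ℕ) (h : ∀ s, u s = ((s + k).choose k : ℤ)) :
    u ∈ evBinom :=
  AddSubgroup.subset_closure (Or.inl ⟨k, h⟩)

theorem mem_evBinom_of_eventually {u : ℕ → ℤ} (n₀ : ℕ) (h : ∀ s, n₀ ≤ s → u s = 0) :
    u ∈ evBinom :=
  AddSubgroup.subset_closure (Or.inr ⟨n₀, h⟩)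

/-- Binomials sum to binomials (hockey stick), and the partial sums of an eventually zero function
are eventually constant. Together with shifts, this is all that the Hilbert-Serre induction needs.
-/
theorem sum_mem_evBinom {u : ℕ → ℤ} (hu : u ∈ evBinom) :
    (fun s ↦ ∑ i ∈ Finset.range (s + 1), u i) ∈ evBinom := by
  induction hu using AddSubgroup.closure_induction with
  | mem u hu =>
    rcases hu with ⟨k, hk⟩ | ⟨n₀, h⟩
    · refine mem_evBinom_of_choose (k + 1) fun s ↦ ?_
      simp only [hk]
      induction s with
      | zero => simp
      | succ s ih =>
        rw [Finset.sum_range_succ, ih]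
        have := Nat.choose_succ_succ (s + 1 + k) k
        rw [show s + 1 + (k + 1) = s + 1 + k + 1 by ring, show s + (k + 1) = s + 1 + k by ring]
        push_cast [this]
        ring
    · set c := ∑ i ∈ Finset.range n₀, u i with hc
      have h1 : (fun s ↦ ∑ i ∈ Finset.range (s + 1), u i)
          = c • (fun _ ↦ (1 : ℤ)) + fun s ↦ ∑ i ∈ Finset.range (s + 1), u i - c := by
        ext s; simp
      rw [h1]
      refine add_mem (zsmul_mem (mem_evBinom_of_choose 0 fun s ↦ by simp) _)
        (mem_evBinom_of_eventually n₀ fun s hs ↦ ?_)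
      rw [sub_eq_zero, hc]
      refine (Finset.sum_subset (Finset.range_mono (by omega)) fun x _ hx ↦ h x ?_).symm
      simpa using hx
  | zero => exact mem_evBinom_of_eventually 0 fun s _ ↦ by simp
  | add u v _ _ hu hv =>
    simp only [Pi.add_apply, Finset.sum_add_distrib]
    exact add_mem hu hv
  | neg u _ hu =>
    simp only [Pi.neg_apply, Finset.sum_neg_distrib]
    exact neg_mem hu

/-- Pascal's rule, with the value `0` inserted at the origin. The shift of the constant `1` is `1`
minus a function supported at `0`, which is why eventually zero functions are among the generators.
-/
theorem shift_mem_evBinom {u : ℕ → ℤ} (hu : u ∈ evBinom) :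
    (fun s ↦ if s = 0 then 0 else u (s - 1)) ∈ evBinom := by
  induction hu using AddSubgroup.closure_induction with
  | mem u hu =>
    rcases hu with ⟨k, hk⟩ | ⟨n₀, h⟩
    · rcases k with _ | k
      · have h1 : (fun s ↦ if s = 0 then 0 else u (s - 1))
            = (fun _ ↦ (1 : ℤ)) - fun s ↦ if s = 0 then 1 else 0 := by
          ext s; by_cases hs : s = 0 <;> simp [hs, hk]
        rw [h1]
        refine sub_mem (mem_evBinom_of_choose 0 fun s ↦ by simp)
          (mem_evBinom_of_eventually 1 fun s hs ↦ ?_)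
        rw [if_neg (by omega)]
      · have h1 : (fun s ↦ if s = 0 then 0 else u (s - 1))
            = (fun s ↦ ((s + (k + 1)).choose (k + 1) : ℤ)) - fun s ↦ ((s + k).choose k : ℤ) := by
          ext s
          rcases s with _ | s
          · simp
          · have := Nat.choose_succ_succ (s + 1 + k) k
            simp only [Nat.succ_ne_zero, if_false, Nat.add_sub_cancel, hk, Pi.sub_apply]
            rw [show s + 1 + (k + 1) = s + 1 + k + 1 by ring, show s + (k + 1) = s + 1 + k by ring]
            push_cast [this]
            ring
        rw [h1]
        exact sub_mem (mem_evBinom_of_choose (k + 1) fun s ↦ rfl)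
          (mem_evBinom_of_choose k fun s ↦ rfl)
    · refine mem_evBinom_of_eventually (n₀ + 1) fun s hs ↦ ?_
      rw [if_neg (by omega), h _ (by omega)]
  | zero => exact mem_evBinom_of_eventually 0 fun s _ ↦ by simp
  | add u v _ _ hu hv =>
    convert add_mem hu hv using 1
    ext s; by_cases hs : s = 0 <;> simp [hs]
  | neg u _ hu =>
    convert neg_mem hu using 1
    ext s; by_cases hs : s = 0 <;> simp [hs]

theorem mul_mem_evBinom₂ {u v : ℕ → ℤ} (hu : u ∈ evBinom) (hv : v ∈ evBinom) :
    (fun s n ↦ u s * v n) ∈ evBinom₂ :=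
  AddSubgroup.subset_closure ⟨u, hu, v, hv, fun _ _ ↦ rfl⟩

/-- An additive operator on functions of two variables preserves `evBinom₂` as soon as it maps
products to products. -/
theorem map_mem_evBinom₂ (Φ : (ℕ → ℕ → ℤ) →+ (ℕ → ℕ → ℤ))
    (h : ∀ u ∈ evBinom, ∀ v ∈ evBinom, Φ (fun s n ↦ u s * v n) ∈ evBinom₂) {f : ℕ → ℕ → ℤ}
    (hf : f ∈ evBinom₂) : Φ f ∈ evBinom₂ := by
  have hle : evBinom₂ ≤ evBinom₂.comap Φ := by
    refine (AddSubgroup.closure_le _).2 ?_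
    rintro g ⟨u, hu, v, hv, hg⟩
    obtain rfl : g = fun s n ↦ u s * v n := by ext s n; exact hg s n
    exact h u hu v hv
  exact hle hf

theorem sum_left_mem_evBinom₂ {f : ℕ → ℕ → ℤ} (hf : f ∈ evBinom₂) :
    (fun s n ↦ ∑ i ∈ Finset.range (s + 1), f i n) ∈ evBinom₂ := by
  refine map_mem_evBinom₂ (AddMonoidHom.mk' (fun f s n ↦ ∑ i ∈ Finset.range (s + 1), f i n)
    fun f g ↦ by ext s n; simp [Finset.sum_add_distrib]) (fun u hu v hv ↦ ?_) hf
  have := mul_mem_evBinom₂ (sum_mem_evBinom hu) hv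
  simpa [Finset.sum_mul] using this

theorem sum_right_mem_evBinom₂ {f : ℕ → ℕ → ℤ} (hf : f ∈ evBinom₂) :
    (fun s n ↦ ∑ i ∈ Finset.range (n + 1), f s i) ∈ evBinom₂ := by
  refine map_mem_evBinom₂ (AddMonoidHom.mk' (fun f s n ↦ ∑ i ∈ Finset.range (n + 1), f s i)
    fun f g ↦ by ext s n; simp [Finset.sum_add_distrib]) (fun u hu v hv ↦ ?_) hf
  have := mul_mem_evBinom₂ hu (sum_mem_evBinom hv)
  simpa [Finset.mul_sum] using this

theorem shift_left_mem_evBinom₂ {f : ℕ → ℕ → ℤ} (hf : f ∈ evBinom₂) :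
    (fun s n ↦ if s = 0 then 0 else f (s - 1) n) ∈ evBinom₂ := by
  refine map_mem_evBinom₂ (AddMonoidHom.mk' (fun f s n ↦ if s = 0 then 0 else f (s - 1) n)
    fun f g ↦ by ext s n; by_cases hs : s = 0 <;> simp [hs]) (fun u hu v hv ↦ ?_) hf
  have := mul_mem_evBinom₂ (shift_mem_evBinom hu) hv
  simpa [ite_mul] using this

theorem shift_right_mem_evBinom₂ {f : ℕ → ℕ → ℤ} (hf : f ∈ evBinom₂) :
    (fun s n ↦ if n = 0 then 0 else f s (n - 1)) ∈ evBinom₂ := by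
  refine map_mem_evBinom₂ (AddMonoidHom.mk' (fun f s n ↦ if n = 0 then 0 else f s (n - 1))
    fun f g ↦ by ext s n; by_cases hn : n = 0 <;> simp [hn]) (fun u hu v hv ↦ ?_) hf
  have := mul_mem_evBinom₂ hu (shift_mem_evBinom hv)
  simpa [mul_ite] using this

/-- Functions of finite support belong to `evBinom₂`. -/
theorem mem_evBinom₂_of_finite {f : ℕ → ℕ → ℤ}
    (hf : {x : ℕ × ℕ | f x.1 x.2 ≠ 0}.Finite) : f ∈ evBinom₂ := by
  classical
  have h1 : f = ∑ x ∈ hf.toFinset, f x.1 x.2 • fun s n ↦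
      (if s = x.1 then (1 : ℤ) else 0) * (if n = x.2 then (1 : ℤ) else 0) := by
    ext s n
    simp only [Finset.sum_apply, Pi.smul_apply, smul_eq_mul]
    rw [Finset.sum_eq_single (s, n)]
    · simp
    · rintro ⟨a, b⟩ _ hab
      by_cases hs : s = a
      · have hn : n ≠ b := fun h ↦ hab (by rw [hs, h])
        simp [hn]
      · simp [hs]
    · intro h
      simpa using h
  rw [h1]
  refine sum_mem fun x _ ↦ zsmul_mem (mul_mem_evBinom₂
    (mem_evBinom_of_eventually (x.1 + 1) fun s hs ↦ if_neg (by omega))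
    (mem_evBinom_of_eventually (x.2 + 1) fun s hs ↦ if_neg (by omega))) _

/-- For `s, n ≫ 0` the function `f` is an integral combination of binomials. -/
def HasExpansion (f : ℕ → ℕ → ℤ) : Prop :=
  ∃ (a : ℕ × ℕ →₀ ℤ) (n₀ : ℕ), ∀ s n, n₀ ≤ s → n₀ ≤ n →
    f s n = ∑ x ∈ a.support, a x * binom₂ x s n

theorem HasExpansion.add {f g : ℕ → ℕ → ℤ} (hf : HasExpansion f) (hg : HasExpansion g) :
    HasExpansion (f + g) := by
  obtain ⟨a, n₀, hf⟩ := hf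
  obtain ⟨b, n₁, hg⟩ := hg
  refine ⟨a + b, max n₀ n₁, fun s n hs hn ↦ ?_⟩
  rw [Pi.add_apply, Pi.add_apply, hf s n (le_of_max_le_left hs) (le_of_max_le_left hn),
    hg s n (le_of_max_le_right hs) (le_of_max_le_right hn)]
  have := Finsupp.sum_add_index' (f := a) (g := b) (h := fun x c ↦ c * binom₂ x s n)
    (by simp) (by intros; ring)
  exact this.symm

theorem HasExpansion.neg {f : ℕ → ℕ → ℤ} (hf : HasExpansion f) : HasExpansion (-f) := by
  obtain ⟨a, n₀, hf⟩ := hf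
  refine ⟨-a, n₀, fun s n hs hn ↦ ?_⟩
  rw [Pi.neg_apply, Pi.neg_apply, hf s n hs hn, Finsupp.support_neg]
  simp

theorem HasExpansion.of_eventually_zero {f : ℕ → ℕ → ℤ} (n₀ : ℕ)
    (h : ∀ s n, n₀ ≤ s → n₀ ≤ n → f s n = 0) : HasExpansion f :=
  ⟨0, n₀, fun s n hs hn ↦ by simp [h s n hs hn]⟩

theorem hasExpansion_mul {u v : ℕ → ℤ} (hu : u ∈ evBinom) (hv : v ∈ evBinom) :
    HasExpansion (fun s n ↦ u s * v n) := by
  induction hu using AddSubgroup.closure_induction with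
  | mem u hu =>
    rcases hu with ⟨k, hk⟩ | ⟨n₀, h⟩
    · induction hv using AddSubgroup.closure_induction with
      | mem v hv =>
        rcases hv with ⟨l, hl⟩ | ⟨n₀, h⟩
        · refine ⟨Finsupp.single (k, l) 1, 0, fun s n _ _ ↦ ?_⟩
          rw [Finsupp.support_single _ one_ne_zero, Finset.sum_singleton]
          simp [binom₂, hk, hl]
        · exact .of_eventually_zero n₀ fun s n _ hn ↦ by simp [h n hn]
      | zero => exact .of_eventually_zero 0 fun s n _ _ ↦ by simp
      | add v w _ _ hv hw =>
        convert hv.add hw using 1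
        ext s n; simp [mul_add]
      | neg v _ hv =>
        convert hv.neg using 1
        ext s n; simp
    · exact .of_eventually_zero n₀ fun s n hs _ ↦ by simp [h s hs]
  | zero => exact .of_eventually_zero 0 fun s n _ _ ↦ by simp
  | add v w _ _ hv hw =>
    convert hv.add hw using 1
    ext s n; simp [add_mul]
  | neg v _ hv =>
    convert hv.neg using 1
    ext s n; simp

theorem hasExpansion_of_mem {f : ℕ → ℕ → ℤ} (hf : f ∈ evBinom₂) : HasExpansion f := by
  induction hf using AddSubgroup.closure_induction with
  | mem f hf =>
    obtain ⟨u, hu, v, hv, hf⟩ := hf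
    obtain rfl : f = fun s n ↦ u s * v n := by ext s n; exact hf s n
    exact hasExpansion_mul hu hv
  | zero => exact .of_eventually_zero 0 fun s n _ _ ↦ by simp
  | add v w _ _ hv hw => exact hv.add hw
  | neg v _ hv => exact hv.neg

/-- If the sums `∑ j ≤ n, f s j` grow at most like a polynomial of degree `D`,
then `f` is eventually a combination of binomials of total degree `< D`. -/
theorem expansion_of_sum_degLT {D : ℕ} {f : ℕ → ℕ → ℤ} (hf : f ∈ evBinom₂)
    (hdeg : DegLT (D + 1) (fun s n ↦ ∑ j ∈ Finset.range (n + 1), f s j)) :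
    ∃ (a : ℕ × ℕ →₀ ℤ) (n₀ : ℕ), (∀ s n, n₀ ≤ s → n₀ ≤ n →
      f s n = ∑ x ∈ a.support, a x * binom₂ x s n) ∧ ∀ x, D ≤ x.1 + x.2 → a x = 0 := by
  obtain ⟨a, n₀, ha⟩ := hasExpansion_of_mem hf
  obtain ⟨b, n₁, hb⟩ := hasExpansion_of_mem (sum_right_mem_evBinom₂ hf)
  refine ⟨a, n₀, ha, ?_⟩
  have hb0 := DegLT.coeff_eq_zero hb hdeg
  obtain ⟨C, n₂, hC, h1⟩ := DegLT.shift_sub hb hb0 0 1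
  have hfdeg : DegLT D f := by
    -- `f s (n + 1)` is the increment of the partial sums from `n` to `n + 1`, whence the offset in
    -- the threshold. The factor `2` absorbs `s + n + 2 ≤ 2 (s + n + 1)`.
    refine ⟨2 * C, n₂ + 1, by positivity, fun s n hs hn ↦ ?_⟩
    obtain ⟨n, rfl⟩ : ∃ k, n = k + 1 := ⟨n - 1, by omega⟩
    have h2 := h1 s n (by omega) (by omega)
    simp only [add_zero, Nat.add_sub_cancel, Finset.sum_range_succ _ (n + 1),
      add_sub_cancel_left] at h2
    have hs0 := Int.natCast_nonneg s
    have hn0 := Int.natCast_nonneg n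
    push_cast
    calc ((s : ℤ) + (n + 1) + 1) * |f s (n + 1)| ≤ 2 * (((s : ℤ) + n + 1) * |f s (n + 1)|) := by
          rw [← mul_assoc]
          exact mul_le_mul_of_nonneg_right (by linarith) (abs_nonneg _)
      _ ≤ 2 * (C * ((s : ℤ) + n + 1) ^ D) := by linarith
      _ ≤ 2 * (C * ((s : ℤ) + (n + 1) + 1) ^ D) := by
          refine mul_le_mul_of_nonneg_left (mul_le_mul_of_nonneg_left
            (pow_le_pow_left₀ (by positivity) (by linarith) _) hC) (by norm_num)
      _ = _ := by ring
  intro x hx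
  by_cases hxs : x ∈ a.support
  · exact DegLT.coeff_eq_zero ha hfdeg x hxs hx
  · simpa using hxs

/-- The pairs `(k, l)` with `k + l ≤ D - 1`. -/
def triangle (D : ℕ) : Finset (ℕ × ℕ) :=
  (Finset.range D ×ˢ Finset.range D).filter fun x ↦ x.1 + x.2 < D

theorem mem_triangle {D : ℕ} {x : ℕ × ℕ} : x ∈ triangle D ↔ x.1 + x.2 < D := by
  simp only [triangle, Finset.mem_filter, Finset.mem_product, Finset.mem_range]
  omega

theorem sum_triangle (D : ℕ) (g : ℕ × ℕ → ℤ) :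
    ∑ k ∈ Finset.range D, ∑ l ∈ Finset.range (D - k), g (k, l) = ∑ x ∈ triangle D, g x := by
  rw [← Finset.sum_finset_product' (triangle D) (Finset.range D) (fun k ↦ Finset.range (D - k))
    (f := fun k l ↦ g (k, l))]
  intro x
  rw [mem_triangle, Finset.mem_range, Finset.mem_range]
  omega

theorem isHilbertExpansion_iff {h : ℕ → ℕ → ℕ∞} {D : ℕ} {a : ℕ → ℕ → ℤ} {v : ℕ → ℕ → ℕ}
    (hv : ∀ s n, h s n = v s n) : IsHilbertExpansion h D a ↔ ∃ n₀, ∀ s n, n₀ ≤ s → n₀ ≤ n →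
      (v s n : ℤ) = ∑ x ∈ triangle D, a x.1 x.2 * binom₂ x s n := by
  unfold IsHilbertExpansion
  refine exists_congr fun n₀ ↦ forall₂_congr fun s n ↦ ?_
  rw [← sum_triangle D fun x ↦ a x.1 x.2 * binom₂ x s n]
  simp only [binom₂, ← mul_assoc, hv]
  refine forall₂_congr fun hs hn ↦ ⟨?_, fun h ↦ ⟨_, rfl, h⟩⟩
  rintro ⟨w, hw, h⟩
  rw [Nat.cast_inj.1 hw]
  exact h

theorem exists_isHilbertExpansion {h : ℕ → ℕ → ℕ∞} {D : ℕ} {v : ℕ → ℕ → ℕ}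
    (hv : ∀ s n, h s n = v s n) {a : ℕ × ℕ →₀ ℤ} {n₀ : ℕ}
    (ha : ∀ s n, n₀ ≤ s → n₀ ≤ n → (v s n : ℤ) = ∑ x ∈ a.support, a x * binom₂ x s n)
    (ha0 : ∀ x, D ≤ x.1 + x.2 → a x = 0) : ∃ a, IsHilbertExpansion h D a := by
  refine ⟨fun k l ↦ a (k, l), (isHilbertExpansion_iff hv).2 ⟨n₀, fun s n hs hn ↦ ?_⟩⟩
  rw [ha s n hs hn]
  refine Finset.sum_subset (fun x hx ↦ ?_) fun x _ hx ↦ by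
    rw [Finsupp.notMem_support_iff.1 hx, zero_mul]
  rw [mem_triangle]
  by_contra hlt
  exact Finsupp.mem_support_iff.1 hx (ha0 x (by omega))

/-- The difference of any two chosen expansions grows too slowly to contain a term of total degree
`D - 1`, so the choices in `topCoeff` are harmless. -/
theorem topCoeff_eq_of_degLT {h₁ h₂ : ℕ → ℕ → ℕ∞} {D : ℕ} {v₁ v₂ : ℕ → ℕ → ℕ}
    (hv₁ : ∀ s n, h₁ s n = v₁ s n) (hv₂ : ∀ s n, h₂ s n = v₂ s n)
    (H₁ : ∃ a, IsHilbertExpansion h₁ D a) (H₂ : ∃ a, IsHilbertExpansion h₂ D a)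
    (hdeg : DegLT (D - 1) fun s n ↦ (v₁ s n : ℤ) - v₂ s n) {k : ℕ} (hk : k < D) :
    topCoeff h₁ D k = topCoeff h₂ D k := by
  unfold topCoeff
  rw [dif_pos H₁, dif_pos H₂]
  obtain ⟨n₁, ha₁⟩ := (isHilbertExpansion_iff hv₁).1 H₁.choose_spec
  obtain ⟨n₂, ha₂⟩ := (isHilbertExpansion_iff hv₂).1 H₂.choose_spec
  set a₁ := H₁.choose
  set a₂ := H₂.choose
  have := DegLT.coeff_eq_zero (S := triangle D) (a := fun x ↦ a₁ x.1 x.2 - a₂ x.1 x.2)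
    (n₀ := max n₁ n₂) (fun s n hs hn ↦ by
      rw [ha₁ s n (le_of_max_le_left hs) (le_of_max_le_left hn),
        ha₂ s n (le_of_max_le_right hs) (le_of_max_le_right hn), ← Finset.sum_sub_distrib]
      exact Finset.sum_congr rfl fun x _ ↦ by ring) hdeg (k, D - 1 - k)
      (mem_triangle.2 (by simp only; omega)) (by simp only; omega)
  exact sub_eq_zero.1 this

end Binomial

end CStar

namespace CStar

/-! ### Hilbert functions of bigraded noetherian subquotients -/

section Families

open IsLocalRing

theorem relLen_comap {R N T : Type*} [CommRing R] [AddCommGroup N] [Module R N] [AddCommGroup T]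
    [Module R T] (f : N →ₗ[R] T) (X : Submodule R T) (Y : Submodule R N) :
    relLen (X.comap f) Y = relLen X (Y.map f) := by
  refine relLen_eq_of_surjective ((X.submoduleOf (Y.map f)).mkQ ∘ₗ f.submoduleMap Y)
    ((Submodule.mkQ_surjective _).comp (f.submoduleMap_surjective Y)) fun v ↦ ?_
  rw [LinearMap.comp_apply, Submodule.mkQ_apply, Submodule.Quotient.mk_eq_zero, mem_submoduleOf_iff]
  rfl

variable {R T : Type*} [CommRing R] [AddCommGroup T] [Module R T]

/-- `T` is a finite-dimensional vector space over the residue field. -/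
theorem length_ne_top_of_maximalIdeal_smul [IsLocalRing R] [IsNoetherian R T]
    (h : maximalIdeal R • (⊤ : Submodule R T) = ⊥) : Module.length R T ≠ ⊤ := by
  have ht : Module.IsTorsionBySet R T (maximalIdeal R : Set R) := by
    rw [Module.isTorsionBySet_iff_subset_annihilator]
    intro r hr
    rw [SetLike.mem_coe, Module.mem_annihilator]
    intro m
    rw [← Submodule.mem_bot R, ← h]
    exact Submodule.smul_mem_smul hr trivial
  let := ht.module
  let : Field (R ⧸ maximalIdeal R) := Ideal.Quotient.field _
  have : IsScalarTower R (R ⧸ maximalIdeal R) T := ht.isScalarTower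
  have : Module.Finite (R ⧸ maximalIdeal R) T := Module.Finite.of_restrictScalars_finite R _ _
  rw [Module.length_eq_of_surjective (R := R ⧸ maximalIdeal R) (S := R)
    (by exact Ideal.Quotient.mk_surjective)]
  exact Module.length_ne_top

/-- The operator `φ j` has degree `d j` on the family `W`. -/
def StableFamily {κ : Type*} (φ : κ → Module.End R T) (d : κ → ℕ × ℕ)
    (W : ℕ × ℕ → Submodule R T) : Prop :=
  ∀ j g, (W g).map (φ j) ≤ W (g + d j)

/-- The ascending chain condition for stable families between `U` and `V`. -/
def FamilyACC {κ : Type*} (φ : κ → Module.End R T) (d : κ → ℕ × ℕ)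
    (U V : ℕ × ℕ → Submodule R T) : Prop :=
  ∀ W : ℕ → ℕ × ℕ → Submodule R T, (∀ k, StableFamily φ d (W k)) → Monotone W →
    (∀ k, U ≤ W k ∧ W k ≤ V) → ∃ n, ∀ m, n ≤ m → W n = W m

theorem FamilyACC.mono {κ : Type*} {φ : κ → Module.End R T} {d : κ → ℕ × ℕ}
    {U V U' V' : ℕ × ℕ → Submodule R T} (h : FamilyACC φ d U V) (hU : U ≤ U') (hV : V' ≤ V) :
    FamilyACC φ d U' V' :=
  fun W hW hmono hle ↦ h W hW hmono fun k ↦ ⟨hU.trans (hle k).1, (hle k).2.trans hV⟩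

section Base

variable {κ : Type*} {φ : κ → Module.End R T} {d : κ → ℕ × ℕ} {U V : ℕ × ℕ → Submodule R T}

theorem stableFamily_of_le (hφ : ∀ j g, (V g).map (φ j) ≤ U (g + d j))
    {W : ℕ × ℕ → Submodule R T} (h1 : U ≤ W) (h2 : W ≤ V) : StableFamily φ d W :=
  fun j g ↦ (Submodule.map_mono (h2 g)).trans ((hφ j g).trans (h1 _))

/-- All operators vanish on `V / U`, so every family between `U` and `V` is stable. Changing `U` in
the single degree `g` turns a chain of submodules of `V g / U g` into a chain of families; hence
this module is noetherian, and it is killed by `𝔪`. -/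
theorem relLen_ne_top_of_familyACC [IsLocalRing R] (hUV : U ≤ V) (hacc : FamilyACC φ d U V)
    (h𝔪 : ∀ g, maximalIdeal R • V g ≤ U g) (hφ : ∀ j g, (V g).map (φ j) ≤ U (g + d j))
    (g : ℕ × ℕ) : relLen (U g) (V g) ≠ ⊤ := by
  have hnoeth : IsNoetherian R (↥(V g) ⧸ (U g).submoduleOf (V g)) := by
    rw [← monotone_stabilizes_iff_noetherian]
    intro f
    set P : ℕ → Submodule R T := fun k ↦
      ((f k).comap ((U g).submoduleOf (V g)).mkQ).map (V g).subtype with hP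
    have hPV : ∀ k, P k ≤ V g := fun k ↦ Submodule.map_subtype_le _ _
    have hUP : ∀ k, U g ≤ P k := by
      intro k t ht
      refine ⟨⟨t, hUV g ht⟩, ?_, rfl⟩
      rw [SetLike.mem_coe, Submodule.mem_comap, Submodule.mkQ_apply,
        (Submodule.Quotient.mk_eq_zero _).2 (mem_submoduleOf_iff.2 ht)]
      exact zero_mem _
    have hle : ∀ k, U ≤ Function.update U g (P k) ∧ Function.update U g (P k) ≤ V := by
      intro k
      refine ⟨fun g' ↦ ?_, fun g' ↦ ?_⟩ <;> by_cases h : g' = g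
      · subst h; simpa using hUP k
      · simp [h]
      · subst h; simpa using hPV k
      · simpa [h] using hUV g'
    obtain ⟨n, hn⟩ := hacc (fun k ↦ Function.update U g (P k))
      (fun k ↦ stableFamily_of_le hφ (hle k).1 (hle k).2)
      (fun a b hab ↦ update_le_update_iff.2
        ⟨Submodule.map_mono (Submodule.comap_mono (f.monotone hab)), fun _ _ ↦ le_rfl⟩) hle
    refine ⟨n, fun m hm ↦ ?_⟩
    have h1 := congrFun (hn m hm) g
    simp only [Function.update_self, hP] at h1
    have h2 := Submodule.map_injective_of_injective (V g).injective_subtype h1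
    exact Submodule.comap_injective_of_surjective (Submodule.mkQ_surjective _) h2
  refine length_ne_top_of_maximalIdeal_smul ?_
  rw [eq_bot_iff, Submodule.smul_le]
  intro r hr x _
  obtain ⟨x, rfl⟩ := Submodule.mkQ_surjective _ x
  rw [← map_smul, Submodule.mem_bot, Submodule.mkQ_apply, Submodule.Quotient.mk_eq_zero,
    mem_submoduleOf_iff]
  exact h𝔪 g (Submodule.smul_mem_smul hr x.2)

/-- With infinitely many nonzero degrees, replacing `U` by `V` in one more of them at each stage
would give a strictly increasing chain of stable families. -/
theorem finite_relLen_ne_zero_of_familyACC (hUV : U ≤ V) (hacc : FamilyACC φ d U V)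
    (hφ : ∀ j g, (V g).map (φ j) ≤ U (g + d j)) :
    {g : ℕ × ℕ | relLen (U g) (V g) ≠ 0}.Finite := by
  classical
  by_contra hinf
  have hinf : {g : ℕ × ℕ | relLen (U g) (V g) ≠ 0}.Infinite := hinf
  set x := hinf.natEmbedding with hx
  set W : ℕ → ℕ × ℕ → Submodule R T := fun k g ↦
    if ∃ i < k, (x i : ℕ × ℕ) = g then V g else U g with hW
  have hle : ∀ k, U ≤ W k ∧ W k ≤ V := by
    intro k
    refine ⟨fun g ↦ ?_, fun g ↦ ?_⟩ <;> simp only [hW] <;> split_ifs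
    exacts [hUV g, le_rfl, le_rfl, hUV g]
  obtain ⟨n, hn⟩ := hacc W (fun k ↦ stableFamily_of_le hφ (hle k).1 (hle k).2) (by
    intro a b hab g
    simp only [hW]
    split_ifs with h1 h2
    · exact le_rfl
    · obtain ⟨i, hi, h⟩ := h1
      exact absurd ⟨i, by omega, h⟩ h2
    · exact hUV g
    · exact le_rfl) hle
  have h1 := congrFun (hn (n + 1) n.le_succ) (x n)
  simp only [hW] at h1
  rw [if_neg, if_pos ⟨n, n.lt_succ_self, rfl⟩] at h1
  · exact (x n).2 (relLen_eq_zero h1.ge)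
  · rintro ⟨i, hi, h⟩
    have := x.injective (Subtype.ext h)
    omega

end Base

/-- A function which is determined by its increments in the first variable. -/
theorem mem_evBinom₂_of_step_left {f hC hK : ℕ → ℕ → ℤ} (hC' : hC ∈ evBinom₂) (hK' : hK ∈ evBinom₂)
    (h0 : ∀ n, f 0 n = hC 0 n) (h1 : ∀ s n, f (s + 1) n - f s n = hC (s + 1) n - hK s n) :
    f ∈ evBinom₂ := by
  have h2 := sum_left_mem_evBinom₂ (sub_mem hC' (shift_left_mem_evBinom₂ hK'))
  convert h2 using 1
  ext s n
  induction s with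
  | zero => simp [h0]
  | succ s ih =>
    rw [Finset.sum_range_succ, ← ih]
    have := h1 s n
    simp only [Pi.sub_apply, Nat.succ_ne_zero, if_false, Nat.add_sub_cancel]
    linarith

theorem mem_evBinom₂_of_step_right {f hC hK : ℕ → ℕ → ℤ} (hC' : hC ∈ evBinom₂)
    (hK' : hK ∈ evBinom₂) (h0 : ∀ s, f s 0 = hC s 0)
    (h1 : ∀ s n, f s (n + 1) - f s n = hC s (n + 1) - hK s n) : f ∈ evBinom₂ := by
  have h2 := sum_right_mem_evBinom₂ (sub_mem hC' (shift_right_mem_evBinom₂ hK'))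
  convert h2 using 1
  ext s n
  induction n with
  | zero => simp [h0]
  | succ n ih =>
    rw [Finset.sum_range_succ, ← ih]
    have := h1 s n
    simp only [Pi.sub_apply, Nat.succ_ne_zero, if_false, Nat.add_sub_cancel]
    linarith

/-- The Hilbert function of a noetherian subquotient `V / U` with operators of degrees
`(1, 0)` and `(0, 1)`. -/
theorem exists_relLen_eq_of_familyACC [IsLocalRing R] {κ : Type*} [DecidableEq κ]
    (φ : κ → Module.End R T) (hcomm : ∀ i j, Commute (φ i) (φ j)) (d : κ → ℕ × ℕ)
    (hd : ∀ j, d j = (1, 0) ∨ d j = (0, 1)) (S : Finset κ) :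
    ∀ U V : ℕ × ℕ → Submodule R T, U ≤ V → StableFamily φ d U → StableFamily φ d V →
      FamilyACC φ d U V → (∀ g, maximalIdeal R • V g ≤ U g) →
      (∀ j, j ∉ S → ∀ g, (V g).map (φ j) ≤ U (g + d j)) →
      ∃ h : ℕ → ℕ → ℕ, (∀ s n, relLen (U (s, n)) (V (s, n)) = h s n) ∧
        (fun s n ↦ (h s n : ℤ)) ∈ evBinom₂ := by
  induction S using Finset.induction_on with
  | empty =>
    intro U V hUV _ _ hacc h𝔪 hφ
    have hφ' : ∀ j g, (V g).map (φ j) ≤ U (g + d j) := fun j ↦ hφ j (Finset.notMem_empty j)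
    have hfin := relLen_ne_top_of_familyACC hUV hacc h𝔪 hφ'
    refine ⟨fun s n ↦ (relLen (U (s, n)) (V (s, n))).toNat,
      fun s n ↦ (ENat.natCast_toNat (hfin _)).symm, mem_evBinom₂_of_finite ?_⟩
    refine (finite_relLen_ne_zero_of_familyACC hUV hacc hφ').subset fun x hx h0 ↦ hx ?_
    simp [h0]
  | insert j S _ ih =>
    intro U V hUV hU hV hacc h𝔪 hφ
    -- `K / U` and `V / C` are the kernel and cokernel of `φ j` on `V / U`; both are annihilated by
    -- `φ j`, so the induction hypothesis applies. The supremum defining `C` is empty in degrees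
    -- outside the shift by `d j`, where `C = U`.
    set K : ℕ × ℕ → Submodule R T := fun g ↦ V g ⊓ (U (g + d j)).comap (φ j) with hKdef
    set C : ℕ × ℕ → Submodule R T := fun g ↦
      U g ⊔ ⨆ (g' : ℕ × ℕ) (_ : g' + d j = g), (V g').map (φ j) with hCdef
    have hUK : U ≤ K := fun g ↦ le_inf (hUV g) (Submodule.map_le_iff_le_comap.1 (hU j g))
    have hKV : K ≤ V := fun g ↦ inf_le_left
    have hUC : U ≤ C := fun g ↦ le_sup_left
    have hmapC : ∀ g, (V g).map (φ j) ≤ C (g + d j) := fun g ↦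
      le_sup_of_le_right (le_iSup₂_of_le g rfl le_rfl)
    have hCV : C ≤ V := fun g ↦ sup_le (hUV g) (iSup₂_le fun g' hg ↦ hg ▸ hV j g')
    have hswap : ∀ (i : κ) (P : Submodule R T),
        (P.map (φ j)).map (φ i) = (P.map (φ i)).map (φ j) := fun i P ↦ by
      rw [← Submodule.map_comp, ← Submodule.map_comp]
      exact congrArg (fun f ↦ P.map f) (hcomm i j)
    have hKst : StableFamily φ d K := by
      intro i g
      refine le_inf ((Submodule.map_mono inf_le_left).trans (hV i g)) ?_
      rw [← Submodule.map_le_iff_le_comap, ← hswap]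
      refine (Submodule.map_mono (Submodule.map_mono inf_le_right)).trans ?_
      refine (Submodule.map_mono (Submodule.map_comap_le _ _)).trans ((hU i _).trans ?_)
      rw [add_right_comm]
    have hCst : StableFamily φ d C := by
      intro i g
      simp only [hCdef, Submodule.map_sup, Submodule.map_iSup]
      refine sup_le ((hU i g).trans le_sup_left) (iSup₂_le fun g' hg ↦ ?_)
      rw [hswap]
      refine (Submodule.map_mono (hV i g')).trans (le_sup_of_le_right ?_)
      exact le_iSup₂_of_le (g' + d i) (by rw [← hg, add_right_comm]) le_rfl
    obtain ⟨hK, hK1, hK2⟩ := ih U K hUK hU hKst (hacc.mono le_rfl hKV)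
      (fun g ↦ (Submodule.smul_mono le_rfl (hKV g)).trans (h𝔪 g)) (fun i hi g ↦ by
        by_cases hij : i = j
        · subst hij
          exact Submodule.map_le_iff_le_comap.2 inf_le_right
        · exact (Submodule.map_mono (hKV g)).trans (hφ i (by simp [hij, hi]) g))
    obtain ⟨hC, hC1, hC2⟩ := ih C V hCV hCst hV (hacc.mono hUC le_rfl)
      (fun g ↦ (h𝔪 g).trans (hUC g)) (fun i hi g ↦ by
        by_cases hij : i = j
        · subst hij
          exact hmapC g
        · exact (hφ i (by simp [hij, hi]) g).trans (hUC _))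
    have hCeq : ∀ g, C (g + d j) = U (g + d j) ⊔ (V g).map (φ j) := by
      intro g
      refine le_antisymm (sup_le le_sup_left (iSup₂_le fun g' hg ↦ ?_))
        (sup_le (hUC _) (hmapC g))
      rw [add_right_cancel hg]
      exact le_sup_right
    have hstep1 : ∀ g, relLen (U (g + d j)) (V (g + d j)) =
        relLen (U (g + d j)) ((V g).map (φ j)) + relLen (C (g + d j)) (V (g + d j)) := by
      intro g
      rw [relLen_add_relLen (hUC _) (hCV _), hCeq, relLen_sup]
    have hstep2 : ∀ g, relLen (U g) (V g) =
        relLen (U g) (K g) + relLen (U (g + d j)) ((V g).map (φ j)) := by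
      intro g
      rw [relLen_add_relLen (hUK _) (hKV _), ← relLen_comap]
      congr 1
      exact relLen_inf_eq (by simp [hKdef, inf_comm])
    have hstep0 : ∀ g, (∀ g', g' + d j ≠ g) → relLen (U g) (V g) = relLen (C g) (V g) := by
      intro g hg
      congr 1
      simp [hCdef, hg]
    have hstepfin : ∀ g, relLen (U g) (V g) ≠ ⊤ → relLen (C (g + d j)) (V (g + d j)) ≠ ⊤ →
        relLen (U (g + d j)) (V (g + d j)) ≠ ⊤ := by
      intro g h1 h2
      rw [hstep1]
      refine WithTop.add_ne_top.2 ⟨?_, h2⟩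
      rw [hstep2] at h1
      exact (WithTop.add_ne_top.1 h1).2
    -- The alternating sum of lengths in the exact sequence of `φ j`; the length `x` of the image
    -- cancels.
    have hstepint : ∀ g (a b c k : ℕ), relLen (U (g + d j)) (V (g + d j)) = a →
        relLen (U g) (V g) = b → relLen (C (g + d j)) (V (g + d j)) = c →
        relLen (U g) (K g) = k → (a : ℤ) - b = c - k := by
      intro g a b c k ha hb hc hk
      rw [hstep1, hc] at ha
      rw [hstep2, hk] at hb
      obtain ⟨x, hx⟩ : ∃ x : ℕ, relLen (U (g + d j)) ((V g).map (φ j)) = x := by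
        refine ⟨_, (ENat.natCast_toNat fun h ↦ ?_).symm⟩
        rw [h] at hb
        simp at hb
      rw [hx] at ha hb
      norm_cast at ha hb
      omega
    have hCtop : ∀ s n, relLen (C (s, n)) (V (s, n)) ≠ ⊤ := fun s n ↦ by
      rw [hC1]; exact ENat.natCast_ne_top _
    rcases hd j with hdj | hdj
    · rw [hdj] at hstep0 hstepfin hstepint
      have h0 : ∀ n, relLen (U (0, n)) (V (0, n)) = hC 0 n := fun n ↦ by
        rw [hstep0 _ (by rintro ⟨a, b⟩ h; simp at h), hC1]
      have hfin : ∀ s n, relLen (U (s, n)) (V (s, n)) ≠ ⊤ := by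
        intro s n
        induction s with
        | zero => rw [h0]; exact ENat.natCast_ne_top _
        | succ s ih => exact hstepfin (s, n) ih (hCtop _ _)
      have hh : ∀ s n, relLen (U (s, n)) (V (s, n)) = (relLen (U (s, n)) (V (s, n))).toNat :=
        fun s n ↦ (ENat.natCast_toNat (hfin s n)).symm
      refine ⟨_, hh, mem_evBinom₂_of_step_left hC2 hK2 (fun n ↦ by rw [h0]; simp) fun s n ↦ ?_⟩
      exact hstepint (s, n) _ _ _ _ (hh _ _) (hh _ _) (hC1 _ _) (hK1 _ _)
    · rw [hdj] at hstep0 hstepfin hstepint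
      have h0 : ∀ s, relLen (U (s, 0)) (V (s, 0)) = hC s 0 := fun s ↦ by
        rw [hstep0 _ (by rintro ⟨a, b⟩ h; simp at h), hC1]
      have hfin : ∀ s n, relLen (U (s, n)) (V (s, n)) ≠ ⊤ := by
        intro s n
        induction n with
        | zero => rw [h0]; exact ENat.natCast_ne_top _
        | succ n ih => exact hstepfin (s, n) ih (hCtop _ _)
      have hh : ∀ s n, relLen (U (s, n)) (V (s, n)) = (relLen (U (s, n)) (V (s, n))).toNat :=
        fun s n ↦ (ENat.natCast_toNat (hfin s n)).symm
      refine ⟨_, hh, mem_evBinom₂_of_step_right hC2 hK2 (fun s ↦ by rw [h0]; simp) fun s n ↦ ?_⟩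
      exact hstepint (s, n) _ _ _ _ (hh _ _) (hh _ _) (hC1 _ _) (hK1 _ _)

section GradedModule

variable {B : Type*} [CommRing B] [Algebra R B] [Module B T] [IsScalarTower R B T]

theorem smul_mem_of_adjoin_eq_top {Y : Set B} (hY : Algebra.adjoin R Y = ⊤) {P : Submodule R T}
    (hP : ∀ y ∈ Y, ∀ t ∈ P, y • t ∈ P) (b : B) {t : T} (ht : t ∈ P) : b • t ∈ P := by
  have hb : b ∈ Algebra.adjoin R Y := hY ▸ trivial
  induction hb using Algebra.adjoin_induction generalizing t with
  | mem y hy => exact hP y hy t ht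
  | algebraMap r =>
    rw [algebraMap_smul]
    exact P.smul_mem r ht
  | add a b _ _ ha hb =>
    rw [add_smul]
    exact P.add_mem (ha ht) (hb ht)
  | mul a b _ _ ha hb =>
    rw [mul_smul]
    exact ha (hb ht)

/-- The Hilbert function of the bigraded module `G_𝔪(T)`, for a finite graded module `T` over an
algebra generated by finitely many elements of degree one. -/
theorem exists_hilb_eq [IsLocalRing R] [IsNoetherianRing R] [IsNoetherianRing B] [Module.Finite B T]
    (𝒯 : ℕ → Submodule R T)
    (hind : ∀ W : ℕ → Submodule R T, (∀ n, W n ≤ 𝒯 n) → ∀ m, (⨆ n, W n) ⊓ 𝒯 m ≤ W m)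
    {Y : Set B} (hYfin : Y.Finite) (hY : Algebra.adjoin R Y = ⊤)
    (hY1 : ∀ y ∈ Y, ∀ n, ∀ t ∈ 𝒯 n, y • t ∈ 𝒯 (n + 1)) :
    ∃ h : ℕ → ℕ → ℕ, (∀ s n, hilb 𝒯 s n = h s n) ∧ (fun s n ↦ (h s n : ℤ)) ∈ evBinom₂ := by
  classical
  obtain ⟨X, hX⟩ := (isNoetherianRing_iff_ideal_fg R).1 inferInstance (maximalIdeal R)
  have := hYfin.to_subtype
  have := Fintype.ofFinite Y
  set b : ↥X ⊕ ↥Y → B := Sum.elim (fun x ↦ algebraMap R B x) (fun y ↦ y) with hb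
  set φ : ↥X ⊕ ↥Y → Module.End R T := fun j ↦ Algebra.lsmul R R T (b j) with hφ
  set d : ↥X ⊕ ↥Y → ℕ × ℕ := Sum.elim (fun _ ↦ (1, 0)) (fun _ ↦ (0, 1)) with hd
  set F : ℕ × ℕ → Submodule R T := fun g ↦ maximalIdeal R ^ g.1 • 𝒯 g.2 with hF
  have hXm : ∀ x ∈ X, x ∈ maximalIdeal R := fun x hx ↦ hX ▸ Ideal.subset_span hx
  have hYle : ∀ y ∈ Y, ∀ i n, ∀ t ∈ maximalIdeal R ^ i • 𝒯 n,
      y • t ∈ maximalIdeal R ^ i • 𝒯 (n + 1) := by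
    intro y hy i n t ht
    induction ht using Submodule.smul_induction_on' with
    | smul r hr t ht =>
      rw [smul_comm]
      exact Submodule.smul_mem_smul hr (hY1 y hy n t ht)
    | add t _ t' _ h h' =>
      rw [smul_add]
      exact add_mem h h'
  have hstF : ∀ i, StableFamily φ d (fun g ↦ maximalIdeal R ^ (g.1 + i) • 𝒯 g.2) := by
    rintro i (x | y) g
    · rintro _ ⟨t, ht, rfl⟩
      simp only [hφ, hb, hd, Sum.elim_inl, Algebra.lsmul_coe, algebraMap_smul, Prod.fst_add,
        Prod.snd_add, add_zero]
      rw [add_right_comm, pow_succ', Submodule.mul_smul]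
      exact Submodule.smul_mem_smul (hXm x x.2) ht
    · rintro _ ⟨t, ht, rfl⟩
      exact hYle y y.2 _ _ t ht
  set 𝔞 : Ideal B := (maximalIdeal R).map (algebraMap R B) with h𝔞
  have hpow : ∀ i n, (maximalIdeal R ^ i • 𝒯 n : Submodule R T) ≤
      (𝔞 ^ i • (⊤ : Submodule B T)).restrictScalars R := by
    intro i n
    rw [h𝔞, ← Ideal.map_pow, Ideal.smul_restrictScalars]
    exact Submodule.smul_mono le_rfl le_top
  -- The chain condition comes from the Rees module of `𝔪B`: a stable family `W` is encoded as the
  -- filtration `s ↦ ∑ₙ W(s, n)`.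
  have hnoeth : IsNoetherian (reesAlgebra 𝔞) ((𝔞.stableFiltration (⊤ : Submodule B T)).submodule) := by
    refine isNoetherian_of_fg_of_noetherian _ ?_
    rw [Ideal.Filtration.submodule_fg_iff_stable]
    · exact Ideal.stableFiltration_stable _ _
    · exact fun i ↦ IsNoetherian.noetherian _
  have hacc : FamilyACC φ d (fun g ↦ maximalIdeal R ^ (g.1 + 1) • 𝒯 g.2) F := by
    intro W hW hmono hle
    have hWT : ∀ k s n, W k (s, n) ≤ 𝒯 n := fun k s n ↦ ((hle k).2 _).trans Submodule.smul_le_right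
    have hYW : ∀ k s, ∀ y ∈ Y, ∀ t ∈ ⨆ n, W k (s, n), y • t ∈ ⨆ n, W k (s, n) := by
      intro k s y hy t ht
      have h1 : (⨆ n, W k (s, n)).map (φ (Sum.inr ⟨y, hy⟩)) ≤ ⨆ n, W k (s, n) := by
        rw [Submodule.map_iSup]
        exact iSup_le fun n ↦ (hW k (Sum.inr ⟨y, hy⟩) (s, n)).trans
          (le_iSup (fun n ↦ W k (s, n)) (n + 1))
      exact h1 ⟨t, ht, rfl⟩
    let P : ℕ → 𝔞.Filtration T := fun k ↦
      { N := fun s ↦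
          { (⨆ n, W k (s, n)) with
            smul_mem' := fun b t ht ↦ smul_mem_of_adjoin_eq_top hY (hYW k s) b ht }
        -- The lower bound on `W` enters here: `W(s + 1, n) ≤ 𝔪 ^ (s + 1) Tₙ ≤ W(s, n)`.
        mono := fun s ↦ by
          change (⨆ n, W k (s + 1, n)) ≤ ⨆ n, W k (s, n)
          exact iSup_mono fun n ↦ ((hle k).2 (s + 1, n)).trans ((hle k).1 (s, n))
        smul_le := fun s ↦ by
          rw [← Submodule.restrictScalars_le R, h𝔞, Ideal.smul_restrictScalars, ← hX]
          refine Submodule.smul_le.2 fun r hr t ht ↦ ?_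
          induction hr using Submodule.span_induction with
          | mem x hx =>
            have h1 : (⨆ n, W k (s, n)).map (φ (Sum.inl ⟨x, hx⟩)) ≤ ⨆ n, W k (s + 1, n) := by
              rw [Submodule.map_iSup]
              exact iSup_mono fun n ↦ hW k (Sum.inl ⟨x, hx⟩) (s, n)
            have h2 := h1 ⟨t, ht, rfl⟩
            simpa [hφ, hb] using h2
          | zero => simp
          | add x y _ _ hx hy => rw [add_smul]; exact add_mem hx hy
          | smul c x _ hx => rw [smul_assoc]; exact Submodule.smul_mem _ c hx }
    have hPmem : ∀ k s t, t ∈ (P k).N s ↔ t ∈ ⨆ n, W k (s, n) := fun _ _ _ ↦ Iff.rfl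
    have hPmono : ∀ k l, k ≤ l → (P k).submodule ≤ (P l).submodule := by
      intro k l hkl f hf
      rw [Ideal.Filtration.mem_submodule] at hf ⊢
      exact fun s ↦ (iSup_mono fun n ↦ hmono hkl (s, n)) (hf s)
    have hPle : ∀ k, (P k).submodule ≤ (𝔞.stableFiltration (⊤ : Submodule B T)).submodule := by
      intro k f hf
      rw [Ideal.Filtration.mem_submodule] at hf ⊢
      exact fun s ↦ (iSup_le fun n ↦ ((hle k).2 (s, n)).trans (hpow s n) :
        (⨆ n, W k (s, n)) ≤ _) (hf s)
    obtain ⟨n, hn⟩ := monotone_stabilizes_iff_noetherian.2 hnoeth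
      ⟨fun k ↦ (P k).submodule.submoduleOf _, fun k l hkl f hf ↦ hPmono k l hkl hf⟩
    refine ⟨n, fun m hm ↦ le_antisymm (hmono hm) ?_⟩
    rintro ⟨s, j⟩ t ht
    have h1 : PolynomialModule.single B s t ∈ (P m).submodule := by
      rw [Ideal.Filtration.mem_submodule]
      intro i
      rw [PolynomialModule.coeff_single, Finsupp.single_apply]
      split_ifs with h
      · subst h
        exact (le_iSup (fun n ↦ W m (s, n)) j) ht
      · exact zero_mem _
    have h2 : PolynomialModule.single B s t ∈ (P n).submodule := by
      have h3 : (⟨_, hPle m h1⟩ : ↥(𝔞.stableFiltration (⊤ : Submodule B T)).submodule) ∈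
          (P m).submodule.submoduleOf _ := h1
      have h4 : (P n).submodule.submoduleOf _ = (P m).submodule.submoduleOf _ := hn m hm
      rw [← h4] at h3
      exact h3
    have h3 := (Ideal.Filtration.mem_submodule _ _).1 h2 s
    rw [PolynomialModule.coeff_single, Finsupp.single_eq_same] at h3
    -- Independence of the degrees recovers the family from the filtration that encodes it.
    exact hind (fun j ↦ W n (s, j)) (hWT n s) j ⟨h3, hWT m s j ht⟩
  obtain ⟨h, h1, h2⟩ := exists_relLen_eq_of_familyACC φ
    (fun i j ↦ by
      rw [commute_iff_eq, hφ]
      simp only [← map_mul, mul_comm]) d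
    (by rintro (x | y) <;> simp [hd]) Finset.univ (fun g ↦ maximalIdeal R ^ (g.1 + 1) • 𝒯 g.2) F
    (fun g ↦ Submodule.smul_mono_left (Ideal.pow_le_pow_right (Nat.le_succ _))) (hstF 1) (hstF 0)
    hacc (fun g ↦ by rw [hF, ← Submodule.mul_smul, ← pow_succ'])
    (fun j hj ↦ absurd (Finset.mem_univ j) hj)
  exact ⟨h, h1, h2⟩

end GradedModule

end Families

end CStar

namespace CStar

/-! ### Growth of lengths modulo powers of an ideal -/

section Growth

open scoped Pointwise

variable {R A : Type*} [CommRing R] [CommRing A] [Algebra R A] (𝔐 : Ideal A)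

/-- The length over `R` of `N / 𝔐 ^ s N`. -/
noncomputable def adicLen (R : Type*) [CommRing R] [Algebra R A] (N : Type*) [AddCommGroup N]
    [Module R N] [Module A N] [IsScalarTower R A N] (s : ℕ) : ℕ∞ :=
  relLen ((𝔐 ^ s • (⊤ : Submodule A N)).restrictScalars R) ⊤

/-- `(s + 1) ^ (d - 1)`, read as `0` for `d = 0`. -/
def powBound : ℕ → ℕ → ℕ
  | 0, _ => 0
  | d + 1, s => (s + 1) ^ d

theorem sum_powBound_le (d s : ℕ) :
    ∑ u ∈ Finset.range (s + 1), powBound d u ≤ powBound (d + 1) s := by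
  cases d with
  | zero => simp [powBound]
  | succ d =>
    calc ∑ u ∈ Finset.range (s + 1), (u + 1) ^ d ≤ ∑ _u ∈ Finset.range (s + 1), (s + 1) ^ d :=
          Finset.sum_le_sum fun u hu ↦ Nat.pow_le_pow_left (by
            have := Finset.mem_range.1 hu; omega) d
      _ = (s + 1) ^ (d + 1) := by simp [pow_succ, mul_comm]

attribute [irreducible] powBound

section Exact

variable {N₁ N₂ N₃ : Type*} [AddCommGroup N₁] [Module R N₁] [Module A N₁] [IsScalarTower R A N₁]
  [AddCommGroup N₂] [Module R N₂] [Module A N₂] [IsScalarTower R A N₂]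
  [AddCommGroup N₃] [Module R N₃] [Module A N₃] [IsScalarTower R A N₃]

theorem adicLen_of_surjective (g : N₂ →ₗ[A] N₃) (hg : Function.Surjective g) (s : ℕ) :
    adicLen 𝔐 R N₃ s = relLen ((𝔐 ^ s • (⊤ : Submodule A N₂) ⊔ LinearMap.ker g).restrictScalars R)
      ⊤ := by
  have h1 : (𝔐 ^ s • (⊤ : Submodule A N₃)).restrictScalars R =
      ((𝔐 ^ s • (⊤ : Submodule A N₂)).restrictScalars R).map (g.restrictScalars R) := by
    have h2 : (𝔐 ^ s • (⊤ : Submodule A N₃)) = (𝔐 ^ s • (⊤ : Submodule A N₂)).map g := by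
      rw [Submodule.map_smul'', Submodule.map_top, LinearMap.range_eq_top.2 hg]
    rw [h2]
    rfl
  have h3 : (⊤ : Submodule R N₃) = (⊤ : Submodule R N₂).map (g.restrictScalars R) := by
    refine eq_comm.1 (eq_top_iff.2 fun y _ ↦ ?_)
    obtain ⟨x, rfl⟩ := hg y
    exact ⟨x, trivial, rfl⟩
  rw [adicLen, h1, h3, relLen_map, Submodule.restrictScalars_sup]
  rfl

/-- The image of `f` contributes at most `N₁ / X` as soon as `f` maps `X` into `𝔐 ^ s N₂`. Leaving
`X` free covers both an arbitrary exact sequence and multiplication by an element of `𝔐`, which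
gains one power of `𝔐`. -/
theorem relLen_le_add_adicLen (f : N₁ →ₗ[A] N₂) (g : N₂ →ₗ[A] N₃) (hg : Function.Surjective g)
    (hfg : Function.Exact f g) (s : ℕ) (X : Submodule R N₁)
    (hX : X ≤ ((𝔐 ^ s • (⊤ : Submodule A N₂)).restrictScalars R).comap (f.restrictScalars R)) :
    adicLen 𝔐 R N₂ s ≤ relLen X ⊤ + adicLen 𝔐 R N₃ s := by
  rw [adicLen_of_surjective 𝔐 g hg, adicLen, relLen_eq_add _
    (le_top : (⊤ : Submodule R N₁).map (f.restrictScalars R) ≤ ⊤), ← relLen_comap, add_comm,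
    Submodule.restrictScalars_sup]
  refine add_le_add (relLen_antitone (inf_le_left.trans hX)) (le_of_eq ?_)
  congr 2
  ext x
  simpa [eq_comm] using (hfg x).symm

end Exact

theorem adicLen_zero (N : Type*) [AddCommGroup N] [Module R N] [Module A N] [IsScalarTower R A N] :
    adicLen 𝔐 R N 0 = 0 :=
  relLen_eq_zero (by simp)

theorem adicLen_le_length (N : Type*) [AddCommGroup N] [Module R N] [Module A N]
    [IsScalarTower R A N] (s : ℕ) : adicLen 𝔐 R N s ≤ Module.length R N := by
  rw [adicLen, relLen_top_eq]
  exact Module.length_le_of_surjective _ (Submodule.mkQ_surjective _)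

/-- If `𝔐 ≤ p`, then `A / p` is a quotient of `A / 𝔐` and has finite length. Otherwise some `x ∈ 𝔐`
lies outside `p`; then `N / xN` has smaller dimension and its lengths bound the increments of `s ↦
ℓ(N / 𝔐 ^ s N)`. -/
theorem exists_adicLen_le_of_equiv_quotient {𝔐} {d : ℕ} (h𝔐 : Module.length R (A ⧸ 𝔐) ≠ ⊤)
    {N : Type*} [AddCommGroup N] [Module R N] [Module A N] [IsScalarTower R A N]
    (ih : ∀ x : A, Module.supportDim A (QuotSMulTop x N) < d →
      ∃ C : ℕ, ∀ s, adicLen 𝔐 R (QuotSMulTop x N) s ≤ (C * powBound d s : ℕ))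
    [Module.Finite A N] (p : Ideal A) [hp : p.IsPrime] (e : N ≃ₗ[A] A ⧸ p)
    (hN : Module.supportDim A N < (d + 1 : ℕ)) :
    ∃ C : ℕ, ∀ s, adicLen 𝔐 R N s ≤ (C * powBound (d + 1) s : ℕ) := by
  by_cases h : 𝔐 ≤ p
  · have h1 : Module.length R N ≤ Module.length R (A ⧸ 𝔐) := by
      rw [(e.restrictScalars R).length_eq]
      exact Module.length_le_of_surjective (Ideal.Quotient.factorₐ R h).toLinearMap
        (Ideal.Quotient.factor_surjective h)
    refine ⟨(Module.length R (A ⧸ 𝔐)).toNat, fun s ↦ ?_⟩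
    refine (adicLen_le_length 𝔐 N s).trans (h1.trans ?_)
    rw [← ENat.natCast_toNat h𝔐]
    exact_mod_cast Nat.le_mul_of_pos_right _ (by rw [powBound]; positivity)
  · obtain ⟨x, hx𝔐, hxp⟩ := SetLike.not_le_iff_exists.1 h
    have hdim : Module.supportDim A (QuotSMulTop x N) < d := by
      have h1 := Module.supportDim_quotSMulTop_succ_le_of_notMem_minimalPrimes (R := A) (M := N)
        (x := x) (fun q hq ↦ by
          rw [e.annihilator_eq, Ideal.annihilator_quotient, Ideal.minimalPrimes_eq_subsingleton_self,
            Set.mem_singleton_iff] at hq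
          rwa [hq])
      have h2 := h1.trans_lt hN
      rw [Nat.cast_add, Nat.cast_one] at h2
      exact lt_of_add_lt_add_right h2
    obtain ⟨C, hC⟩ := ih x hdim
    refine ⟨C, fun s ↦ ?_⟩
    suffices h : adicLen 𝔐 R N s ≤ (C * ∑ u ∈ Finset.range (s + 1), powBound d u : ℕ) from
      h.trans (by exact_mod_cast Nat.mul_le_mul_left _ (sum_powBound_le d s))
    induction s with
    | zero => simp [adicLen_zero]
    | succ s ihs =>
      have h1 := relLen_le_add_adicLen 𝔐 (R := R) (LinearMap.lsmul A N x)
        (Submodule.mkQ (x • (⊤ : Submodule A N)) : N →ₗ[A] QuotSMulTop x N) (Submodule.mkQ_surjective _) (by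
          intro y
          rw [Submodule.mkQ_apply, Submodule.Quotient.mk_eq_zero]
          simp [Submodule.mem_smul_pointwise_iff_exists]) (s + 1)
        ((𝔐 ^ s • (⊤ : Submodule A N)).restrictScalars R) (fun y hy ↦ by
          change x • y ∈ 𝔐 ^ (s + 1) • (⊤ : Submodule A N)
          rw [pow_succ', Submodule.mul_smul]
          exact Submodule.smul_mem_smul hx𝔐 hy)
      have h2 : adicLen 𝔐 R N (s + 1) ≤ adicLen 𝔐 R N s + adicLen 𝔐 R (QuotSMulTop x N) (s + 1) := h1
      have h3 := h2.trans (add_le_add ihs (hC (s + 1)))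
      rwa [← Nat.cast_add, ← mul_add, ← Finset.sum_range_succ] at h3

/-- The function `s ↦ ℓ(N / 𝔐 ^ s N)` grows at most like a polynomial of degree `dim N`. -/
theorem exists_adicLen_le [IsNoetherianRing A] (h𝔐 : Module.length R (A ⧸ 𝔐) ≠ ⊤) (d : ℕ) :
    ∀ (N : Type*) [AddCommGroup N] [Module R N] [Module A N] [IsScalarTower R A N]
      [Module.Finite A N], Module.supportDim A N < d →
      ∃ C : ℕ, ∀ s, adicLen 𝔐 R N s ≤ (C * powBound d s : ℕ) := by
  induction d with
  | zero =>
    intro N _ _ _ _ _ hN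
    have : Subsingleton N := by
      rw [← Module.supportDim_eq_bot_iff_subsingleton (R := A)]
      by_contra hne
      obtain ⟨k, hk⟩ := WithBot.ne_bot_iff_exists.1 hne
      rw [← hk] at hN
      exact absurd (WithBot.coe_lt_coe.1 hN) (by simp)
    refine ⟨0, fun s ↦ le_of_eq ?_⟩
    rw [adicLen, relLen_top_eq, Module.length_eq_zero]
    simp
  | succ d ih =>
    intro N iN iR iA iT iF
    -- The dévissage by prime cyclic quotients only knows `A`-modules; the outer terms of an exact
    -- sequence receive their `R`-structure through `A` below.
    revert iR iT
    induction iF using IsNoetherianRing.induction_on_isQuotientEquivQuotientPrime A with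
    | subsingleton N =>
      intro _ _ _
      refine ⟨0, fun s ↦ le_of_eq ?_⟩
      rw [adicLen, relLen_top_eq, Module.length_eq_zero]
      simp
    | quotient N p e =>
      intro _ _ hN
      exact exists_adicLen_le_of_equiv_quotient h𝔐 (fun x hx ↦ ih _ hx) p.1 e hN
    | exact N₁ N₂ N₃ f g hf hg hfg h₁ h₃ =>
      intro _ _ hN
      let _ : Module R N₁ := Module.compHom N₁ (algebraMap R A)
      let _ : Module R N₃ := Module.compHom N₃ (algebraMap R A)
      have : IsScalarTower R A N₁ := IsScalarTower.of_algebraMap_smul fun _ _ ↦ rfl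
      have : IsScalarTower R A N₃ := IsScalarTower.of_algebraMap_smul fun _ _ ↦ rfl
      obtain ⟨C₁, h₁⟩ := h₁ ((Module.supportDim_le_of_injective f hf).trans_lt hN)
      obtain ⟨C₃, h₃⟩ := h₃ ((Module.supportDim_le_of_surjective g hg).trans_lt hN)
      refine ⟨C₁ + C₃, fun s ↦ ?_⟩
      suffices h : adicLen 𝔐 R N₂ s ≤ adicLen 𝔐 R N₁ s + adicLen 𝔐 R N₃ s by
        have h4 := h.trans (add_le_add (h₁ s) (h₃ s))
        rwa [← Nat.cast_add, ← add_mul] at h4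
      refine relLen_le_add_adicLen 𝔐 (R := R) f g hg hfg s
        ((𝔐 ^ s • (⊤ : Submodule A N₁)).restrictScalars R) ?_
      rw [← Submodule.map_le_iff_le_comap]
      have h5 : (𝔐 ^ s • (⊤ : Submodule A N₁)).map f ≤ 𝔐 ^ s • (⊤ : Submodule A N₂) := by
        rw [Submodule.map_smul'']
        exact Submodule.smul_mono le_rfl le_top
      exact h5

end Growth

end CStar

namespace CStar

/-! ### Homogeneous submodules and the ideal `𝔪A + A₁A` -/

section Graded

open IsLocalRing DirectSum

variable {R A M : Type*} [CommRing R] [CommRing A] [Algebra R A]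
  [AddCommGroup M] [Module R M] [Module A M] [IsScalarTower R A M]

section Proj

variable (𝓜 : ℕ → Submodule R M) [DirectSum.Decomposition 𝓜]

/-- The projection of a graded module onto its part of degree `n`. -/
noncomputable def gradedProj (n : ℕ) : M →ₗ[R] M :=
  (𝓜 n).subtype ∘ₗ DirectSum.component R ℕ (fun i ↦ 𝓜 i) n ∘ₗ (decomposeLinearEquiv 𝓜).toLinearMap

theorem gradedProj_mem (n : ℕ) (x : M) : gradedProj 𝓜 n x ∈ 𝓜 n := (decompose 𝓜 x n).2

theorem gradedProj_of_mem {n : ℕ} {x : M} (hx : x ∈ 𝓜 n) : gradedProj 𝓜 n x = x :=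
  decompose_of_mem_same 𝓜 hx

theorem gradedProj_of_mem_ne {m n : ℕ} {x : M} (hx : x ∈ 𝓜 m) (h : m ≠ n) :
    gradedProj 𝓜 n x = 0 :=
  decompose_of_mem_ne 𝓜 hx h

/-- A submodule which contains the homogeneous components of its elements. -/
def IsHomog (X : Submodule A M) : Prop := ∀ n, ∀ x ∈ X, gradedProj 𝓜 n x ∈ X

variable {𝓜}

end Proj

/-- The part of degree `n` of a submodule. -/
def piece (𝓜 : ℕ → Submodule R M) (X : Submodule A M) (n : ℕ) : Submodule R M :=
  X.restrictScalars R ⊓ 𝓜 n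

theorem piece_mono (𝓜 : ℕ → Submodule R M) {X Y : Submodule A M} (h : X ≤ Y) (n : ℕ) :
    piece 𝓜 X n ≤ piece 𝓜 Y n :=
  inf_le_inf_right _ h

variable {𝓐 : ℕ → Submodule R A} {𝓜 : ℕ → Submodule R M}
  [DirectSum.Decomposition 𝓜]

theorem map_gradedProj_smul_le {X : Submodule A M} (hX : IsHomog 𝓜 X) (𝔞 : Ideal R) (n : ℕ) :
    (𝔞 • X.restrictScalars R).map (gradedProj 𝓜 n) ≤ 𝔞 • piece 𝓜 X n := by
  rw [Submodule.map_smul'']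
  refine Submodule.smul_mono le_rfl ?_
  rintro _ ⟨x, hx, rfl⟩
  exact ⟨hX n x hx, gradedProj_mem 𝓜 n x⟩

/-- Projection to degree `n` is `R`-linear, fixes `x` and maps `X` into its degree `n` part. This
transfers statements about `𝔪A` from whole modules to graded pieces. -/
theorem mem_smul_piece {X : Submodule A M} (hX : IsHomog 𝓜 X) (𝔞 : Ideal R) {n : ℕ} {x : M}
    (hx : x ∈ 𝔞.map (algebraMap R A) • X) (hxn : x ∈ 𝓜 n) : x ∈ 𝔞 • piece 𝓜 X n := by
  rw [← gradedProj_of_mem 𝓜 hxn]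
  refine map_gradedProj_smul_le hX 𝔞 n ⟨x, ?_, rfl⟩
  rw [← Ideal.smul_restrictScalars]
  exact hx

variable [SetLike.GradedSMul 𝓐 𝓜]

omit [IsScalarTower R A M] [DirectSum.Decomposition 𝓜] in
theorem smul_mem_degree_succ {a : A} (ha : a ∈ 𝓐 1) {n : ℕ} {x : M} (hx : x ∈ 𝓜 n) :
    a • x ∈ 𝓜 (n + 1) := by
  have h := SetLike.GradedSMul.smul_mem ha hx
  rwa [vadd_eq_add, add_comm] at h

omit [IsScalarTower R A M] in
theorem gradedProj_succ_smul {a : A} (ha : a ∈ 𝓐 1) (n : ℕ) (x : M) :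
    gradedProj 𝓜 (n + 1) (a • x) = a • gradedProj 𝓜 n x := by
  induction x using DirectSum.Decomposition.inductionOn 𝓜 with
  | zero => simp
  | @homogeneous i x =>
    have h := smul_mem_degree_succ (𝓜 := 𝓜) ha x.2
    by_cases hi : i = n
    · subst hi
      rw [gradedProj_of_mem 𝓜 h, gradedProj_of_mem 𝓜 x.2]
    · rw [gradedProj_of_mem_ne 𝓜 h (by omega), gradedProj_of_mem_ne 𝓜 x.2 hi, smul_zero]
  | add x y hx hy => rw [smul_add, map_add, map_add, smul_add, hx, hy]

omit [IsScalarTower R A M] in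
theorem gradedProj_zero_smul {a : A} (ha : a ∈ 𝓐 1) (x : M) : gradedProj 𝓜 0 (a • x) = 0 := by
  induction x using DirectSum.Decomposition.inductionOn 𝓜 with
  | zero => simp
  | @homogeneous i x =>
    exact gradedProj_of_mem_ne 𝓜 (smul_mem_degree_succ (𝓜 := 𝓜) ha x.2) (by omega)
  | add x y hx hy => rw [smul_add, map_add, hx, hy, add_zero]

/-- Induction for `I • X`, where `I` is generated by `L`. -/
theorem span_smul_induction {L : Set A} {X : Submodule A M} {p : M → Prop} {z : M}
    (hz : z ∈ Ideal.span L • X) (hmem : ∀ l ∈ L, ∀ x ∈ X, p (l • x)) (h0 : p 0)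
    (hadd : ∀ x y, p x → p y → p (x + y)) : p z := by
  induction hz using Submodule.smul_induction_on' with
  | smul a ha x hx =>
    induction ha using Submodule.span_induction generalizing x with
    | mem l hl => exact hmem l hl x hx
    | zero => rwa [zero_smul]
    | add a b _ _ h1 h2 => rw [add_smul]; exact hadd _ _ (h1 x hx) (h2 x hx)
    | smul c a _ h => rw [smul_eq_mul, mul_comm, mul_smul]; exact h _ (X.smul_mem c hx)
  | add x _ y _ hx hy => exact hadd _ _ hx hy

omit [IsScalarTower R A M] in
theorem IsHomog.smul {I : Ideal A} (hI : GeneratedByLinearForms 𝓐 I) {X : Submodule A M}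
    (hX : IsHomog 𝓜 X) : IsHomog 𝓜 (I • X) := by
  obtain ⟨L, hL, rfl⟩ := hI
  intro n z hz
  refine span_smul_induction (p := fun z ↦ gradedProj 𝓜 n z ∈ Ideal.span L • X) hz
    (fun l hl x hx ↦ ?_) (by simp) fun x y hx hy ↦ by rw [map_add]; exact add_mem hx hy
  cases n with
  | zero => rw [gradedProj_zero_smul (hL hl)]; exact zero_mem _
  | succ n =>
    rw [gradedProj_succ_smul (hL hl)]
    exact Submodule.smul_mem_smul (Ideal.subset_span hl) (hX n x hx)

omit [IsScalarTower R A M] in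
theorem isHomog_pow {I : Ideal A} (hI : GeneratedByLinearForms 𝓐 I) (i : ℕ) :
    IsHomog 𝓜 (I ^ i • (⊤ : Submodule A M)) := by
  induction i with
  | zero => exact fun _ _ _ ↦ by simp
  | succ i ih =>
    rw [pow_succ', Submodule.mul_smul]
    exact ih.smul hI

-- Every linear factor raises the degree by one and `M` starts in degree `0`. This makes the sums
-- over `i` finite in each internal degree.
omit [IsScalarTower R A M] in
theorem gradedProj_pow_smul_eq_zero {I : Ideal A} (hI : GeneratedByLinearForms 𝓐 I) {i : ℕ} {x : M}
    (hx : x ∈ I ^ i • (⊤ : Submodule A M)) : ∀ n, n < i → gradedProj 𝓜 n x = 0 := by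
  obtain ⟨L, hL, rfl⟩ := hI
  induction i generalizing x with
  | zero => intro n hn; omega
  | succ i ih =>
    rw [pow_succ', Submodule.mul_smul] at hx
    refine span_smul_induction (p := fun x ↦ ∀ n, n < i + 1 → gradedProj 𝓜 n x = 0) hx
      (fun l hl x hx n hn ↦ ?_) (by simp) fun x y hx hy n hn ↦ by
      rw [map_add, hx n hn, hy n hn, add_zero]
    cases n with
    | zero => exact gradedProj_zero_smul (hL hl) x
    | succ n => rw [gradedProj_succ_smul (hL hl), ih hx n (by omega), smul_zero]

theorem piece_pow_eq_bot {I : Ideal A} (hI : GeneratedByLinearForms 𝓐 I) {i n : ℕ} (h : n < i) :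
    piece 𝓜 (I ^ i • (⊤ : Submodule A M)) n = ⊥ := by
  rw [eq_bot_iff]
  rintro x ⟨hx, hxn⟩
  rw [Submodule.mem_bot, ← gradedProj_of_mem 𝓜 hxn]
  exact gradedProj_pow_smul_eq_zero hI hx n h

variable (𝓐) in
/-- The ideal `𝔪 A + A₁ A` of a graded algebra over a local ring. -/
def irrelevantMax [IsLocalRing R] : Ideal A :=
  (maximalIdeal R).map (algebraMap R A) ⊔ Ideal.span (𝓐 1 : Set A)

/-- Modulo linear forms every element of `A` comes from `R`, so the quotient is an image of the
residue field. -/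
theorem length_quotient_irrelevantMax [IsLocalRing R] (hA : Algebra.adjoin R (𝓐 1 : Set A) = ⊤) :
    Module.length R (A ⧸ irrelevantMax 𝓐) ≠ ⊤ := by
  have hsurj : Function.Surjective (algebraMap R (A ⧸ irrelevantMax 𝓐)) := by
    intro x
    obtain ⟨a, rfl⟩ := Ideal.Quotient.mk_surjective x
    have ha : a ∈ Algebra.adjoin R (𝓐 1 : Set A) := hA ▸ trivial
    induction ha using Algebra.adjoin_induction with
    | mem y hy =>
      refine ⟨0, ?_⟩
      rw [map_zero, eq_comm, Ideal.Quotient.eq_zero_iff_mem]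
      exact Ideal.mem_sup_right (Ideal.subset_span hy)
    | algebraMap r => exact ⟨r, rfl⟩
    | add a b _ _ ha hb =>
      obtain ⟨r, hr⟩ := ha
      obtain ⟨r', hr'⟩ := hb
      exact ⟨r + r', by rw [map_add, map_add, hr, hr']⟩
    | mul a b _ _ ha hb =>
      obtain ⟨r, hr⟩ := ha
      obtain ⟨r', hr'⟩ := hb
      exact ⟨r * r', by rw [map_mul, map_mul, hr, hr']⟩
  have hle : Module.length R (A ⧸ irrelevantMax 𝓐) ≤ Module.length R (ResidueField R) := by
    refine Module.length_le_of_surjective (Submodule.liftQ (maximalIdeal R)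
      (Algebra.linearMap R (A ⧸ irrelevantMax 𝓐)) fun r hr ↦ ?_) fun x ↦ ?_
    · rw [LinearMap.mem_ker, Algebra.linearMap_apply]
      change Ideal.Quotient.mk _ (algebraMap R A r) = 0
      rw [Ideal.Quotient.eq_zero_iff_mem]
      exact Ideal.mem_sup_left (Ideal.mem_map_of_mem _ hr)
    · obtain ⟨r, rfl⟩ := hsurj x
      exact ⟨Submodule.Quotient.mk r, rfl⟩
  have h1 : Module.length R (ResidueField R) = 1 := by
    rw [Module.length_eq_one_iff]
    exact isSimpleModule_iff_quot_maximal.2 ⟨_, inferInstance, ⟨LinearEquiv.refl _ _⟩⟩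
  exact ne_top_of_le_ne_top (by rw [h1]; exact ENat.one_ne_top) hle

/-- In degree `j` at most `j` of the `p` factors can be linear forms, so at least `p - j` of them
lie in `𝔪`. -/
theorem gradedProj_irrelevantMax_pow_smul [IsLocalRing R]
    (hA : Algebra.adjoin R (𝓐 1 : Set A) = ⊤) {X : Submodule A M} (hX : IsHomog 𝓜 X) (p : ℕ) {x : M}
    (hx : x ∈ irrelevantMax 𝓐 ^ p • X) (j : ℕ) :
    gradedProj 𝓜 j x ∈ maximalIdeal R ^ (p - j) • piece 𝓜 X j := by
  have hlin : ∀ a ∈ 𝓐 1, ∀ (q : ℕ) (x : M) (i : ℕ),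
      gradedProj 𝓜 i x ∈ maximalIdeal R ^ q • piece 𝓜 X i →
      gradedProj 𝓜 (i + 1) (a • x) ∈ maximalIdeal R ^ q • piece 𝓜 X (i + 1) := by
    intro a ha q x i h
    rw [gradedProj_succ_smul ha]
    generalize gradedProj 𝓜 i x = z at h
    induction h using Submodule.smul_induction_on' with
    | smul r hr y hy =>
      rw [smul_comm]
      exact Submodule.smul_mem_smul hr ⟨X.smul_mem a hy.1, smul_mem_degree_succ ha hy.2⟩
    | add y _ z _ hy hz => rw [smul_add]; exact add_mem hy hz
  -- The condition on all components is packaged as an `A`-submodule, so that the induction only has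
  -- to multiply `P p` by generators of `𝔪A` and of `A₁A`.
  let P : ℕ → Submodule A M := fun p ↦
    { (⨅ j, (maximalIdeal R ^ (p - j) • piece 𝓜 X j).comap (gradedProj 𝓜 j) : Submodule R M) with
      smul_mem' := by
        intro a x hx
        refine smul_mem_of_adjoin_eq_top hA (fun a ha x hx ↦ ?_) a hx
        rw [Submodule.mem_iInf] at hx ⊢
        intro j
        rw [Submodule.mem_comap]
        cases j with
        | zero => rw [gradedProj_zero_smul ha]; exact zero_mem _
        | succ j =>
          exact Submodule.smul_mono (Ideal.pow_le_pow_right (by omega)) le_rfl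
            (hlin a ha _ x j (hx j)) }
  have hP : ∀ p x, x ∈ P p ↔ ∀ j, gradedProj 𝓜 j x ∈ maximalIdeal R ^ (p - j) • piece 𝓜 X j :=
    fun p x ↦ Submodule.mem_iInf _
  suffices h : irrelevantMax 𝓐 ^ p • X ≤ P p from (hP p x).1 (h hx) j
  clear hx
  induction p with
  | zero =>
    intro x hx
    rw [hP]
    intro j
    rw [pow_zero, Ideal.one_eq_top, Submodule.top_smul] at hx
    rw [Nat.zero_sub, pow_zero, Ideal.one_eq_top, Submodule.top_smul]
    exact ⟨hX j x hx, gradedProj_mem 𝓜 j x⟩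
  | succ p ih =>
    rw [pow_succ', Submodule.mul_smul]
    refine (Submodule.smul_mono le_rfl ih).trans ?_
    rw [irrelevantMax, Submodule.sup_smul]
    refine sup_le ?_ fun x hx ↦ ?_
    · rw [← Submodule.restrictScalars_le R, Ideal.smul_restrictScalars]
      refine Submodule.smul_le.2 fun r hr x hx ↦ ?_
      change r • x ∈ P (p + 1)
      rw [hP]
      intro j
      rw [map_smul]
      have h := Submodule.smul_mem_smul hr ((hP p x).1 hx j)
      rw [← Submodule.mul_smul, ← pow_succ'] at h
      exact Submodule.smul_mono (Ideal.pow_le_pow_right (by omega)) le_rfl h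
    · refine span_smul_induction hx (fun l hl x hx ↦ ?_) (zero_mem _) fun x y hx hy ↦ add_mem hx hy
      rw [hP]
      intro j
      cases j with
      | zero => rw [gradedProj_zero_smul hl]; exact zero_mem _
      | succ j =>
        rw [Nat.add_sub_add_right]
        exact hlin l hl _ x j ((hP p x).1 hx j)

end Graded

/-! ### Finitely many linear generators -/

section FiniteGeneration

open DirectSum

variable {R A : Type*} [CommRing R] [CommRing A] [Algebra R A]

/-- A standard graded algebra which is noetherian is generated by finitely many linear forms. -/
theorem exists_finite_adjoin_eq_top [IsNoetherianRing A] (𝓐 : ℕ → Submodule R A) [GradedAlgebra 𝓐]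
    (hA : Algebra.adjoin R (𝓐 1 : Set A) = ⊤) :
    ∃ Y : Set A, Y.Finite ∧ Y ⊆ 𝓐 1 ∧ Algebra.adjoin R Y = ⊤ := by
  obtain ⟨Y, hY1, hY2⟩ := Submodule.fg_span_iff_fg_span_finset_subset (R := A) (𝓐 1 : Set A) |>.1
    (IsNoetherian.noetherian _)
  refine ⟨Y, Y.finite_toSet, hY1, ?_⟩
  -- The degree `0` part is the image of `R`; hence an `A`-combination of linear forms, projected to
  -- degree `1`, becomes an `R`-combination.
  have hzero : ∀ a : A, ∃ r : R, gradedProj 𝓐 0 a = algebraMap R A r := by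
    intro a
    have ha : a ∈ Algebra.adjoin R (𝓐 1 : Set A) := hA ▸ trivial
    have hmul : ∀ a b : A, gradedProj 𝓐 0 (a * b) = gradedProj 𝓐 0 a * gradedProj 𝓐 0 b :=
      fun a b ↦ map_mul (GradedRing.projZeroRingHom 𝓐) a b
    induction ha using Algebra.adjoin_induction with
    | mem y hy => exact ⟨0, by rw [gradedProj_of_mem_ne 𝓐 hy one_ne_zero, map_zero]⟩
    | algebraMap r => exact ⟨r, gradedProj_of_mem 𝓐 (SetLike.algebraMap_mem_graded 𝓐 r)⟩
    | add a b _ _ ha hb =>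
      obtain ⟨r, hr⟩ := ha
      obtain ⟨r', hr'⟩ := hb
      exact ⟨r + r', by rw [map_add, map_add, hr, hr']⟩
    | mul a b _ _ ha hb =>
      obtain ⟨r, hr⟩ := ha
      obtain ⟨r', hr'⟩ := hb
      exact ⟨r * r', by rw [hmul, map_mul, hr, hr']⟩
  have hspan : (𝓐 1 : Set A) ⊆ Submodule.span R (Y : Set A) := by
    intro x hx
    rw [← gradedProj_of_mem 𝓐 hx]
    have hx' : x ∈ Submodule.span A (Y : Set A) := hY2 ▸ Submodule.subset_span hx
    have hx'' : x ∈ Ideal.span (Y : Set A) • (⊤ : Submodule A A) := by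
      rwa [smul_eq_mul, Ideal.mul_top]
    refine span_smul_induction
      (p := fun x ↦ gradedProj 𝓐 1 x ∈ Submodule.span R (Y : Set A)) hx'' (fun l hl x _ ↦ ?_)
      (by simp) fun x y hx hy ↦ by rw [map_add]; exact add_mem hx hy
    obtain ⟨r, hr⟩ := hzero x
    rw [gradedProj_succ_smul (𝓜 := 𝓐) (hY1 hl), hr, smul_eq_mul, mul_comm, ← Algebra.smul_def]
    exact Submodule.smul_mem _ r (Submodule.subset_span hl)
  refine top_le_iff.1 (hA ▸ Algebra.adjoin_le fun x hx ↦ ?_)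
  exact Algebra.span_le_adjoin R _ (hspan hx)

end FiniteGeneration

end CStar

namespace CStar

/-! ### Lengths computed coefficient by coefficient -/

section CoeffData

open IsLocalRing

variable {R M : Type*} [CommRing R] [AddCommGroup M] [Module R M]

/-- An identification of `P` with the module `⨁ᵢ Gᵢ` of polynomials with coefficients `Gᵢ ⊆ M`. -/
structure CoeffData (G : ℕ → Submodule R M) (P : Type*) [AddCommGroup P] [Module R P] where
  coeff : P →ₗ[R] (ℕ → M)
  coeff_injective : Function.Injective coeff
  coeff_mem : ∀ p i, coeff p i ∈ G i
  single : ∀ i, G i →ₗ[R] P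
  coeff_single : ∀ i x, coeff (single i x) = Pi.single i (x : M)

variable {G G' : ℕ → Submodule R M} {𝓜 : ℕ → Submodule R M}
  {P T : Type*} [AddCommGroup P] [Module R P] [AddCommGroup T] [Module R T]

/-- The elements with coefficients of degree `n`. -/
def CoeffData.level (c : CoeffData G P) (𝓜 : ℕ → Submodule R M) (n : ℕ) : Submodule R P where
  carrier := {p | ∀ i, c.coeff p i ∈ 𝓜 n}
  add_mem' hp hq i := by rw [map_add]; exact add_mem (hp i) (hq i)
  zero_mem' i := by rw [map_zero]; exact zero_mem _
  smul_mem' r p hp i := by rw [map_smul]; exact Submodule.smul_mem _ r (hp i)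

/-- The length of the degree `n` part of `⨁ᵢ Gᵢ / (𝔪 ^ (s + 1) Gᵢ + G'ᵢ)`, if `[Gᵢ]ₙ = 0` for
`i > n`. -/
noncomputable def filtLen [IsLocalRing R] (𝓜 G' G : ℕ → Submodule R M) (s n : ℕ) : ℕ∞ :=
  ∑ i ∈ Finset.range (n + 1),
    relLen (maximalIdeal R ^ (s + 1) • (G i ⊓ 𝓜 n) ⊔ G' i) (G i ⊓ 𝓜 n)

theorem CoeffData.eq_sum_single (c : CoeffData G P) {n : ℕ} {p : P}
    (hp : ∀ i, n < i → c.coeff p i = 0) :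
    p = ∑ i : Fin (n + 1), c.single i ⟨c.coeff p i, c.coeff_mem p i⟩ := by
  apply c.coeff_injective
  ext j
  rw [map_sum, Finset.sum_apply]
  simp only [c.coeff_single]
  by_cases hj : j < n + 1
  · rw [Finset.sum_eq_single ⟨j, hj⟩]
    · simp
    · intro b _ hb
      exact Pi.single_eq_of_ne (fun h ↦ hb (Fin.ext h.symm)) _
    · simp
  · rw [hp j (by omega), Finset.sum_eq_zero]
    intro b _
    exact Pi.single_eq_of_ne (by omega) _

theorem CoeffData.single_mem_smul (c : CoeffData G P) {𝔞 : Ideal R} {i : ℕ} {Y : Submodule R M}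
    {x : M} (hx : x ∈ 𝔞 • Y) (hxG : x ∈ G i) (hY : Y ≤ G i := by exact inf_le_left) :
    c.single i ⟨x, hxG⟩ ∈ 𝔞 • (Y.submoduleOf (G i)).map (c.single i) := by
  rw [← Submodule.map_smul'']
  refine Submodule.mem_map_of_mem ?_
  have h : 𝔞 • Y = (𝔞 • Y.submoduleOf (G i)).map (G i).subtype := by
    rw [Submodule.map_smul'', Submodule.submoduleOf, Submodule.map_comap_subtype, inf_eq_right.2 hY]
  rw [h] at hx
  obtain ⟨y, hy, hyx⟩ := hx
  obtain rfl : y = ⟨x, hxG⟩ := Subtype.ext hyx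
  exact hy

/-- The degree `n` part of `P` is the direct sum of the degree `n` parts of the `Gᵢ`, and only `i ≤
n` contribute. Both `𝔪 ^ (s + 1)` and the kernel of `f` respect this decomposition. -/
theorem CoeffData.hilbSum_eq [IsLocalRing R] (c : CoeffData G P) (f : P →ₗ[R] T)
    (hker : ∀ p, f p = 0 ↔ ∀ i, c.coeff p i ∈ G' i) (hvan : ∀ n i, n < i → G i ⊓ 𝓜 n = ⊥)
    (s n : ℕ) : hilbSum (fun n ↦ (c.level 𝓜 n).map f) s n = filtLen 𝓜 G' G s n := by
  set K : ℕ → Submodule R M := fun i ↦ maximalIdeal R ^ (s + 1) • (G i ⊓ 𝓜 n) ⊔ G' i with hK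
  have hlev : ∀ v ∈ c.level 𝓜 n, ∀ i, c.coeff v i ∈ G i ⊓ 𝓜 n :=
    fun v hv i ↦ ⟨c.coeff_mem v i, hv i⟩
  have hzero : ∀ v ∈ c.level 𝓜 n, ∀ i, n < i → c.coeff v i = 0 := by
    intro v hv i hi
    have := hlev v hv i
    rwa [hvan n i hi, Submodule.mem_bot] at this
  have hsingle : ∀ i (x : M) (hx : x ∈ G i), x ∈ 𝓜 n → c.single i ⟨x, hx⟩ ∈ c.level 𝓜 n := by
    intro i x hx hxn j
    rw [c.coeff_single]
    by_cases hj : j = i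
    · subst hj; simpa using hxn
    · rw [Pi.single_eq_of_ne hj]; exact zero_mem _
  have hcoeffle : ∀ i, (maximalIdeal R ^ (s + 1) • c.level 𝓜 n).map (LinearMap.proj i ∘ₗ c.coeff) ≤
      maximalIdeal R ^ (s + 1) • (G i ⊓ 𝓜 n) := by
    intro i
    rw [Submodule.map_smul'']
    refine Submodule.smul_mono le_rfl ?_
    rintro _ ⟨v, hv, rfl⟩
    exact hlev v hv i
  rw [hilbSum_eq_relLen, ← Submodule.map_smul'', relLen_map, filtLen]
  let g : c.level 𝓜 n →ₗ[R] (i : Fin (n + 1)) →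
      (↥(G i ⊓ 𝓜 n) ⧸ (K i).submoduleOf (G i ⊓ 𝓜 n)) :=
    LinearMap.pi fun i ↦ ((K i).submoduleOf (G i ⊓ 𝓜 n)).mkQ ∘ₗ
      ((LinearMap.proj (i : ℕ) ∘ₗ c.coeff ∘ₗ (c.level 𝓜 n).subtype).codRestrict (G i ⊓ 𝓜 n)
        fun v ↦ hlev v v.2 i)
  have hgapply : ∀ v i, g v i = ((K i).submoduleOf (G i ⊓ 𝓜 n)).mkQ ⟨c.coeff v i, hlev v v.2 i⟩ :=
    fun _ _ ↦ rfl
  have hg : Function.Surjective g := by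
    intro y
    choose x hx using fun i ↦ Submodule.mkQ_surjective _ (y i)
    refine ⟨⟨∑ i : Fin (n + 1), c.single i ⟨x i, (x i).2.1⟩,
      sum_mem fun i _ ↦ hsingle i _ _ (x i).2.2⟩, ?_⟩
    ext i
    rw [hgapply, ← hx]
    congr 1
    apply Subtype.ext
    simp only [map_sum, Finset.sum_apply, c.coeff_single]
    rw [Finset.sum_eq_single i]
    · simp
    · intro b _ hb
      exact Pi.single_eq_of_ne (fun h ↦ hb (Fin.ext h.symm)) _
    · simp
  rw [relLen_eq_of_surjective g hg, Module.length_pi_of_fintype, Finset.sum_range]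
  · rfl
  intro v
  have h1 : g v = 0 ↔ ∀ i : Fin (n + 1), c.coeff v i ∈ K i := by
    rw [funext_iff]
    refine forall_congr' fun i ↦ ?_
    rw [hgapply, Submodule.mkQ_apply, Pi.zero_apply, Submodule.Quotient.mk_eq_zero,
      mem_submoduleOf_iff]
  rw [h1]
  constructor
  · intro h
    choose a ha b hb hab using fun i ↦ Submodule.mem_sup.1 (h i)
    have haG : ∀ i : Fin (n + 1), a i ∈ G i ⊓ 𝓜 n := fun i ↦ Submodule.smul_le_right (ha i)
    have hbG : ∀ i : Fin (n + 1), b i ∈ G i ⊓ 𝓜 n := fun i ↦ by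
      rw [eq_sub_of_add_eq' (hab i)]
      exact sub_mem (hlev v v.2 i) (haG i)
    rw [c.eq_sum_single (hzero v v.2)]
    refine sum_mem fun i _ ↦ ?_
    have h2 : (⟨c.coeff v i, c.coeff_mem v i⟩ : G i) = ⟨a i, (haG i).1⟩ + ⟨b i, (hbG i).1⟩ :=
      Subtype.ext (hab i).symm
    rw [h2, map_add]
    refine add_mem (Submodule.mem_sup_left ?_) (Submodule.mem_sup_right ?_)
    · refine Submodule.smul_mono le_rfl ?_ (c.single_mem_smul (Y := G i ⊓ 𝓜 n) (ha i) (haG i).1)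
      rintro _ ⟨⟨x, hx⟩, hx', rfl⟩
      exact hsingle i x hx (mem_submoduleOf_iff.1 hx').2
    · rw [LinearMap.mem_ker, hker]
      intro j
      rw [c.coeff_single]
      by_cases hj : j = i
      · subst hj; simpa using hb i
      · rw [Pi.single_eq_of_ne hj]; exact zero_mem _
  · intro h i
    obtain ⟨a, ha, b, hb, hab⟩ := Submodule.mem_sup.1 h
    rw [← hab, map_add]
    refine add_mem (Submodule.mem_sup_left (hcoeffle i ⟨a, ha, rfl⟩)) (Submodule.mem_sup_right ?_)
    exact (hker b).1 hb i

/-- The kernel of `f` is homogeneous: if `p` lifts an element of the sum and `v` of degree `m` lifts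
the same element, the degree `m` part of `p - v` is again in the kernel. This supplies the
independence hypothesis of `exists_hilb_eq`. -/
theorem CoeffData.iSup_inf_le [DirectSum.Decomposition 𝓜] (c : CoeffData G P) (f : P →ₗ[R] T)
    (hker : ∀ p, f p = 0 ↔ ∀ i, c.coeff p i ∈ G' i)
    (hG' : ∀ i n, ∀ x ∈ G' i, gradedProj 𝓜 n x ∈ G' i) (W : ℕ → Submodule R T)
    (hW : ∀ n, W n ≤ (c.level 𝓜 n).map f) (m : ℕ) :
    (⨆ n, W n) ⊓ (c.level 𝓜 m).map f ≤ W m := by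
  rintro x ⟨hx, v, hv, rfl⟩
  have key : ∀ x ∈ ⨆ n, W n, ∃ p, f p = x ∧ ∃ q ∈ c.level 𝓜 m, f q ∈ W m ∧
      ∀ i, gradedProj 𝓜 m (c.coeff p i) = c.coeff q i := by
    intro x hx
    induction hx using Submodule.iSup_induction' with
    | mem n x hx =>
      obtain ⟨p, hp, rfl⟩ := hW n hx
      by_cases h : n = m
      · subst h
        exact ⟨p, rfl, p, hp, hx, fun i ↦ gradedProj_of_mem 𝓜 (hp i)⟩
      · exact ⟨p, rfl, 0, zero_mem _, by rw [map_zero]; exact zero_mem _, fun i ↦ by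
          rw [gradedProj_of_mem_ne 𝓜 (hp i) h, map_zero, Pi.zero_apply]⟩
    | zero => exact ⟨0, map_zero _, 0, zero_mem _, by rw [map_zero]; exact zero_mem _, by simp⟩
    | add x y _ _ hx hy =>
      obtain ⟨p, hp, q, hq, hqW, h⟩ := hx
      obtain ⟨p', hp', q', hq', hqW', h'⟩ := hy
      refine ⟨p + p', by rw [map_add, hp, hp'], q + q', add_mem hq hq',
        by rw [map_add]; exact add_mem hqW hqW', fun i ↦ ?_⟩
      rw [map_add, Pi.add_apply, map_add, h, h', map_add, Pi.add_apply]
  obtain ⟨p, hp, q, hq, hqW, h⟩ := key _ hx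
  have h1 : ∀ i, c.coeff (p - v) i ∈ G' i := (hker _).1 (by rw [map_sub, hp, sub_self])
  have h2 : f (q - v) = 0 := (hker _).2 fun i ↦ by
    have h3 := hG' i m _ (h1 i)
    rwa [map_sub, Pi.sub_apply, map_sub, h, gradedProj_of_mem 𝓜 (hv i), ← Pi.sub_apply,
      ← map_sub] at h3
  rw [map_sub, sub_eq_zero] at h2
  rwa [← h2]

end CoeffData

end CStar

namespace CStar

open Polynomial

/-! ### Rees modules of filtrations and uniform Artin-Rees -/

section Finite

variable {A M : Type*} [CommRing A] [AddCommGroup M] [Module A M] {I : Ideal A}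

theorem finite_submodule [IsNoetherianRing A] [Module.Finite A M] {F : I.Filtration M}
    (hF : F.Stable) : Module.Finite (reesAlgebra I) F.submodule := by
  rw [Module.Finite.iff_fg, Ideal.Filtration.submodule_fg_iff_stable]
  · exact hF
  · exact fun i ↦ IsNoetherian.noetherian _

end Finite

section Filtration

variable {R A M : Type*} [CommRing R] [CommRing A] [Algebra R A]
  [AddCommGroup M] [Module R M] [Module A M] [IsScalarTower R A M] {I : Ideal A}

theorem single_mem_submodule (F : I.Filtration M) {i : ℕ} {x : M} (hx : x ∈ F.N i) :
    PolynomialModule.single A i x ∈ F.submodule := by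
  rw [Ideal.Filtration.mem_submodule]
  intro j
  rw [PolynomialModule.coeff_single, Finsupp.single_apply]
  split_ifs with h
  · exact h ▸ hx
  · exact zero_mem _

/-- An extended ideal acts through constants, so its multiples of the Rees module are determined one
coefficient at a time. -/
theorem mem_map_smul_submodule (F : I.Filtration M) (𝔞 : Ideal A) (z : F.submodule) :
    z ∈ 𝔞.map (algebraMap A (reesAlgebra I)) • (⊤ : Submodule (reesAlgebra I) F.submodule) ↔
      ∀ i, z.1.coeff i ∈ 𝔞 • F.N i := by
  have hres : ∀ w : F.submodule,
      w ∈ 𝔞.map (algebraMap A (reesAlgebra I)) • (⊤ : Submodule (reesAlgebra I) F.submodule) ↔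
      w ∈ 𝔞 • (⊤ : Submodule A F.submodule) := fun w ↦ by
    rw [← Submodule.restrictScalars_top A (reesAlgebra I) F.submodule, ← Ideal.smul_restrictScalars]
    rfl
  constructor
  · intro hz i
    rw [hres] at hz
    induction hz using Submodule.smul_induction_on' with
    | smul r hr w _ => exact Submodule.smul_mem_smul hr ((F.mem_submodule _).1 w.2 i)
    | add w _ w' _ h h' => exact add_mem h h'
  · intro h
    have hsingle : ∀ i x (hx : x ∈ F.N i), x ∈ 𝔞 • F.N i →
        (⟨_, single_mem_submodule F hx⟩ : F.submodule) ∈ 𝔞 • (⊤ : Submodule A F.submodule) := by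
      intro i x hx hx'
      let σ : F.N i →ₗ[A] F.submodule :=
        { toFun := fun x ↦ ⟨PolynomialModule.single A i x, single_mem_submodule F x.2⟩
          map_add' := fun x y ↦ Subtype.ext (PolynomialModule.single_add i _ _)
          map_smul' := fun r x ↦ Subtype.ext (PolynomialModule.single_smul i _ _) }
      have h1 : 𝔞 • F.N i = (𝔞 • (⊤ : Submodule A (F.N i))).map (F.N i).subtype := by
        rw [Submodule.map_smul'', Submodule.map_top, Submodule.range_subtype]
      rw [h1] at hx'
      obtain ⟨y, hy, rfl⟩ := hx'
      have h2 : σ y ∈ (𝔞 • (⊤ : Submodule A (F.N i))).map σ := Submodule.mem_map_of_mem hy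
      rw [Submodule.map_smul''] at h2
      exact Submodule.smul_mono le_rfl le_top h2
    rw [hres]
    have hsum : z = ∑ i ∈ z.1.coeff.support,
        (⟨_, single_mem_submodule F ((F.mem_submodule _).1 z.2 i)⟩ : F.submodule) := by
      apply Subtype.ext
      rw [AddSubmonoidClass.coe_finsetSum]
      apply PolynomialModule.coeff_injective
      rw [PolynomialModule.coeff_sum]
      exact (Finsupp.sum_single z.1.coeff).symm
    rw [hsum]
    exact sum_mem fun i _ ↦ hsingle i _ ((F.mem_submodule _).1 z.2 i) (h i)

/-- A uniform version of the **Artin-Rees lemma** for the levels of two filtrations. -/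
theorem exists_pow_smul_inf_le [IsNoetherianRing A] [Module.Finite A M] {F F' : I.Filtration M}
    (hF : F.Stable) (𝔞 : Ideal A) : ∃ c : ℕ, ∀ s i x,
      x ∈ 𝔞 ^ (s + c) • F.N i → x ∈ F'.N i → x ∈ 𝔞 ^ s • F'.N i := by
  have hfin := finite_submodule hF
  -- A single application over the Rees algebra; reading off the coefficient of `tⁱ` then yields the
  -- same `c` for every `i`.
  obtain ⟨c, hc⟩ := Ideal.exists_pow_inf_eq_pow_smul (R := reesAlgebra I) (M := F.submodule)
    (𝔞.map (algebraMap A (reesAlgebra I))) (Submodule.submoduleOf F'.submodule F.submodule)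
  refine ⟨c, fun s i x hx hx' ↦ ?_⟩
  have hxF : x ∈ F.N i := Submodule.smul_le_right hx
  have h1 : (⟨_, single_mem_submodule F hxF⟩ : F.submodule) ∈
      (𝔞.map (algebraMap A (reesAlgebra I))) ^ (s + c) •
        (⊤ : Submodule (reesAlgebra I) F.submodule) ⊓ F'.submodule.submoduleOf F.submodule := by
    refine ⟨?_, single_mem_submodule F' hx'⟩
    rw [SetLike.mem_coe, ← Ideal.map_pow, mem_map_smul_submodule]
    intro j
    rw [PolynomialModule.coeff_single, Finsupp.single_apply]
    split_ifs with h
    · exact h ▸ hx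
    · exact zero_mem _
  rw [hc (s + c) (Nat.le_add_left _ _), Nat.add_sub_cancel] at h1
  have h2 : (⟨_, single_mem_submodule F hxF⟩ : F.submodule) ∈
      (𝔞.map (algebraMap A (reesAlgebra I))) ^ s • F'.submodule.submoduleOf F.submodule :=
    Submodule.smul_mono le_rfl inf_le_right h1
  have h3 : PolynomialModule.single A i x ∈
      (𝔞.map (algebraMap A (reesAlgebra I))) ^ s • F'.submodule := by
    have h4 := Submodule.mem_map_of_mem (f := F.submodule.subtype) h2
    rw [Submodule.map_smul'', Submodule.submoduleOf, Submodule.map_comap_subtype] at h4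
    exact Submodule.smul_mono le_rfl inf_le_right h4
  have h5 : (⟨_, single_mem_submodule F' hx'⟩ : F'.submodule) ∈
      (𝔞 ^ s).map (algebraMap A (reesAlgebra I)) •
        (⊤ : Submodule (reesAlgebra I) F'.submodule) := by
    rw [Ideal.map_pow]
    have h6 : (𝔞.map (algebraMap A (reesAlgebra I))) ^ s • F'.submodule =
        ((𝔞.map (algebraMap A (reesAlgebra I))) ^ s •
          (⊤ : Submodule (reesAlgebra I) F'.submodule)).map F'.submodule.subtype := by
      rw [Submodule.map_smul'', Submodule.map_top, Submodule.range_subtype]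
    rw [h6] at h3
    obtain ⟨y, hy, hyx⟩ := h3
    obtain rfl : y = ⟨_, single_mem_submodule F' hx'⟩ := Subtype.ext hyx
    exact hy
  have h7 := (mem_map_smul_submodule F' (𝔞 ^ s) _).1 h5 i
  rwa [PolynomialModule.coeff_single, Finsupp.single_eq_same] at h7

variable (R) in
/-- The coefficients of the elements of the Rees module of a filtration. -/
noncomputable def filtrationCoeffData (F : I.Filtration M) :
    CoeffData (fun i ↦ (F.N i).restrictScalars R) F.submodule where
  coeff :=
    { toFun := fun f i ↦ f.1.coeff i
      map_add' := fun _ _ ↦ rfl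
      map_smul' := fun _ _ ↦ rfl }
  coeff_injective f g h := Subtype.ext (PolynomialModule.coeff_injective
    (Finsupp.ext fun i ↦ congrFun h i))
  coeff_mem f i := (F.mem_submodule _).1 f.2 i
  single i :=
    { toFun := fun x ↦ ⟨PolynomialModule.single A i x, single_mem_submodule F x.2⟩
      map_add' := fun x y ↦ Subtype.ext (PolynomialModule.single_add i _ _)
      map_smul' := fun r x ↦ Subtype.ext (by
        apply PolynomialModule.coeff_injective
        exact (Finsupp.smul_single r i (x : M)).symm) }
  coeff_single i x := by
    ext j
    exact Finsupp.single_apply.trans (by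
      by_cases h : i = j
      · subst h; simp
      · rw [if_neg h, Pi.single_eq_of_ne (Ne.symm h)])

variable (R M I) in
/-- The coefficients of the elements of the Rees module of an ideal. -/
noncomputable def reesCoeffData :
    CoeffData (fun i ↦ (I ^ i • (⊤ : Submodule A M)).restrictScalars R) (ReesModule M I) where
  coeff :=
    { toFun := fun f i ↦ f.coeff i
      map_add' := fun f g ↦ funext fun i ↦ ReesModule.coeff_add f g i
      map_smul' := fun r f ↦ funext fun i ↦ ReesModule.coeff_smul r f i }
  coeff_injective f g h := Subtype.ext (PolynomialModule.coeff_injective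
    (Finsupp.ext fun i ↦ congrFun h i))
  coeff_mem f i := (Ideal.Filtration.mem_submodule _ _).1 f.2 i
  single i :=
    { toFun := fun x ↦ (⟨PolynomialModule.single A i x, single_mem_submodule
        (I.stableFiltration ⊤) x.2⟩ : ↥((I.stableFiltration (⊤ : Submodule A M)).submodule))
      map_add' := fun x y ↦ Subtype.ext (PolynomialModule.single_add i _ _)
      map_smul' := fun r x ↦ Subtype.ext (by
        apply PolynomialModule.coeff_injective
        ext j
        refine Eq.trans ?_ (ReesModule.coeff_smul r (_ : ReesModule M I) j).symm
        exact DFunLike.congr_fun (Finsupp.smul_single r i (x : M)).symm j) }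
  coeff_single i x := by
    ext j
    exact Finsupp.single_apply.trans (by
      by_cases h : i = j
      · subst h; simp
      · rw [if_neg h, Pi.single_eq_of_ne (Ne.symm h)])

/-- The levels of a filtration, over `R`. -/
def levels (R : Type*) [CommRing R] [Algebra R A] [Module R M] [IsScalarTower R A M]
    (F : I.Filtration M) (i : ℕ) : Submodule R M := (F.N i).restrictScalars R

/-- The filtration `F` shifted by one: `i ↦ F (i + 1)`. -/
def succFiltration (F : I.Filtration M) : I.Filtration M where
  N i := F.N (i + 1)
  mono _ := F.mono _
  smul_le _ := F.smul_le _

theorem mem_reesIdeal_smul_top_iff (f : ReesModule M I) :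
    f ∈ (reesIdeal I • ⊤ : Submodule (reesAlgebra I) (ReesModule M I)) ↔
      ∀ i, f.coeff i ∈ I ^ (i + 1) • (⊤ : Submodule A M) := by
  refine (mem_map_smul_submodule (I.stableFiltration ⊤) I f).trans (forall_congr' fun i ↦ ?_)
  rw [pow_succ', Submodule.mul_smul]
  rfl

theorem hilbSum_internalGrading [IsLocalRing R] {𝓐 : ℕ → Submodule R A} {𝓜 : ℕ → Submodule R M}
    [DirectSum.Decomposition 𝓜] [SetLike.GradedSMul 𝓐 𝓜] (hI : GeneratedByLinearForms 𝓐 I)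
    (s n : ℕ) : hilbSum (internalGrading M I 𝓜) s n =
      filtLen 𝓜 (levels R (succFiltration (I.stableFiltration (⊤ : Submodule A M))))
        (levels R (I.stableFiltration (⊤ : Submodule A M))) s n :=
  (reesCoeffData R M I).hilbSum_eq
    (G' := levels R (succFiltration (I.stableFiltration (⊤ : Submodule A M))))
    ((Submodule.mkQ (reesIdeal I • ⊤ :
      Submodule (reesAlgebra I) (ReesModule M I))).restrictScalars R)
    (fun f ↦ (Submodule.Quotient.mk_eq_zero _).trans (mem_reesIdeal_smul_top_iff f))
    (fun _ _ h ↦ piece_pow_eq_bot hI h) s n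

end Filtration

end CStar

namespace CStar

open Polynomial

/-! ### Hilbert functions of quotients of Rees modules -/

section HilbertFunction

variable {R A M : Type*} [CommRing R] [CommRing A] [Algebra R A] {I : Ideal A}

/-- The generators are linear forms of `A` in `t`-degree `0` and products `z t` with `z ∈ I` linear.
As `t` has internal degree `0`, all of them have internal degree one. -/
theorem exists_reesAlgebra_generators [IsNoetherianRing A] {𝓐 : ℕ → Submodule R A}
    [GradedAlgebra 𝓐] (hA : Algebra.adjoin R (𝓐 1 : Set A) = ⊤)
    (hI : GeneratedByLinearForms 𝓐 I) : ∃ Y : Set (reesAlgebra I), Y.Finite ∧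
      Algebra.adjoin R Y = ⊤ ∧ ∀ y ∈ Y, ∃ a ∈ 𝓐 1, ∃ i, (y : A[X]) = monomial i a := by
  obtain ⟨Y₀, hY₀, hY₀1, hY₀top⟩ := exists_finite_adjoin_eq_top 𝓐 hA
  obtain ⟨L, hL1, rfl⟩ := hI
  obtain ⟨L₀, hL₀, hL₀s⟩ := Submodule.fg_span_iff_fg_span_finset_subset (R := A) L |>.1
    (IsNoetherian.noetherian _)
  set I := Ideal.span L with hIdef
  have hLI : ∀ z : L₀, monomial 1 (z : A) ∈ reesAlgebra I := fun z ↦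
    reesAlgebra.monomial_mem.2 (by rw [pow_one]; exact Ideal.subset_span (hL₀ z.2))
  set Y : Set (reesAlgebra I) :=
    algebraMap A (reesAlgebra I) '' Y₀ ∪ Set.range fun z : L₀ ↦ ⟨_, hLI z⟩ with hYdef
  refine ⟨Y, (hY₀.image _).union (Set.finite_range _), ?_, ?_⟩
  · set S := (Algebra.adjoin R Y).map ((reesAlgebra I).val.restrictScalars R) with hS
    have hC : ∀ a : A, C a ∈ S := by
      intro a
      refine ⟨algebraMap A (reesAlgebra I) a, ?_, rfl⟩
      have ha : a ∈ Algebra.adjoin R Y₀ := hY₀top ▸ Algebra.mem_top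
      have h : algebraMap A (reesAlgebra I) a ∈
          (Algebra.adjoin R Y₀).map (IsScalarTower.toAlgHom R A (reesAlgebra I)) := ⟨a, ha, rfl⟩
      rw [AlgHom.map_adjoin] at h
      exact Algebra.adjoin_mono Set.subset_union_left h
    have hz : ∀ z ∈ I, monomial 1 z ∈ S := by
      intro z hz
      rw [hIdef, Ideal.span, hL₀s] at hz
      induction hz using Submodule.span_induction with
      | mem z hz => exact ⟨⟨_, hLI ⟨z, hz⟩⟩, Algebra.subset_adjoin (Or.inr ⟨⟨z, hz⟩, rfl⟩), rfl⟩
      | zero => rw [map_zero]; exact zero_mem _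
      | add x y _ _ hx hy => rw [map_add]; exact add_mem hx hy
      | smul a x _ hx =>
        rw [← smul_monomial, smul_eq_C_mul]
        exact mul_mem (hC a) hx
    rw [eq_top_iff]
    rintro f -
    have hf : (f : A[X]) ∈ S := by
      obtain ⟨f, h⟩ := f
      change f ∈ S
      rw [← adjoin_monomial_eq_reesAlgebra] at h
      induction h using Algebra.adjoin_induction with
      | mem x hx => obtain ⟨z, hzI, rfl⟩ := hx; exact hz z hzI
      | algebraMap a => exact hC a
      | add x y _ _ hx hy => exact add_mem hx hy
      | mul x y _ _ hx hy => exact mul_mem hx hy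
    obtain ⟨g, hg, hgf⟩ := hf
    rwa [← Subtype.ext (a1 := g) (a2 := f) hgf]
  · rintro y (⟨a, ha, rfl⟩ | ⟨z, rfl⟩)
    · exact ⟨a, hY₀1 ha, 0, rfl⟩
    · exact ⟨z, hL1 (hL₀ z.2), 1, rfl⟩

variable [AddCommGroup M] [Module R M] [Module A M] [IsScalarTower R A M]

theorem CoeffData.exists_filtLen_eq [IsLocalRing R] [IsNoetherianRing R] {B P : Type*} [CommRing B]
    [IsNoetherianRing B] [Algebra R B] [AddCommGroup P] [Module R P] [Module B P]
    [IsScalarTower R B P] [Module.Finite B P] {𝓜 G G' : ℕ → Submodule R M}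
    [DirectSum.Decomposition 𝓜] (c : CoeffData G P) (Q : Submodule B P)
    (hker : ∀ p, p ∈ Q ↔ ∀ i, c.coeff p i ∈ G' i)
    (hG' : ∀ i n, ∀ x ∈ G' i, gradedProj 𝓜 n x ∈ G' i)
    (hvan : ∀ n i, n < i → G i ⊓ 𝓜 n = ⊥) {Y : Set B} (hYfin : Y.Finite)
    (hY : Algebra.adjoin R Y = ⊤)
    (hY1 : ∀ y ∈ Y, ∀ n, ∀ p ∈ c.level 𝓜 n, y • p ∈ c.level 𝓜 (n + 1)) :
    ∃ h : ℕ → ℕ → ℕ, (∀ s n, filtLen 𝓜 G' G s n = h s n) ∧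
      (fun s n ↦ (h s n : ℤ)) ∈ evBinom₂ := by
  have hker' : ∀ p, Q.mkQ.restrictScalars R p = 0 ↔ ∀ i, c.coeff p i ∈ G' i :=
    fun p ↦ (Submodule.Quotient.mk_eq_zero _).trans (hker p)
  obtain ⟨h, hh, hev⟩ := exists_hilb_eq (fun n ↦ (c.level 𝓜 n).map (Q.mkQ.restrictScalars R))
    (fun W hW m ↦ c.iSup_inf_le _ hker' hG' W hW m) hYfin hY
    (by rintro y hy n _ ⟨p, hp, rfl⟩; exact ⟨y • p, hY1 y hy n p hp, rfl⟩)
  refine ⟨fun s n ↦ ∑ u ∈ Finset.range (s + 1), h u n, fun s n ↦ ?_, ?_⟩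
  · rw [← c.hilbSum_eq _ hker' hvan, hilbSum]
    simp only [hh]
    push_cast
    rfl
  · have := sum_left_mem_evBinom₂ hev
    push_cast
    exact this

/-- The Hilbert function of the quotient of the Rees module of a stable filtration by that of a
smaller filtration. -/
theorem exists_filtLen_eq [IsLocalRing R] [IsNoetherianRing R] [IsNoetherianRing A]
    [Module.Finite A M] {𝓐 : ℕ → Submodule R A} [GradedAlgebra 𝓐]
    (hA : Algebra.adjoin R (𝓐 1 : Set A) = ⊤) {𝓜 : ℕ → Submodule R M}
    [DirectSum.Decomposition 𝓜] [SetLike.GradedSMul 𝓐 𝓜] (hI : GeneratedByLinearForms 𝓐 I)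
    {F F' : I.Filtration M} (hF : F.Stable) (hF' : ∀ i, IsHomog 𝓜 (F'.N i))
    (hvan : ∀ n i, n < i → piece 𝓜 (F.N i) n = ⊥) :
    ∃ h : ℕ → ℕ → ℕ, (∀ s n, filtLen 𝓜 (levels R F') (levels R F) s n = h s n) ∧
      (fun s n ↦ (h s n : ℤ)) ∈ evBinom₂ := by
  obtain ⟨Y, hYfin, hY, hY1⟩ := exists_reesAlgebra_generators hA hI
  have hfin := finite_submodule hF
  refine CoeffData.exists_filtLen_eq (B := reesAlgebra I) (filtrationCoeffData R F)
    (Submodule.submoduleOf F'.submodule F.submodule) (fun p ↦ F'.mem_submodule _)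
    (fun i n x hx ↦ hF' i n x hx) hvan hYfin hY ?_
  intro y hy n p hp i
  obtain ⟨a, ha, j, hj⟩ := hY1 y hy
  change (((y : A[X]) • (p : PolynomialModule A M)).coeff i) ∈ 𝓜 (n + 1)
  rw [hj, PolynomialModule.monomial_smul_apply]
  split_ifs
  · rw [add_comm n 1]
    exact SetLike.GradedSMul.smul_mem ha (hp _)
  · exact zero_mem _

end HilbertFunction

end CStar

namespace CStar

open IsLocalRing

/-! ### Lengths of graded pieces and the degree bound -/

section Piece

variable {R A M : Type*} [CommRing R] [CommRing A] [Algebra R A]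
  [AddCommGroup M] [Module R M] [Module A M] [IsScalarTower R A M] {𝓜 : ℕ → Submodule R M}

theorem smul_piece_le (𝔞 : Ideal R) (X : Submodule A M) (n : ℕ) :
    𝔞 • piece 𝓜 X n ≤ piece 𝓜 X n := Submodule.smul_le_right

theorem algebraMap_smul_mem {X : Submodule A M} {𝔞 : Ideal R} {n : ℕ} {x : M}
    (hx : x ∈ 𝔞 • piece 𝓜 X n) : x ∈ 𝔞.map (algebraMap R A) • X := by
  have h : x ∈ (𝔞.map (algebraMap R A) • X).restrictScalars R := by
    rw [Ideal.smul_restrictScalars]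
    exact Submodule.smul_mono le_rfl inf_le_left hx
  exact h

end Piece

section PieceLength

variable {R A M : Type*} [CommRing R] [IsLocalRing R] [CommRing A] [Algebra R A]
  [AddCommGroup M] [Module R M] [Module A M] [IsScalarTower R A M]
  {𝓐 : ℕ → Submodule R A} {𝓜 : ℕ → Submodule R M}

/-- The length of the degree `n` part of `X / (𝔪 ^ (s + 1) X + K)`. -/
noncomputable def pieceLen (𝓜 : ℕ → Submodule R M) (X K : Submodule A M) (s n : ℕ) : ℕ∞ :=
  relLen (maximalIdeal R ^ (s + 1) • piece 𝓜 X n ⊔ K.restrictScalars R) (piece 𝓜 X n)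

theorem pieceLen_eq_zero_of_le {X K : Submodule A M} (h : X ≤ K) (s n : ℕ) :
    pieceLen 𝓜 X K s n = 0 :=
  relLen_eq_zero (inf_le_left.trans (le_sup_of_le_right fun _ hx ↦ h hx))

theorem pieceLen_eq_zero_of_piece_eq_bot {X K : Submodule A M} {n : ℕ} (h : piece 𝓜 X n = ⊥)
    (s : ℕ) : pieceLen 𝓜 X K s n = 0 :=
  relLen_eq_zero (h ▸ bot_le)

/-- Exact additivity holds only with `𝔪 ^ (s + 1) X`, not `𝔪 ^ (s + 1) Y`, in the second summand;
comparing these two gives the upper and lower estimates that follow. -/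
theorem pieceLen_eq_add {X Y K : Submodule A M} (hY : Y ≤ X) (hK : K ≤ Y) (s n : ℕ) :
    pieceLen 𝓜 X K s n = pieceLen 𝓜 X Y s n +
      relLen (maximalIdeal R ^ (s + 1) • piece 𝓜 X n ⊔ K.restrictScalars R) (piece 𝓜 Y n) := by
  rw [pieceLen, relLen_eq_add _ (piece_mono 𝓜 hY n), pieceLen]
  congr 1
  refine relLen_inf_eq (le_antisymm (inf_le_inf_right _ ?_) ?_)
  · exact sup_le (sup_le le_sup_left (le_sup_of_le_right fun _ hx ↦ hK hx))
      (inf_le_left.trans le_sup_right)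
  · rintro x ⟨hx, hxX⟩
    refine ⟨?_, hxX⟩
    obtain ⟨u, hu, y, hy, rfl⟩ := Submodule.mem_sup.1 hx
    refine Submodule.add_mem_sup (Submodule.mem_sup_left hu) ⟨hy, ?_⟩
    have := sub_mem hxX.2 (smul_piece_le _ X n hu).2
    rwa [add_sub_cancel_left] at this

theorem pieceLen_le_add {X Y K : Submodule A M} (hY : Y ≤ X) (hK : K ≤ Y) (s n : ℕ) :
    pieceLen 𝓜 X K s n ≤ pieceLen 𝓜 X Y s n + pieceLen 𝓜 Y K s n := by
  rw [pieceLen_eq_add hY hK]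
  refine add_le_add le_rfl (relLen_antitone (inf_le_left.trans (sup_le_sup_right ?_ _)))
  exact Submodule.smul_mono le_rfl (piece_mono 𝓜 hY n)

/-- Superadditivity up to a shift: the Artin-Rees hypothesis puts `𝔪 ^ (s + 1) X ∩ Y` inside `𝔪 ^ (s
+ 1 - c) Y`, and homogeneity of `Y` passes this to degree `n`. -/
theorem add_le_pieceLen [DirectSum.Decomposition 𝓜] {X Y K : Submodule A M} (hY : Y ≤ X)
    (hK : K ≤ Y) (hYh : IsHomog 𝓜 Y) {s c : ℕ} (hc : c ≤ s)
    (h : ∀ x, x ∈ (maximalIdeal R).map (algebraMap R A) ^ (s + 1) • X → x ∈ Y →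
      x ∈ (maximalIdeal R).map (algebraMap R A) ^ (s + 1 - c) • Y) (n : ℕ) :
    pieceLen 𝓜 X Y s n + pieceLen 𝓜 Y K (s - c) n ≤ pieceLen 𝓜 X K s n := by
  rw [pieceLen_eq_add hY hK]
  refine add_le_add le_rfl (relLen_antitone ?_)
  rintro x ⟨hx, hxY⟩
  obtain ⟨u, hu, k, hk, rfl⟩ := Submodule.mem_sup.1 hx
  refine Submodule.add_mem_sup ?_ hk
  have huY : u ∈ Y := by
    have := sub_mem hxY.1 (hK hk)
    rwa [add_sub_cancel_right] at this
  have h1 := h u (by rw [← Ideal.map_pow]; exact algebraMap_smul_mem hu) huY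
  rw [← Ideal.map_pow] at h1
  rw [show s - c + 1 = s + 1 - c by omega]
  exact mem_smul_piece hYh _ h1 (smul_piece_le _ X n hu).2

/-- For `j ≤ n` the degree `j` part of `𝔐 ^ (s + 1 + n) X` lies in `𝔪 ^ (s + 1) Xⱼ`, because at most
`j` factors are linear. The pieces of different degrees are then added up along the filtration `S`.
-/
theorem sum_pieceLen_le [DirectSum.Decomposition 𝓜] [GradedAlgebra 𝓐] [SetLike.GradedSMul 𝓐 𝓜]
    (hA : Algebra.adjoin R (𝓐 1 : Set A) = ⊤) {X K : Submodule A M} (hX : IsHomog 𝓜 X)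
    (hK : IsHomog 𝓜 K) (s n : ℕ) :
    ∑ j ∈ Finset.range (n + 1), pieceLen 𝓜 X K s j ≤
      relLen ((irrelevantMax 𝓐 ^ (s + 1 + n) • X ⊔ K).restrictScalars R)
        (X.restrictScalars R) := by
  set U := (irrelevantMax 𝓐 ^ (s + 1 + n) • X ⊔ K).restrictScalars R with hU
  set S : ℕ → Submodule R M := fun j ↦ ⨆ k ∈ Finset.range j, piece 𝓜 X k with hS
  have hproj : ∀ j, ∀ x ∈ S j, gradedProj 𝓜 j x = 0 := by
    intro j
    change S j ≤ LinearMap.ker (gradedProj 𝓜 j)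
    refine iSup₂_le fun k hk x hx ↦ ?_
    exact gradedProj_of_mem_ne 𝓜 hx.2 (Finset.mem_range.1 hk).ne
  have hstep : ∀ j ≤ n, pieceLen 𝓜 X K s j ≤ relLen (U ⊔ S j) (piece 𝓜 X j) := by
    intro j hj
    refine relLen_antitone ?_
    rintro x ⟨hx, hxj⟩
    obtain ⟨v, hv, y, hy, rfl⟩ := Submodule.mem_sup.1 hx
    obtain ⟨u, hu, k, hk, rfl⟩ := Submodule.mem_sup.1 hv
    rw [← gradedProj_of_mem 𝓜 hxj.2, map_add, map_add, hproj j y hy, add_zero]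
    refine Submodule.add_mem_sup ?_ (hK j k hk)
    refine Submodule.smul_mono_left (Ideal.pow_le_pow_right ?_)
      (gradedProj_irrelevantMax_pow_smul hA hX _ hu j)
    omega
  have hsum : ∀ j ≤ n + 1, ∑ k ∈ Finset.range j, pieceLen 𝓜 X K s k ≤ relLen U (S j) := by
    intro j hj
    induction j with
    | zero => simp
    | succ j ih =>
      have hSj : S (j + 1) = S j ⊔ piece 𝓜 X j := by
        simp only [hS, Finset.range_add_one, Finset.iSup_insert, sup_comm]
      rw [Finset.sum_range_succ, add_comm, hSj, relLen_eq_add U le_sup_left]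
      refine add_le_add ((hstep j (by omega)).trans (relLen_mono le_sup_right)) (ih (by omega))
  refine (hsum _ le_rfl).trans (relLen_mono (iSup₂_le fun k _ ↦ inf_le_left))

/-- Uniform Artin-Rees for `I^(i+1)M ⊆ IⁱM`, applied `i` times: every step costs the same `c`, so
the total loss is linear in `i`. -/
theorem exists_pow_smul_inf_pow_le [IsNoetherianRing A] [Module.Finite A M] (I 𝔞 : Ideal A) :
    ∃ c : ℕ, ∀ (m i : ℕ) (x : M), x ∈ 𝔞 ^ m • (⊤ : Submodule A M) →
      x ∈ I ^ i • (⊤ : Submodule A M) → x ∈ 𝔞 ^ (m - c * i) • I ^ i • (⊤ : Submodule A M) := by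
  obtain ⟨c, hc⟩ := exists_pow_smul_inf_le (F := I.stableFiltration (⊤ : Submodule A M))
    (F' := succFiltration (I.stableFiltration (⊤ : Submodule A M)))
    (I.stableFiltration_stable ⊤) 𝔞
  refine ⟨c, fun m i ↦ ?_⟩
  induction i with
  | zero => intro x hx _; simpa using hx
  | succ i ih =>
    intro x hx hxI
    have h1 := ih x hx (Submodule.smul_mono_left (Ideal.pow_le_pow_right (Nat.le_succ i)) hxI)
    rw [mul_add, mul_one, Nat.sub_add_eq]
    by_cases h : c ≤ m - c * i
    · exact hc _ i x (by rwa [Nat.sub_add_cancel h]) hxI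
    · rw [Nat.sub_eq_zero_of_le (by omega), pow_zero, Ideal.one_eq_top, Submodule.top_smul]
      exact hxI

theorem exists_sum_filtLen_le [DirectSum.Decomposition 𝓜] [GradedAlgebra 𝓐]
    [SetLike.GradedSMul 𝓐 𝓜] [IsNoetherianRing A] [Module.Finite A M]
    (hA : Algebra.adjoin R (𝓐 1 : Set A) = ⊤) {I : Ideal A} (hI : GeneratedByLinearForms 𝓐 I)
    {D : ℕ} (hD : Module.supportDim A M ≤ D) : ∃ C : ℕ, ∀ s n,
      ∑ j ∈ Finset.range (n + 1),
        filtLen 𝓜 (levels R (succFiltration (I.stableFiltration (⊤ : Submodule A M))))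
          (levels R (I.stableFiltration (⊤ : Submodule A M))) s j ≤
      (C * (s + n + 1) ^ D : ℕ) := by
  obtain ⟨c, hc⟩ := exists_pow_smul_inf_pow_le (M := M) I (irrelevantMax 𝓐)
  obtain ⟨C, hC⟩ := exists_adicLen_le (irrelevantMax 𝓐) (length_quotient_irrelevantMax hA) (D + 1) M
    (hD.trans_lt (by exact_mod_cast Nat.lt_succ_self D))
  refine ⟨C * (c + 2) ^ D, fun s n ↦ ?_⟩
  set W : ℕ → Submodule A M := fun i ↦ I ^ i • ⊤ with hW
  have hWanti : Antitone W := fun a b h ↦ Submodule.smul_mono_left (Ideal.pow_le_pow_right h)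
  -- For `i ≤ n` this leaves `m - c i ≥ s + 1 + n`, the exponent needed in `sum_pieceLen_le`.
  -- Moreover `m + 1 ≤ (c + 2) (s + n + 1)`.
  set m := s + 1 + n + c * n with hm
  calc _ = ∑ j ∈ Finset.range (n + 1), ∑ i ∈ Finset.range (j + 1),
        pieceLen 𝓜 (W i) (W (i + 1)) s j := rfl
    _ ≤ ∑ j ∈ Finset.range (n + 1), ∑ i ∈ Finset.range (n + 1),
        pieceLen 𝓜 (W i) (W (i + 1)) s j :=
      Finset.sum_le_sum fun j hj ↦ Finset.sum_le_sum_of_subset (Finset.range_subset_range.2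
        (by have := Finset.mem_range.1 hj; omega))
    _ = ∑ i ∈ Finset.range (n + 1), ∑ j ∈ Finset.range (n + 1),
        pieceLen 𝓜 (W i) (W (i + 1)) s j := Finset.sum_comm
    _ ≤ ∑ i ∈ Finset.range (n + 1), relLen ((irrelevantMax 𝓐 ^ m • ⊤ : Submodule A M).restrictScalars
        R ⊔ (W (i + 1)).restrictScalars R) ((W i).restrictScalars R) := by
      refine Finset.sum_le_sum fun i hi ↦
        (sum_pieceLen_le hA (isHomog_pow hI i) (isHomog_pow hI (i + 1)) s n).trans
        (relLen_antitone ?_)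
      rintro x ⟨hx, hxi⟩
      obtain ⟨u, hu, y, hy, rfl⟩ := Submodule.mem_sup.1 hx
      rw [Submodule.restrictScalars_mem] at *
      have hui : u ∈ W i := by
        have := sub_mem hxi (hWanti (Nat.le_succ i) hy)
        rwa [add_sub_cancel_right] at this
      refine Submodule.add_mem_sup (Submodule.smul_mono_left (Ideal.pow_le_pow_right ?_)
        (hc m i u hu hui)) hy
      have : c * i ≤ c * n := Nat.mul_le_mul_left c (by have := Finset.mem_range.1 hi; omega)
      omega
    _ ≤ relLen ((irrelevantMax 𝓐 ^ m • ⊤ : Submodule A M).restrictScalars R)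
        ((W 0).restrictScalars R) := by
      -- The summands are graded pieces of the filtration of `M / 𝔐 ^ m M` by the images of `IⁱM`.
      rw [← sum_relLen_le (W := fun i ↦ (W i).restrictScalars R)
        (fun a b h x hx ↦ hWanti h hx) _ (n + 1)]
      exact le_self_add
    _ ≤ adicLen (irrelevantMax 𝓐) R M m := relLen_mono le_top
    _ ≤ (C * (m + 1) ^ D : ℕ) := by simpa [powBound] using hC m
    _ ≤ _ := by
      refine Nat.cast_le.2 ?_
      rw [mul_assoc, ← mul_pow]
      refine Nat.mul_le_mul_left _ (Nat.pow_le_pow_left ?_ _)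
      rw [hm]
      nlinarith [Nat.zero_le (c * s), Nat.zero_le c]

end PieceLength

end CStar

namespace CStar

open IsLocalRing

/-! ### Reductions and the comparison of the Hilbert sums -/

section Growth

theorem DegLT.comp_sub {e : ℕ} {f : ℕ → ℕ → ℤ} (hf : DegLT e f) (c : ℕ) :
    DegLT e (fun s n ↦ f (s - c) n) := by
  obtain ⟨C, n₀, hC, hf⟩ := hf
  refine ⟨(c + 1) * C, n₀ + c, by positivity, fun s n hs hn ↦ ?_⟩
  obtain ⟨t, rfl⟩ : ∃ t, s = t + c := ⟨s - c, by omega⟩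
  simp only [Nat.add_sub_cancel]
  push_cast
  have hle : ((t : ℤ) + n + 1) ^ e ≤ ((t : ℤ) + c + n + 1) ^ e := by gcongr; omega
  calc ((t : ℤ) + c + n + 1) * |f t n| ≤ ((c + 1) * ((t : ℤ) + n + 1)) * |f t n| := by
        gcongr
        nlinarith [mul_nonneg (Int.natCast_nonneg c) (Int.natCast_nonneg t),
          mul_nonneg (Int.natCast_nonneg c) (Int.natCast_nonneg n)]
    _ = (c + 1) * (((t : ℤ) + n + 1) * |f t n|) := by ring
    _ ≤ (c + 1) * (C * ((t : ℤ) + n + 1) ^ e) :=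
        mul_le_mul_of_nonneg_left (hf t n (by omega) (by omega)) (by positivity)
    _ ≤ (c + 1) * (C * ((t : ℤ) + c + n + 1) ^ e) := by gcongr
    _ = _ := by ring

theorem expansion_of_sum_le {D : ℕ} {f : ℕ → ℕ → ℕ∞} {v : ℕ → ℕ → ℕ} (hv : ∀ s n, f s n = v s n)
    (hev : (fun s n ↦ (v s n : ℤ)) ∈ evBinom₂) {C : ℕ}
    (hC : ∀ s n, ∑ j ∈ Finset.range (n + 1), f s j ≤ (C * (s + n + 1) ^ D : ℕ)) :
    ∃ (a : ℕ × ℕ →₀ ℤ) (n₀ : ℕ), (∀ s n, n₀ ≤ s → n₀ ≤ n →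
      (v s n : ℤ) = ∑ x ∈ a.support, a x * binom₂ x s n) ∧ ∀ x, D ≤ x.1 + x.2 → a x = 0 := by
  refine expansion_of_sum_degLT hev ⟨C, 0, by positivity, fun s n _ _ ↦ ?_⟩
  have h := hC s n
  simp only [hv] at h
  have h' : ∑ j ∈ Finset.range (n + 1), v s j ≤ C * (s + n + 1) ^ D := by exact_mod_cast h
  rw [abs_of_nonneg (Finset.sum_nonneg fun _ _ ↦ Int.natCast_nonneg _), pow_succ', mul_left_comm]
  refine mul_le_mul_of_nonneg_left ?_ (by positivity)
  exact_mod_cast h'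

end Growth

section Reduction

variable {A M : Type*} [CommRing A] [AddCommGroup M] [Module A M] {I J : Ideal A}

variable (M) in
/-- For `I ≤ J`, the filtration `i ↦ Jⁱ M`, as an `I`-filtration. -/
def powFiltration (h : I ≤ J) : I.Filtration M where
  N i := J ^ i • ⊤
  mono i := Submodule.smul_mono_left (Ideal.pow_le_pow_right i.le_succ)
  smul_le i := by
    rw [pow_succ', Submodule.mul_smul]
    exact Submodule.smul_mono_left h

theorem IsReduction.smul_pow_eq {n : ℕ}
    (h : ((I * J ^ n) • ⊤ : Submodule A M) = ((J ^ (n + 1)) • ⊤ : Submodule A M)) (k : ℕ) :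
    I • J ^ (n + k) • (⊤ : Submodule A M) = J ^ (n + k + 1) • (⊤ : Submodule A M) := by
  rw [show n + k + 1 = k + (n + 1) by ring, pow_add J k, Submodule.mul_smul, ← h,
    ← Submodule.mul_smul, ← Submodule.mul_smul]
  congr 1
  ring

/-- Here the reduction hypothesis becomes finiteness: `⨁ JⁱM tⁱ` is finite over the Rees algebra of
`I`. -/
theorem IsReduction.stable (hIJ : I ≤ J) (h : IsReduction M I J) :
    (powFiltration M hIJ).Stable := by
  obtain ⟨n, -, h⟩ := h
  refine ⟨n, fun m hm ↦ ?_⟩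
  obtain ⟨k, rfl⟩ := Nat.exists_eq_add_of_le hm
  exact IsReduction.smul_pow_eq h k

theorem IsReduction.exists_pow_smul_le (h : IsReduction M I J) :
    ∃ n, ∀ i, J ^ (i + n) • (⊤ : Submodule A M) ≤ I ^ i • ⊤ := by
  obtain ⟨n, -, h⟩ := h
  refine ⟨n, fun i ↦ ?_⟩
  suffices H : J ^ (i + n) • (⊤ : Submodule A M) = I ^ i • J ^ n • ⊤ from
    H.trans_le (Submodule.smul_mono le_rfl le_top)
  induction i with
  | zero => simp
  | succ i ih =>
    rw [show i + 1 + n = n + i + 1 by ring, ← IsReduction.smul_pow_eq h, add_comm n, ih, pow_succ',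
      Submodule.mul_smul]

end Reduction

section Comparison

variable {R A M : Type*} [CommRing R] [IsLocalRing R] [CommRing A] [Algebra R A]
  [AddCommGroup M] [Module R M] [Module A M] [IsScalarTower R A M]
  {𝓐 : ℕ → Submodule R A} {𝓜 : ℕ → Submodule R M}

theorem filtLen_mono (𝓜 G' G : ℕ → Submodule R M) {s t : ℕ} (h : s ≤ t) (n : ℕ) :
    filtLen 𝓜 G' G s n ≤ filtLen 𝓜 G' G t n :=
  Finset.sum_le_sum fun _ _ ↦ relLen_antitone (inf_le_left.trans (sup_le_sup_right
    (Submodule.smul_mono_left (Ideal.pow_le_pow_right (by omega))) _))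

/-- Since `J^(i+m)M ⊆ IⁱM`, the `i`-th term is bounded by `m` consecutive quotients `J^(i+a)M /
J^(i+a+1)M`; for each `a`, the sum over `i` is part of the Hilbert sum of `J`. -/
theorem filtLen_powFiltration_le [DirectSum.Decomposition 𝓜] [SetLike.GradedSMul 𝓐 𝓜]
    {I J : Ideal A} (hIJ : I ≤ J) (hJ : GeneratedByLinearForms 𝓐 J) {m : ℕ}
    (hm : ∀ i, J ^ (i + m) • (⊤ : Submodule A M) ≤ I ^ i • ⊤) (s n : ℕ) :
    filtLen 𝓜 (levels R (I.stableFiltration (⊤ : Submodule A M)))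
        (levels R (powFiltration M hIJ)) s n ≤
      m * filtLen 𝓜 (levels R (succFiltration (J.stableFiltration (⊤ : Submodule A M))))
        (levels R (J.stableFiltration (⊤ : Submodule A M))) s n := by
  set W : ℕ → Submodule A M := fun i ↦ J ^ i • ⊤ with hW
  have hWanti : Antitone W := fun a b h ↦ Submodule.smul_mono_left (Ideal.pow_le_pow_right h)
  have hstep : ∀ i, pieceLen 𝓜 (W i) (I ^ i • ⊤) s n ≤
      ∑ a ∈ Finset.range m, pieceLen 𝓜 (W (i + a)) (W (i + a + 1)) s n := by
    intro i
    set X : Submodule R M := maximalIdeal R ^ (s + 1) • piece 𝓜 (W i) n ⊔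
      (W (i + m)).restrictScalars R with hX
    have h1 : pieceLen 𝓜 (W i) (I ^ i • ⊤) s n ≤ relLen X (piece 𝓜 (W i) n) :=
      relLen_antitone (inf_le_left.trans (sup_le_sup_left (fun _ hx ↦ hm i hx) _))
    have h2 := sum_relLen_le (W := fun a ↦ piece 𝓜 (W (i + a)) n)
      (fun a b h ↦ piece_mono 𝓜 (hWanti (by omega)) n) X m
    rw [relLen_eq_zero (U := X) (V := piece 𝓜 (W (i + m)) n) (inf_le_left.trans le_sup_right),
      add_zero] at h2
    refine h1.trans (h2.symm.le.trans (Finset.sum_le_sum fun a _ ↦ relLen_antitone ?_))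
    rintro x ⟨hx, hxW⟩
    obtain ⟨u, hu, v, hv, rfl⟩ := Submodule.mem_sup.1 hx
    refine Submodule.add_mem_sup (Submodule.mem_sup_left ?_) ⟨hv, ?_⟩
    · exact Submodule.smul_mono le_rfl (piece_mono 𝓜 (hWanti (Nat.le_add_right i a)) n) hu
    · have := sub_mem hxW.2 (smul_piece_le _ _ n hu).2
      rwa [add_sub_cancel_left] at this
  have hzero : ∀ k, n < k → pieceLen 𝓜 (W k) (W (k + 1)) s n = 0 := fun k hk ↦
    pieceLen_eq_zero_of_piece_eq_bot (piece_pow_eq_bot hJ hk) s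
  calc _ ≤ ∑ i ∈ Finset.range (n + 1), ∑ a ∈ Finset.range m,
        pieceLen 𝓜 (W (i + a)) (W (i + a + 1)) s n := Finset.sum_le_sum fun i _ ↦ hstep i
    _ = ∑ a ∈ Finset.range m, ∑ i ∈ Finset.range (n + 1),
        pieceLen 𝓜 (W (i + a)) (W (i + a + 1)) s n := Finset.sum_comm
    _ ≤ ∑ a ∈ Finset.range m, ∑ k ∈ Finset.range (n + 1), pieceLen 𝓜 (W k) (W (k + 1)) s n := by
      refine Finset.sum_le_sum fun a _ ↦ ?_
      have h3 := Finset.sum_range_add (fun k ↦ pieceLen 𝓜 (W k) (W (k + 1)) s n) a (n + 1)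
      have h4 := Finset.sum_range_add (fun k ↦ pieceLen 𝓜 (W k) (W (k + 1)) s n) (n + 1) a
      rw [Finset.sum_eq_zero (s := Finset.range a) (fun k _ ↦ hzero (n + 1 + k) (by omega)),
        add_zero, add_comm (n + 1) a] at h4
      rw [← h4, h3]
      simp only [add_comm a]
      exact le_add_self
    _ = _ := by
      rw [Finset.sum_const, Finset.card_range, nsmul_eq_mul]
      rfl

/-- The shift of index drops the term `i = 0`, where both modules are `M`, and adds `i = n + 1`,
which has no part of degree `n`. -/
theorem sum_pieceLen_succ_eq [DirectSum.Decomposition 𝓜] [SetLike.GradedSMul 𝓐 𝓜]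
    {I J : Ideal A} (hIJ : I ≤ J) (hJ : GeneratedByLinearForms 𝓐 J) (s n : ℕ) :
    ∑ i ∈ Finset.range (n + 1),
      pieceLen 𝓜 (J ^ (i + 1) • (⊤ : Submodule A M)) (I ^ (i + 1) • (⊤ : Submodule A M)) s n =
    filtLen 𝓜 (levels R (I.stableFiltration (⊤ : Submodule A M)))
      (levels R (powFiltration M hIJ)) s n := by
  change _ = ∑ i ∈ Finset.range (n + 1),
      pieceLen 𝓜 (J ^ i • (⊤ : Submodule A M)) (I ^ i • (⊤ : Submodule A M)) s n
  rw [Finset.sum_range_succ, pieceLen_eq_zero_of_piece_eq_bot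
    (piece_pow_eq_bot hJ (Nat.lt_succ_self n)), Finset.sum_range_succ', pieceLen_eq_zero_of_le
    (X := J ^ 0 • (⊤ : Submodule A M)) (by simp)]

variable [DirectSum.Decomposition 𝓜] [SetLike.GradedSMul 𝓐 𝓜] [IsNoetherianRing A]
  [Module.Finite A M]

theorem exists_filtLen_add_le {I J : Ideal A} (hIJ : I ≤ J) (hI : GeneratedByLinearForms 𝓐 I)
    (hJ : GeneratedByLinearForms 𝓐 J) (hred : IsReduction M I J) :
    let v : Ideal A → ℕ → ℕ → ℕ∞ := fun K ↦
      filtLen 𝓜 (levels R (succFiltration (K.stableFiltration (⊤ : Submodule A M))))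
        (levels R (K.stableFiltration (⊤ : Submodule A M)))
    let q : ℕ → ℕ → ℕ∞ := filtLen 𝓜 (levels R (I.stableFiltration (⊤ : Submodule A M)))
        (levels R (powFiltration M hIJ))
    ∃ c, ∀ s n, c ≤ s → q s n + v I (s - c) n ≤ v J s n + q s n ∧
      v J s n + q (s - c) n ≤ q s n + v I s n := by
  intro v q
  obtain ⟨c₁, hc₁⟩ := exists_pow_smul_inf_le (F' := I.stableFiltration (⊤ : Submodule A M))
    (hred.stable hIJ) ((maximalIdeal R).map (algebraMap R A))
  obtain ⟨c₂, hc₂⟩ := exists_pow_smul_inf_le (F' := succFiltration (powFiltration M hIJ))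
    (hred.stable hIJ) ((maximalIdeal R).map (algebraMap R A))
  refine ⟨max c₁ c₂, fun s n hs ↦ ?_⟩
  set c := max c₁ c₂ with hc
  -- The middle quantity, filtered once through `IⁱM` and once through `J^(i+1)M`; each route gives
  -- a lower bound with a shift and an upper bound without.
  set P : ℕ → ℕ∞ := fun i ↦ pieceLen 𝓜 (J ^ i • (⊤ : Submodule A M))
    (I ^ (i + 1) • (⊤ : Submodule A M)) s n with hP
  have hle : ∀ i, I ^ i • (⊤ : Submodule A M) ≤ J ^ i • ⊤ := fun i ↦
    Submodule.smul_mono_left (Ideal.pow_right_mono hIJ i)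
  have hsucc : ∀ (K : Ideal A) i, K ^ (i + 1) • (⊤ : Submodule A M) ≤ K ^ i • ⊤ := fun K i ↦
    Submodule.smul_mono_left (Ideal.pow_le_pow_right i.le_succ)
  have hmono : ∀ (c' : ℕ) (X : Submodule A M), c' ≤ c →
      ∀ x ∈ (maximalIdeal R).map (algebraMap R A) ^ (s + 1 - c') • X,
        x ∈ (maximalIdeal R).map (algebraMap R A) ^ (s + 1 - c) • X := fun c' X h x hx ↦
    Submodule.smul_mono_left (Ideal.pow_le_pow_right (by omega)) hx
  have hq : ∀ s n, ∑ i ∈ Finset.range (n + 1), pieceLen 𝓜 (J ^ (i + 1) • (⊤ : Submodule A M))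
      (I ^ (i + 1) • (⊤ : Submodule A M)) s n = q s n := sum_pieceLen_succ_eq hIJ hJ
  constructor
  · calc q s n + v I (s - c) n ≤ ∑ i ∈ Finset.range (n + 1), P i := by
          refine (Finset.sum_add_distrib.symm.le).trans (Finset.sum_le_sum fun i _ ↦ ?_)
          refine add_le_pieceLen (hle i) (hsucc I i) (isHomog_pow hI i) hs (fun x hx hx' ↦ ?_) n
          refine hmono c₁ _ (le_max_left _ _) x (hc₁ _ i x ?_ hx')
          rwa [Nat.sub_add_cancel (by omega)]
      _ ≤ v J s n + q s n := by
          rw [← hq]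
          refine (Finset.sum_le_sum fun i _ ↦ ?_).trans Finset.sum_add_distrib.le
          exact pieceLen_le_add (hsucc J i) (hle (i + 1)) s n
  · calc v J s n + q (s - c) n ≤ ∑ i ∈ Finset.range (n + 1), P i := by
          rw [← hq]
          refine (Finset.sum_add_distrib.symm.le).trans (Finset.sum_le_sum fun i _ ↦ ?_)
          refine add_le_pieceLen (hsucc J i) (hle (i + 1)) (isHomog_pow hJ (i + 1)) hs
            (fun x hx hx' ↦ ?_) n
          refine hmono c₂ _ (le_max_right _ _) x (hc₂ _ i x ?_ hx')
          rwa [Nat.sub_add_cancel (by omega)]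
      _ ≤ q s n + v I s n := by
          refine (Finset.sum_le_sum fun i _ ↦ ?_).trans Finset.sum_add_distrib.le
          exact pieceLen_le_add (hle i) (hsucc I i) s n

theorem topCoeff_hilbSum_eq [GradedAlgebra 𝓐] [IsNoetherianRing R]
    (hA : Algebra.adjoin R (𝓐 1 : Set A) = ⊤) {D : ℕ}
    (hD : Module.supportDim A M ≤ D) {I J : Ideal A} (hIJ : I ≤ J)
    (hI : GeneratedByLinearForms 𝓐 I) (hJ : GeneratedByLinearForms 𝓐 J)
    (hred : IsReduction M I J) :
    (∃ a, IsHilbertExpansion (hilbSum (internalGrading M I 𝓜)) D a) ∧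
    (∃ a, IsHilbertExpansion (hilbSum (internalGrading M J 𝓜)) D a) ∧
    ∀ k < D, topCoeff (hilbSum (internalGrading M I 𝓜)) D k =
      topCoeff (hilbSum (internalGrading M J 𝓜)) D k := by
  have key : ∀ {K : Ideal A}, GeneratedByLinearForms 𝓐 K → ∃ v : ℕ → ℕ → ℕ,
      (∀ s n, filtLen 𝓜 (levels R (succFiltration (K.stableFiltration (⊤ : Submodule A M))))
        (levels R (K.stableFiltration (⊤ : Submodule A M))) s n = v s n) ∧
      (fun s n ↦ (v s n : ℤ)) ∈ evBinom₂ := fun {K} hK ↦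
    exists_filtLen_eq hA hK (K.stableFiltration_stable ⊤) (fun i ↦ isHomog_pow hK (i + 1))
      fun n i h ↦ piece_pow_eq_bot hK h
  obtain ⟨vI, hvI, hevI⟩ := key hI
  obtain ⟨vJ, hvJ, hevJ⟩ := key hJ
  obtain ⟨q, hq, hevq⟩ := exists_filtLen_eq (F := powFiltration M hIJ)
    (F' := I.stableFiltration ⊤) (𝓜 := 𝓜) hA hI (hred.stable hIJ) (fun i ↦ isHomog_pow hI i)
    fun n i h ↦ piece_pow_eq_bot hJ h
  obtain ⟨CI, hCI⟩ := exists_sum_filtLen_le (𝓜 := 𝓜) hA hI hD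
  obtain ⟨CJ, hCJ⟩ := exists_sum_filtLen_le (𝓜 := 𝓜) hA hJ hD
  obtain ⟨m, hm⟩ := hred.exists_pow_smul_le
  obtain ⟨aI, nI, haI, haI0⟩ := expansion_of_sum_le hvI hevI hCI
  obtain ⟨aJ, nJ, haJ, haJ0⟩ := expansion_of_sum_le hvJ hevJ hCJ
  obtain ⟨aq, nq, haq, haq0⟩ := expansion_of_sum_le (C := m * CJ) (D := D) hq hevq (fun s n ↦ by
    refine (Finset.sum_le_sum fun j _ ↦ filtLen_powFiltration_le hIJ hJ hm s j).trans ?_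
    rw [← Finset.mul_sum, mul_assoc, Nat.cast_mul]
    exact mul_le_mul_right (hCJ s n) _)
  have hI' := fun s n ↦ (hilbSum_internalGrading (M := M) (𝓜 := 𝓜) hI s n).trans (hvI s n)
  have hJ' := fun s n ↦ (hilbSum_internalGrading (M := M) (𝓜 := 𝓜) hJ s n).trans (hvJ s n)
  have HI := exists_isHilbertExpansion hI' haI haI0
  have HJ := exists_isHilbertExpansion hJ' haJ haJ0
  refine ⟨HI, HJ, fun k hk ↦ topCoeff_eq_of_degLT hI' hJ' HI HJ ?_ hk⟩
  obtain ⟨c, hc⟩ := exists_filtLen_add_le (𝓜 := 𝓜) hIJ hI hJ hred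
  -- The two estimates give `h_I(s) - h_J(s) ≤ h_I(s) - h_I(s - c)` and `h_J(s) - h_I(s) ≤ q(s) -
  -- q(s - c)`. Both right-hand sides are nonnegative, so their sum bounds the absolute value.
  have h1 := ((DegLT.shift_sub haI (fun x _ ↦ haI0 x) c 0).add
    (DegLT.shift_sub haq (fun x _ ↦ haq0 x) c 0)).comp_sub c
  refine h1.of_abs_le (n₁ := c) fun s n hs _ ↦ ?_
  obtain ⟨h2, h3⟩ := hc s n hs
  simp only [hvI, hvJ, hq] at h2 h3
  have h4 := filtLen_mono 𝓜 (levels R (succFiltration (I.stableFiltration (⊤ : Submodule A M))))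
    (levels R (I.stableFiltration (⊤ : Submodule A M))) (Nat.sub_le s c) n
  have h5 := filtLen_mono 𝓜 (levels R (I.stableFiltration (⊤ : Submodule A M)))
    (levels R (powFiltration M hIJ)) (Nat.sub_le s c) n
  simp only [hvI, hq] at h4 h5
  norm_cast at h2 h3 h4 h5
  rw [Nat.sub_add_cancel hs, add_zero]
  refine le_trans ?_ (le_abs_self _)
  rw [abs_le]
  omega

end Comparison

end CStar

namespace CStar

/-! ### Dimension under finite restriction of scalars -/

section Integral

/-- Lying over and going up lift chains of primes; incomparability keeps contracted chains strict.
-/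
theorem ringKrullDim_eq_of_isIntegral {S T : Type*} [CommRing S] [CommRing T] [Algebra S T]
    [Algebra.IsIntegral S T] (h : Function.Injective (algebraMap S T)) :
    ringKrullDim S = ringKrullDim T := by
  refine le_antisymm (iSup_le fun l ↦ ?_) ?_
  · obtain ⟨Q, -, hQ, hQc⟩ := Ideal.exists_ideal_over_prime_of_isIntegral l.head.asIdeal
      (⊥ : Ideal T) (by
        rw [← RingHom.ker_eq_comap_bot, (RingHom.injective_iff_ker_eq_bot _).1 h]
        exact bot_le)
    have : Q.LiesOver l.head.asIdeal := ⟨hQc.symm⟩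
    obtain ⟨L, hL, -⟩ := Ideal.exists_ltSeries_of_hasGoingUp l Q
    rw [← hL]
    exact Order.LTSeries.length_le_krullDim L
  · exact Order.krullDim_le_of_strictMono (PrimeSpectrum.comap (algebraMap S T))
      fun p q hpq ↦ Ideal.IsIntegral.comap_lt_comap (I := p.asIdeal) (J := q.asIdeal) hpq

/-- The dimension of a module does not change under restriction of scalars along a ring
homomorphism over which the module is finite. -/
theorem supportDim_eq_of_finite (S T N : Type*) [CommRing S] [CommRing T] [Algebra S T]
    [AddCommGroup N] [Module S N] [Module T N] [IsScalarTower S T N] [Module.Finite S N] :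
    Module.supportDim S N = Module.supportDim T N := by
  have : Module.Finite T N := Module.Finite.of_restrictScalars_finite S T N
  rw [Module.supportDim_eq_ringKrullDim_quotient_annihilator,
    Module.supportDim_eq_ringKrullDim_quotient_annihilator]
  have hann : Module.annihilator S N = (Module.annihilator T N).comap (algebraMap S T) := by
    ext s
    simp only [Ideal.mem_comap, Module.mem_annihilator, algebraMap_smul]
  let g := Ideal.quotientMap (Module.annihilator T N) (algebraMap S T) hann.le
  let := g.toAlgebra
  have hint : Algebra.IsIntegral (S ⧸ Module.annihilator S N) (T ⧸ Module.annihilator T N) := by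
    refine ⟨fun x ↦ ?_⟩
    obtain ⟨t, rfl⟩ := Ideal.Quotient.mk_surjective x
    -- Cayley-Hamilton for multiplication by `t` on the finite `S`-module `N`: the value of `p` at
    -- `t` annihilates `N`.
    obtain ⟨p, hp, hpt⟩ := LinearMap.exists_monic_and_aeval_eq_zero S (Algebra.lsmul S S N t)
    refine ⟨p.map (Ideal.Quotient.mk _), hp.map _, ?_⟩
    rw [Polynomial.eval₂_map]
    change Polynomial.eval₂ (g.comp (Ideal.Quotient.mk _)) _ p = 0
    rw [Ideal.quotientMap_comp_mk, ← Polynomial.hom_eval₂, Ideal.Quotient.eq_zero_iff_mem,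
      Module.mem_annihilator]
    intro x
    rw [Polynomial.aeval_algHom_apply] at hpt
    exact LinearMap.congr_fun hpt x
  exact ringKrullDim_eq_of_isIntegral (Ideal.quotientMap_injective' hann.ge)

end Integral

/-! ### Annihilators of the associated graded modules up to radical -/

section Annihilator

open Polynomial

variable {A M : Type*} [CommRing A] [AddCommGroup M] [Module A M]

/-- An element that gains one filtration step gains `k` steps when raised to the `k`-th power. In
the induction, multiplying `b ^ k x` by `t ^ k` brings it back to the range where the hypothesis on
`b` applies. -/
theorem pow_smul_coeff_mem {W : ℕ → Submodule A M} {b : A[X]}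
    (hb : ∀ x : PolynomialModule A M, (∀ i, x.coeff i ∈ W i) → ∀ i, (b • x).coeff i ∈ W (i + 1))
    (k : ℕ) (x : PolynomialModule A M) (hx : ∀ i, x.coeff i ∈ W i) (i : ℕ) :
    (b ^ k • x).coeff i ∈ W (i + k) := by
  induction k generalizing i with
  | zero => simpa using hx i
  | succ k ih =>
    have h := hb (monomial k (1 : A) • b ^ k • x) (fun j ↦ by
      rw [PolynomialModule.monomial_smul_apply]
      split_ifs with hj
      · rw [one_smul]
        have := ih (j - k)
        rwa [Nat.sub_add_cancel hj] at this
      · exact zero_mem _) (i + k)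
    rwa [smul_comm, PolynomialModule.monomial_smul_apply, if_pos (Nat.le_add_left _ _), one_smul,
      Nat.add_sub_cancel, ← mul_smul, ← pow_succ'] at h

variable {I J : Ideal A} {m : ℕ}

theorem pow_smul_coeff_mem_of_le (hIJ : I ≤ J)
    (hm : ∀ i, J ^ (i + m) • (⊤ : Submodule A M) ≤ I ^ i • ⊤) {b : A[X]}
    (hb : ∀ x : PolynomialModule A M, (∀ i, x.coeff i ∈ I ^ i • (⊤ : Submodule A M)) →
      ∀ i, (b • x).coeff i ∈ I ^ (i + 1) • (⊤ : Submodule A M))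
    (y : PolynomialModule A M) (hy : ∀ i, y.coeff i ∈ J ^ i • (⊤ : Submodule A M)) (i : ℕ) :
    (b ^ (m + 1) • y).coeff i ∈ J ^ (i + 1) • (⊤ : Submodule A M) := by
  have hsum : y = ∑ l ∈ y.coeff.support, PolynomialModule.single A l (y.coeff l) := by
    apply PolynomialModule.coeff_injective
    rw [PolynomialModule.coeff_sum]
    exact (Finsupp.sum_single y.coeff).symm
  rw [hsum, Finset.smul_sum, PolynomialModule.coeff_sum, Finsupp.finsetSum_apply]
  refine sum_mem fun l _ ↦ ?_
  -- A coefficient in `J^l M` lies in `I^(l-m)M`, so the monomial is lowered to `t`-degree `l - m`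
  -- (read as `0` for `l < m`). The power `t ^ min l m` split off costs at most `m` steps, and `b ^
  -- (m + 1)` gains `m + 1`.
  have h1 : PolynomialModule.single A l (y.coeff l) =
      monomial (min l m) (1 : A) • PolynomialModule.single A (l - m) (y.coeff l) := by
    rw [PolynomialModule.monomial_smul_single, one_smul]
    congr 1
    omega
  rw [h1, smul_comm, PolynomialModule.monomial_smul_apply]
  split_ifs with hl
  · rw [one_smul]
    have h2 := pow_smul_coeff_mem hb (m + 1) (PolynomialModule.single A (l - m) (y.coeff l))
      (fun j ↦ by
        rw [PolynomialModule.coeff_single, Finsupp.single_apply]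
        split_ifs with hj
        · subst hj
          by_cases hlm : m ≤ l
          · refine hm _ ?_
            rw [Nat.sub_add_cancel hlm]
            exact hy l
          · rw [Nat.sub_eq_zero_of_le (by omega)]
            simp
        · exact zero_mem _) (i - min l m)
    exact Submodule.smul_mono_left ((Ideal.pow_right_mono hIJ _).trans
      (Ideal.pow_le_pow_right (by omega))) h2
  · exact zero_mem _

/-- View `y` in the `J`-filtration, gain `m + 1` steps there, and return by `J^(i+1+m)M ⊆ I^(i+1)M`.
-/
theorem pow_smul_coeff_mem_of_ge (hIJ : I ≤ J)
    (hm : ∀ i, J ^ (i + m) • (⊤ : Submodule A M) ≤ I ^ i • ⊤) {b : A[X]}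
    (hb : ∀ x : PolynomialModule A M, (∀ i, x.coeff i ∈ J ^ i • (⊤ : Submodule A M)) →
      ∀ i, (b • x).coeff i ∈ J ^ (i + 1) • (⊤ : Submodule A M))
    (y : PolynomialModule A M) (hy : ∀ i, y.coeff i ∈ I ^ i • (⊤ : Submodule A M)) (i : ℕ) :
    (b ^ (m + 1) • y).coeff i ∈ I ^ (i + 1) • (⊤ : Submodule A M) := by
  have h := pow_smul_coeff_mem hb (m + 1) y
    (fun j ↦ Submodule.smul_mono_left (Ideal.pow_right_mono hIJ j) (hy j)) i
  refine hm _ ?_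
  rwa [add_right_comm, add_assoc]

end Annihilator

end CStar

namespace CStar

open Polynomial

/-! ### Equality of the dimensions of `G_I(M)` and `G_J(M)` -/

section SupportDim

theorem supportDim_quotient_smul_top {S : Type*} [CommRing S] (𝔞 : Ideal S) (N : Type*)
    [AddCommGroup N] [Module S N] [Module.Finite S N] :
    Module.supportDim (S ⧸ 𝔞) (N ⧸ (𝔞 • ⊤ : Submodule S N)) =
      Module.supportDim S (N ⧸ (𝔞 • ⊤ : Submodule S N)) :=
  (supportDim_eq_of_finite S (S ⧸ 𝔞) (N ⧸ (𝔞 • ⊤ : Submodule S N))).symm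

variable {A M : Type*} [CommRing A] [AddCommGroup M] [Module A M] {I J : Ideal A}

instance [IsNoetherianRing A] [Module.Finite A M] :
    Module.Finite (reesAlgebra I) (ReesModule M I) :=
  finite_submodule (I.stableFiltration_stable ⊤)

theorem mem_annihilator_assocGradedModule {b : reesAlgebra I} :
    b ∈ Module.annihilator (reesAlgebra I) (AssocGradedModule M I) ↔
      ∀ x : PolynomialModule A M, (∀ i, x.coeff i ∈ I ^ i • (⊤ : Submodule A M)) →
        ∀ i, ((b : A[X]) • x).coeff i ∈ I ^ (i + 1) • (⊤ : Submodule A M) := by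
  rw [Module.mem_annihilator]
  constructor
  · intro h x hx
    let z : ReesModule M I := ⟨x, (Ideal.Filtration.mem_submodule _ _).2 hx⟩
    have hz := h (Submodule.Quotient.mk z)
    rw [← Submodule.Quotient.mk_smul, Submodule.Quotient.mk_eq_zero,
      mem_reesIdeal_smul_top_iff] at hz
    exact hz
  · intro h z
    obtain ⟨z, rfl⟩ := Submodule.Quotient.mk_surjective _ z
    rw [← Submodule.Quotient.mk_smul, Submodule.Quotient.mk_eq_zero, mem_reesIdeal_smul_top_iff]
    exact h z.1 ((Ideal.Filtration.mem_submodule _ _).1 z.2)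

theorem supportDim_assocGradedModule [IsNoetherianRing A] [Module.Finite A M] :
    Module.supportDim (AssocGradedRing I) (AssocGradedModule M I) =
      Module.supportDim (reesAlgebra I) (AssocGradedModule M I) :=
  supportDim_quotient_smul_top (reesIdeal I) (ReesModule M I)

theorem supportDim_assocGradedModule_eq [IsNoetherianRing A] [Module.Finite A M] (hIJ : I ≤ J)
    (h : IsReduction M I J) :
    Module.supportDim (AssocGradedRing I) (AssocGradedModule M I) =
      Module.supportDim (AssocGradedRing J) (AssocGradedModule M J) := by
  rw [supportDim_assocGradedModule, supportDim_assocGradedModule]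
  have hle : reesAlgebra I ≤ reesAlgebra J := fun f hf i ↦ Ideal.pow_right_mono hIJ i (hf i)
  let := (Subalgebra.inclusion hle).toAlgebra
  let : Module (reesAlgebra I) (AssocGradedModule M J) :=
    Module.compHom _ (Subalgebra.inclusion hle).toRingHom
  have : IsScalarTower (reesAlgebra I) (reesAlgebra J) (AssocGradedModule M J) :=
    IsScalarTower.of_algebraMap_smul fun _ _ ↦ rfl
  -- `G_J(M)` is a quotient of `⨁ JⁱM tⁱ`, hence finite over the Rees algebra of `I`, and its
  -- dimension may be computed there.
  let π : (powFiltration M hIJ).submodule →ₗ[reesAlgebra I] AssocGradedModule M J :=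
    { toFun := fun x ↦ Submodule.Quotient.mk (⟨x.1, x.2⟩ : ReesModule M J)
      map_add' := fun _ _ ↦ rfl
      map_smul' := fun _ _ ↦ rfl }
  have hπ : Function.Surjective π := fun z ↦ by
    obtain ⟨z, rfl⟩ := Submodule.Quotient.mk_surjective _ z
    exact ⟨⟨z.1, z.2⟩, rfl⟩
  have := finite_submodule (h.stable hIJ)
  have : Module.Finite (reesAlgebra I) (AssocGradedModule M J) := Module.Finite.of_surjective π hπ
  rw [← supportDim_eq_of_finite (reesAlgebra I) (reesAlgebra J) (AssocGradedModule M J),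
    Module.supportDim, Module.supportDim]
  obtain ⟨m, hm⟩ := h.exists_pow_smul_le
  have hann : ∀ b : reesAlgebra I, b ∈ Module.annihilator (reesAlgebra I) (AssocGradedModule M J) ↔
      Subalgebra.inclusion hle b ∈ Module.annihilator (reesAlgebra J) (AssocGradedModule M J) :=
    fun b ↦ by rw [Module.mem_annihilator, Module.mem_annihilator]; rfl
  -- The `(m + 1)`-st power of an element of either annihilator lies in the other, so the same
  -- primes contain both.
  suffices H : Module.support (reesAlgebra I) (AssocGradedModule M I) =
      Module.support (reesAlgebra I) (AssocGradedModule M J) by rw [H]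
  rw [Module.support_eq_zeroLocus, Module.support_eq_zeroLocus]
  ext p
  constructor
  · intro hp b hb
    refine p.2.mem_of_pow_mem (m + 1) (hp (mem_annihilator_assocGradedModule.2 ?_))
    rw [SetLike.mem_coe, hann, mem_annihilator_assocGradedModule] at hb
    exact pow_smul_coeff_mem_of_ge hIJ hm hb
  · intro hp b hb
    refine p.2.mem_of_pow_mem (m + 1) (hp ?_)
    rw [SetLike.mem_coe, hann, mem_annihilator_assocGradedModule]
    exact pow_smul_coeff_mem_of_le hIJ hm (mem_annihilator_assocGradedModule.1 hb)

end SupportDim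

end CStar

theorem theorem3p3 {R A M : Type*} [CommRing R] [IsLocalRing R] [IsNoetherianRing R]
    [CommRing A] [Algebra R A] [IsNoetherianRing A]
    (𝓐 : ℕ → Submodule R A) [GradedAlgebra 𝓐] (hA : Algebra.adjoin R (𝓐 1 : Set A) = ⊤)
    [AddCommGroup M] [Module R M] [Module A M] [IsScalarTower R A M] [Module.Finite A M]
    (𝓜 : ℕ → Submodule R M) [DirectSum.Decomposition 𝓜] [SetLike.GradedSMul 𝓐 𝓜]
    (D : ℕ) (hD : Module.supportDim A M = D)
    (I J : Ideal A) (hIJ : I ≤ J)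
    (hI : CStar.GeneratedByLinearForms 𝓐 I) (hJ : CStar.GeneratedByLinearForms 𝓐 J)
    (hht : 0 < CStar.moduleHeight M I) (hred : CStar.IsReduction M I J) :
    (∃ a, CStar.IsHilbertExpansion (CStar.hilbSum (CStar.internalGrading M I 𝓜)) D a) ∧
    (∃ a, CStar.IsHilbertExpansion (CStar.hilbSum (CStar.internalGrading M J 𝓜)) D a) ∧
    ∀ k < D, CStar.cStar 𝓜 I D k = CStar.cStar 𝓜 J D k := by
  obtain ⟨hI', hJ', hc⟩ := CStar.topCoeff_hilbSum_eq (𝓜 := 𝓜) hA hD.le hIJ hI hJ hred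
  refine ⟨hI', hJ', fun k hk ↦ ?_⟩
  rw [CStar.cStar, CStar.cStar, CStar.cMult, CStar.cMult,
    CStar.supportDim_assocGradedModule_eq hIJ hred, hc k hk]
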